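/- **Setting.** Fix $a<b$, $0<\epsilon<1$, $L>0$, $0<\mu_0<1$, $y_0\in\mathbb R$, and functions $\varsigma:\mathbb N\to[1,\infty)$, $\nu:\mathbb N\to\mathbb N$ such that for every $\check\delta>0$, $\varsigma(n)/n^{\check\delta}\to0$ and $\nu(n)/n^{\check\delta}\to0$ as $n\to\infty$. Let $\mathcal P_n$ be the set of probability densities $p$ on $\mathbb R$ with $\int xp=0$, $\int x^2p=1$ and $\int|x|^{2k}p(x)\,dx\le\varsigma(n)^k(2k-1)!!$ for all $k\ge1$. Let $\Theta_{\epsilon,L}$ be the set of $S\in C^1([a,b])$ with $\sup|S|\le1-\epsilon$, $\sup|\dot S|\le L$. For $n\ge3$ observe $$y_k=S(x_k)y_{k-1}+\xi_k,\quad x_k=a+\tfrac{k(b-a)}n,\quad 1\le k\le n,$$ where the $\xi_k$ are i.i.d. with density $p\in\mathcal P_n$ and $y_0$ is the given constant. **Sequential procedures.** Let $d=[\sqrt n]$, $z_l=a+\frac ld(b-a)$, $h=\frac{b-a}{2d}$, $\tilde z_l=\frac{z_l-a}{b-a}$, $\tilde h=\frac h{b-a}$, $Q_{l,j}=\mathbf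 1_{\{|x_j-z_l|\le h\}}$, $k_{1,l}=[n\tilde z_l-n\tilde h]+1$, $k_{2,l}=[n\tilde z_l+n\tilde h]\wedge n$, $\iota_l=k_{1,l}+[(n\tilde h)^{\mu_0}]$, $\tilde\epsilon=1/(2+\ln n)$. For $1\le l\le d$ put $A^{(l)}_{k,m}=\sum_{j=k+1}^mQ_{l,j}y_{j-1}^2$, $$\widehat S_{\iota_l}=\frac{\sum_{j=1}^{\iota_l}Q_{l,j}y_{j-1}y_j}{A^{(l)}_{0,\iota_l}},\quad \widetilde S_{\iota_l}=\min(\max(\widehat S_{\iota_l},-1+\tilde\epsilon),1-\tilde\epsilon),\quad H_l=\frac{1-\tilde\epsilon}{1-\widetilde S_{\iota_l}^2}(k_{2,l}-\iota_l-1),$$ $\tau_l=\inf\{\iota_l+1\le k\le k_{2,l}:A^{(l)}_{\iota_l,k}\ge H_l\}$ (with $\inf\emptyset=k_{2,l}$), $\Gamma_l=\{A^{(l)}_{\iota_l,k_{2,l}-1}\ge H_l\}$, $\Gamma=\bigcap_{l=1}^d\Gamma_l$. Let $\varkappa_l=\big((H_l-A^{(l)}_{\iota_l,\tau_l-1})/(Q_{l,\tau_l}y_{\tau_l-1}^2)\big)^{1/2}$,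 so that $A^{(l)}_{\iota_l,\tau_l-1}+\varkappa_l^2Q_{l,\tau_l}y_{\tau_l-1}^2=H_l$ and $0<\varkappa_l\le1$ on $\Gamma_l\cap\{H_l>0\}$. Finally $$Y_l=\frac{\mathbf 1_\Gamma}{H_l}\Big(\sum_{j=\iota_l+1}^{\tau_l-1}Q_{l,j}y_{j-1}y_j+\varkappa_lQ_{l,\tau_l}y_{\tau_l-1}y_{\tau_l}\Big),\qquad \sigma_l^2=\frac1{H_l}.$$ (Conventions: $x/0=0$ and square roots of negative numbers are $0$. The case $H_l\le0$ can occur only for finitely many small $n$, and then the formula gives $Y_l=0$.) **Model selection.** Let $(\phi_j)_{1\le j\le d}$ be functions on $[a,b]$ with $\frac{b-a}d\sum_{l=1}^d\phi_i(z_l)\phi_j(z_l)=\mathbf 1_{\{i=j\}}$, and let $\Lambda\subset[0,1]^d$ be a nonempty finite set with $\nu(n)$ elements. Put $\hat\theta_j=\frac{b-a}d\sum_{l=1}^dY_l\phi_j(z_l)$, $\mathbf s_j=\frac{b-a}d\sum_{l=1}^d\sigma_l^2\phi_j^2(z_l)$, $\tilde\theta_j=\hat\theta_j^2-\frac{b-a}d\mathbf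 s_j$. For $\lambda\in\Lambda$ let $\widehat S_\lambda(z_l)=\mathbf 1_\Gamma\sum_{j=1}^d\lambda(j)\hat\theta_j\phi_j(z_l)$, extended to $[a,b]$ as the step function equal to $\widehat S_\lambda(z_1)$ on $[a,z_1]$ and to $\widehat S_\lambda(z_l)$ on $(z_{l-1},z_l]$ for $2\le l\le d$. For $\delta>0$ let $$J(\lambda)=\sum_{j=1}^d\lambda^2(j)\hat\theta_j^2-2\sum_{j=1}^d\lambda(j)\tilde\theta_j+\delta\,\frac{b-a}d\sum_{j=1}^d\lambda^2(j)\mathbf s_j ,$$ let $\hat\lambda$ be any random element of $\Lambda$ that minimizes $J$ over $\Lambda$, and $\widehat S_*=\widehat S_{\hat\lambda}$. The risk is $\mathcal R_p(\widehat S,S)=\mathbf E_{p,S}\int_a^b(\widehat S(t)-S(t))^2dt$. **Theorem.** There are real numbers $\check{\mathbf B}_n(p)$, which do not depend on $S,\delta,\Lambda,(\phi_j)$ or the choice of $\hat\lambda$, such that for every $p$ and every $\check\delta>0$ $$\lim_{n\to\infty}\check{\mathbf B}_n(p)/n^{\check\delta}=0,$$ and for all $n\ge3$, $p\in\mathcal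 P_n$, $S\in\Theta_{\epsilon,L}$, $0<\delta\le1/12$, all $(\phi_j)$, $\Lambda$ and $\hat\lambda$ as above, $$\mathcal R_p(\widehat S_*,S)\le\frac{(1+4\delta)(1+\delta)^2}{1-6\delta}\min_{\lambda\in\Lambda}\mathcal R_p(\widehat S_\lambda,S)+\frac{\max(\check{\mathbf B}_n(p),0)}{\delta n}.$$ -/

import Mathlib

open MeasureTheory ProbabilityTheory Filter Topology
open scoped ENNReal

noncomputable section

namespace SeqAR

/-- Noise densities: centred, unit variance, with all even moments of order `2k`
bounded by `ς ^ k * (2k-1)!!`. -/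
structure IsNoiseDensity (ς : ℝ) (p : ℝ → ℝ) : Prop where
  measurable : Measurable p
  nonneg : ∀ x, 0 ≤ p x
  total : ∫ x, p x = 1
  mean_integrable : Integrable (fun x => x * p x)
  mean : ∫ x, x * p x = 0
  variance : ∫ x, x ^ 2 * p x = 1
  moment_integrable : ∀ k : ℕ, 1 ≤ k → Integrable (fun x => |x| ^ (2 * k) * p x)
  moment_le : ∀ k : ℕ, 1 ≤ k →
    (∫ x, |x| ^ (2 * k) * p x) / (ς ^ k * (Nat.doubleFactorial (2 * k - 1) : ℝ)) ≤ 1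

/-- The stability set: continuously differentiable functions on `[a,b]` with
`|S| ≤ 1 - ε` and `|S'| ≤ L` there. -/
def stabilitySet (a b ε L : ℝ) : Set (ℝ → ℝ) :=
  {S | ContDiffOn ℝ 1 S (Set.Icc a b) ∧ (∀ x ∈ Set.Icc a b, |S x| ≤ 1 - ε) ∧
    ∀ x ∈ Set.Icc a b, |derivWithin S (Set.Icc a b) x| ≤ L}

/-- `ξ 1, ξ 2, …` are i.i.d. with density `p` under `P` (`ξ 0` is not used). -/
structure IsNoise {Ω : Type*} [MeasurableSpace Ω] (P : Measure Ω) (p : ℝ → ℝ)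
    (ξ : ℕ → Ω → ℝ) : Prop where
  measurable : ∀ k, 1 ≤ k → Measurable (ξ k)
  law : ∀ k, 1 ≤ k → P.map (ξ k) = volume.withDensity (fun x => ENNReal.ofReal (p x))
  indep : iIndepFun (fun k : ℕ => ξ (k + 1)) P

/-- Known parameters of the procedure: the interval `[a,b]`, the exponent that fixes the
length of the auxiliary estimation step, and the number of observations. -/
structure Design where
  a : ℝ
  b : ℝ
  mu0 : ℝ
  n : ℕ

namespace Design

variable (D : Design)

/-- Observation times `x_k`. -/
def x (k : ℕ) : ℝ := D.a + k * (D.b - D.a) / D.n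

/-- The autoregression `y_k = S(x_k) y_{k-1} + ξ_k` started at `y0`. -/
def process (S : ℝ → ℝ) (y0 : ℝ) (ξ : ℕ → ℝ) : ℕ → ℝ
  | 0 => y0
  | k + 1 => S (D.x (k + 1)) * process S y0 ξ k + ξ (k + 1)

/-- The number `d = [√n]` of grid points. -/
abbrev d : ℕ := Nat.sqrt D.n

/-- Grid points `z_l`, used for `1 ≤ l ≤ d`; also `z 0 = a`. -/
def z (l : ℕ) : ℝ := D.a + (l : ℝ) / D.d * (D.b - D.a)

/-- Bandwidth. -/
def h : ℝ := (D.b - D.a) / (2 * D.d)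

/-- `Q_{l,j}`: the indicator kernel of `[-1,1]` at `(x_j - z_l) / h`. -/
def Q (l j : ℕ) : ℝ := (Set.Icc (-1 : ℝ) 1).indicator 1 ((D.x j - D.z l) / D.h)

def k1 (l : ℕ) : ℕ :=
  ⌊(D.n : ℝ) * ((D.z l - D.a) / (D.b - D.a)) - D.n * (D.h / (D.b - D.a))⌋₊ + 1

def k2 (l : ℕ) : ℕ :=
  min ⌊(D.n : ℝ) * ((D.z l - D.a) / (D.b - D.a)) + D.n * (D.h / (D.b - D.a))⌋₊ D.n

def q : ℕ := ⌊((D.n : ℝ) * (D.h / (D.b - D.a))) ^ D.mu0⌋₊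

def iota (l : ℕ) : ℕ := D.k1 l + D.q

/-- The truncation level `1 / (2 + ln n)`. -/
def epsT : ℝ := 1 / (2 + Real.log D.n)

/-! Statistics: functions of the observed path `y`. -/

/-- `A_{k,m}` for the `l`-th window. -/
def A (l : ℕ) (y : ℕ → ℝ) (k m : ℕ) : ℝ :=
  ∑ j ∈ Finset.Icc (k + 1) m, D.Q l j * y (j - 1) ^ 2

/-- Auxiliary kernel estimator of `S (z_l)` from the first `ι_l` observations. -/
def SAux (l : ℕ) (y : ℕ → ℝ) : ℝ :=
  (∑ j ∈ Finset.Icc 1 (D.iota l), D.Q l j * y (j - 1) * y j) / D.A l y 0 (D.iota l)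

/-- Its projection on `[-1 + epsT, 1 - epsT]`. -/
def SProj (l : ℕ) (y : ℕ → ℝ) : ℝ := min (max (D.SAux l y) (-1 + D.epsT)) (1 - D.epsT)

/-- The threshold `H_l`. -/
def H (l : ℕ) (y : ℕ → ℝ) : ℝ :=
  (1 - D.epsT) / (1 - D.SProj l y ^ 2) * ((D.k2 l : ℝ) - D.iota l - 1)

/-- The stopping time `τ_l`; it equals `k_{2,l}` when the threshold is not reached. -/
def tau (l : ℕ) (y : ℕ → ℝ) : ℕ :=
  sInf (insert (D.k2 l)
    {k | D.iota l + 1 ≤ k ∧ k ≤ D.k2 l ∧ D.H l y ≤ D.A l y (D.iota l) k})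

/-- The event `Γ_l`. -/
def GammaAt (l : ℕ) : Set (ℕ → ℝ) := {y | D.H l y ≤ D.A l y (D.iota l) (D.k2 l - 1)}

/-- The event `Γ`. -/
def Gamma : Set (ℕ → ℝ) := {y | ∀ l ∈ Finset.Icc 1 D.d, y ∈ D.GammaAt l}

/-- The correcting coefficient `ϰ_l`, i.e. the positive root of
`A_{ι,τ-1} + ϰ² Q_{l,τ} y_{τ-1}² = H`; see `kappa_spec`. -/
def kappa (l : ℕ) (y : ℕ → ℝ) : ℝ :=
  Real.sqrt ((D.H l y - D.A l y (D.iota l) (D.tau l y - 1)) /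
    (D.Q l (D.tau l y) * y (D.tau l y - 1) ^ 2))

lemma Q_nonneg (l j : ℕ) : 0 ≤ D.Q l j := by
  unfold Q
  exact Set.indicator_nonneg (fun _ _ => zero_le_one) _

/-- Whenever the threshold is positive, `ϰ_l` has its defining property on `Γ_l`. -/
lemma kappa_spec (l : ℕ) (y : ℕ → ℝ) (hH : 0 < D.H l y) (hy : y ∈ D.GammaAt l) :
    0 < D.kappa l y ∧ D.kappa l y ≤ 1 ∧
      D.A l y (D.iota l) (D.tau l y - 1) +
        D.kappa l y ^ 2 * D.Q l (D.tau l y) * y (D.tau l y - 1) ^ 2 = D.H l y := by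
  have hy2 : D.H l y ≤ D.A l y (D.iota l) (D.k2 l - 1) := hy
  have hlt : D.iota l + 1 ≤ D.k2 l - 1 := by
    by_contra hc
    have : D.A l y (D.iota l) (D.k2 l - 1) = 0 := by
      unfold A
      rw [Finset.Icc_eq_empty hc, Finset.sum_empty]
    linarith
  have hmem := Nat.sInf_mem (s := insert (D.k2 l)
    {k | D.iota l + 1 ≤ k ∧ k ≤ D.k2 l ∧ D.H l y ≤ D.A l y (D.iota l) k}) ⟨_, Or.inl rfl⟩
  have hle : D.tau l y ≤ D.k2 l - 1 := Nat.sInf_le (Or.inr ⟨hlt, by omega, hy2⟩)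
  change D.tau l y ∈ _ at hmem
  rcases hmem with hmem | ⟨h1, h2, h3⟩
  · omega
  have hbefore : D.A l y (D.iota l) (D.tau l y - 1) < D.H l y := by
    by_contra hc
    push Not at hc
    by_cases h4 : D.iota l + 1 ≤ D.tau l y - 1
    · have h5 : D.tau l y ≤ D.tau l y - 1 :=
        Nat.sInf_le (Or.inr ⟨h4, by omega, hc⟩)
      omega
    · have : D.A l y (D.iota l) (D.tau l y - 1) = 0 := by
        unfold A
        rw [Finset.Icc_eq_empty h4, Finset.sum_empty]
      linarith
  have hstep : D.A l y (D.iota l) (D.tau l y) = D.A l y (D.iota l) (D.tau l y - 1) +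
      D.Q l (D.tau l y) * y (D.tau l y - 1) ^ 2 := by
    obtain ⟨m, hm⟩ : ∃ m, D.tau l y = m + 1 := ⟨D.tau l y - 1, by omega⟩
    rw [hm] at h1 ⊢
    unfold A
    rw [Finset.sum_Icc_succ_top (by omega)]
    simp
  rw [hstep] at h3
  have hpos : 0 < D.Q l (D.tau l y) * y (D.tau l y - 1) ^ 2 := by linarith
  have hr : 0 < (D.H l y - D.A l y (D.iota l) (D.tau l y - 1)) /
      (D.Q l (D.tau l y) * y (D.tau l y - 1) ^ 2) := div_pos (by linarith) hpos
  refine ⟨Real.sqrt_pos.2 hr, ?_, ?_⟩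
  · refine Real.sqrt_le_one.2 ?_
    rw [div_le_one hpos]
    linarith
  · unfold kappa
    rw [Real.sq_sqrt hr.le, mul_assoc, div_mul_cancel₀ _ hpos.ne']
    ring

/-- The truncated sequential estimator `S*_l` of `S (z_l)`. -/
def seqEst (l : ℕ) (y : ℕ → ℝ) : ℝ :=
  (D.GammaAt l).indicator (fun y =>
    1 / D.H l y *
      ((∑ j ∈ Finset.Icc (D.iota l + 1) (D.tau l y - 1), D.Q l j * y (j - 1) * y j) +
        D.kappa l y * D.Q l (D.tau l y) * y (D.tau l y - 1) * y (D.tau l y))) y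

/-- The observations `Y_l` of the regression scheme. -/
def Y (l : ℕ) (y : ℕ → ℝ) : ℝ := D.Gamma.indicator (fun y => D.seqEst l y) y

/-- `σ_l²`. -/
def sigmaSq (l : ℕ) (y : ℕ → ℝ) : ℝ := 1 / D.H l y

/-- Empirical inner product. -/
def empInner (f g : ℝ → ℝ) : ℝ :=
  (D.b - D.a) / D.d * ∑ l ∈ Finset.Icc 1 D.d, f (D.z l) * g (D.z l)

/-- Orthonormality of `d` functions for the empirical inner product. -/
def IsEmpOrthonormal (φ : Fin D.d → ℝ → ℝ) : Prop :=
  ∀ i j, D.empInner (φ i) (φ j) = if i = j then 1 else 0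

/-- Estimated Fourier coefficients. -/
def thetaHat (φ : Fin D.d → ℝ → ℝ) (y : ℕ → ℝ) (j : Fin D.d) : ℝ :=
  (D.b - D.a) / D.d * ∑ l ∈ Finset.Icc 1 D.d, D.Y l y * φ j (D.z l)

/-- `s_{j,d}`. -/
def sCoef (φ : Fin D.d → ℝ → ℝ) (y : ℕ → ℝ) (j : Fin D.d) : ℝ :=
  (D.b - D.a) / D.d * ∑ l ∈ Finset.Icc 1 D.d, D.sigmaSq l y * φ j (D.z l) ^ 2

def thetaTilde (φ : Fin D.d → ℝ → ℝ) (y : ℕ → ℝ) (j : Fin D.d) : ℝ :=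
  D.thetaHat φ y j ^ 2 - (D.b - D.a) / D.d * D.sCoef φ y j

/-- The penalty term. -/
def penalty (φ : Fin D.d → ℝ → ℝ) (y : ℕ → ℝ) (lam : Fin D.d → ℝ) : ℝ :=
  (D.b - D.a) / D.d * ∑ j, lam j ^ 2 * D.sCoef φ y j

/-- The cost function `J_d`. -/
def cost (φ : Fin D.d → ℝ → ℝ) (δ : ℝ) (y : ℕ → ℝ) (lam : Fin D.d → ℝ) : ℝ :=
  ∑ j, lam j ^ 2 * D.thetaHat φ y j ^ 2 - 2 * ∑ j, lam j * D.thetaTilde φ y j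
    + δ * D.penalty φ y lam

/-- The weighted least squares estimator at the grid point `z_l`. -/
def wlsGrid (φ : Fin D.d → ℝ → ℝ) (lam : Fin D.d → ℝ) (y : ℕ → ℝ) (l : ℕ) : ℝ :=
  D.Gamma.indicator (fun y => ∑ j, lam j * D.thetaHat φ y j * φ j (D.z l)) y

/-- The weighted least squares estimator as a step function on `[a,b]`. -/
def wls (φ : Fin D.d → ℝ → ℝ) (lam : Fin D.d → ℝ) (y : ℕ → ℝ) (t : ℝ) : ℝ :=
  (Set.Icc D.a (D.z 1)).indicator (fun _ => D.wlsGrid φ lam y 1) t +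
    ∑ l ∈ Finset.Icc 2 D.d,
      (Set.Ioc (D.z (l - 1)) (D.z l)).indicator (fun _ => D.wlsGrid φ lam y l) t

/-- `‖f‖²` in `L²[a,b]`. -/
def sqNorm (f : ℝ → ℝ) : ℝ := ∫ t in D.a..D.b, f t ^ 2

/-- The quadratic risk `E ‖Ŝ - S‖²` of a random function, as an extended nonnegative number. -/
def risk {Ω : Type*} [MeasurableSpace Ω] (P : Measure Ω) (Shat : Ω → ℝ → ℝ) (S : ℝ → ℝ) :
    ℝ≥0∞ :=
  ∫⁻ ω, ENNReal.ofReal (D.sqNorm (fun t => Shat ω t - S t)) ∂P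

/-- `lamHat` is a random element of `Λ` that minimizes the cost function over `Λ`
along the random path `y`. -/
structure IsSelector {Ω : Type*} [MeasurableSpace Ω] (φ : Fin D.d → ℝ → ℝ) (δ : ℝ)
    (Λ : Finset (Fin D.d → ℝ)) (y : Ω → ℕ → ℝ) (lamHat : Ω → Fin D.d → ℝ) : Prop where
  measurable : Measurable lamHat
  mem : ∀ ω, lamHat ω ∈ Λ
  le : ∀ ω, ∀ lam ∈ Λ, D.cost φ δ (y ω) (lamHat ω) ≤ D.cost φ δ (y ω) lam

end Design

end SeqAR

end

/-! On `Γ` the observation `Y_l` is `S(z_l)` plus a small bias plus a sum of weights times noise.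
The weights `wt` are predictable, and the correction `ϰ_l` makes their squares add up to exactly `1
/ H_l`. The variance proxy of the noise is thus observable although `S` is unknown. Different `l`
use disjoint stretches of time. In Fourier coordinates the scheme becomes `θ + β + N`, and the
penalty coefficient `ψ_j = (b - a) / d * s_j` is exactly the compensator of `N_j ^ 2`.

The selection step is then deterministic (`oracle_pathwise`): minimality of the cost compares two
losses up to `∑ β_j ^ 2` and the normalized fluctuations `devQuad` and `devLin`. The penalty of the
selected weight, counted with the factor `δ`, absorbs what the fluctuations cannot pay for. In mean
these fluctuations are of order `1 / n` up to subpolynomial factors, uniformly in the weight vector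
(`integral_devQuad_le`, `integral_devLin_le`), so the random `lamHat` is handled by summing over
`Λ`, at the price of the factor `ν n`. The main probabilistic estimate is `integral_quadForm_sq_le`,
a second moment bound for a centred quadratic form in the window sums.

The bias has two sources: the variation of `S` over a window of width of order `n ^ (-1/2)`, and the
stopping step, which costs at most `2 * max y ^ 2 / H`. The expected maximum of `y ^ 4` is
subpolynomial because moments of all orders are bounded along the path
(`lintegral_sup'_process_le`).

The probability of `Γ` never has to be estimated: off `Γ` all estimators vanish and have the same
loss, while the weights are defined on every path with energy at most `1 / H_l`, so all expectations
run over the whole space. Replacing integrals by grid sums and back costs `(1 + δ) ^ 2` and a term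
of order `1 / (δ n)`. The finitely many `n` with too short windows are covered by a crude bound. -/

namespace SeqAR

/-! ### Random variables with finite moments of every order. -/

section Moments

variable {Ω : Type*} [MeasurableSpace Ω] {P : Measure Ω}

/-- Random variables all of whose moments are finite. -/
def HasAllMoments (X : Ω → ℝ) (P : Measure Ω) : Prop := ∀ p : ℕ, MemLp X p P

namespace HasAllMoments

variable {X Z : Ω → ℝ}

lemma add (hX : HasAllMoments X P) (hZ : HasAllMoments Z P) :
    HasAllMoments (fun ω => X ω + Z ω) P := fun p => (hX p).add (hZ p)

lemma sub (hX : HasAllMoments X P) (hZ : HasAllMoments Z P) :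
    HasAllMoments (fun ω => X ω - Z ω) P := fun p => (hX p).sub (hZ p)

lemma mul (hX : HasAllMoments X P) (hZ : HasAllMoments Z P) :
    HasAllMoments (fun ω => X ω * Z ω) P := fun p => by
  have : ENNReal.HolderTriple ((2 * p : ℕ) : ℝ≥0∞) ((2 * p : ℕ) : ℝ≥0∞) (p : ℝ≥0∞) := by
    constructor
    push_cast
    rw [ENNReal.mul_inv (by simp) (by simp), ← add_mul, ENNReal.inv_two_add_inv_two, one_mul]
  exact (hZ (2 * p)).mul' (hX (2 * p))

lemma sum {ι : Type*} (s : Finset ι) {F : ι → Ω → ℝ} (h : ∀ i ∈ s, HasAllMoments (F i) P) :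
    HasAllMoments (fun ω => ∑ i ∈ s, F i ω) P := fun p =>
  memLp_finsetSum s fun i hi => h i hi p

lemma const [IsFiniteMeasure P] (c : ℝ) : HasAllMoments (fun _ : Ω => c) P :=
  fun _ => memLp_const c

lemma const_mul [IsFiniteMeasure P] (c : ℝ) (hX : HasAllMoments X P) :
    HasAllMoments (fun ω => c * X ω) P := (const c).mul hX

lemma sq (hX : HasAllMoments X P) : HasAllMoments (fun ω => X ω ^ 2) P := by
  simpa only [pow_two] using hX.mul hX

lemma of_bound [IsFiniteMeasure P] (hX : Measurable X) (C : ℝ) (h : ∀ ω, |X ω| ≤ C) :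
    HasAllMoments X P := fun _ =>
  MemLp.of_bound hX.aestronglyMeasurable C (Eventually.of_forall h)

lemma integrable (hX : HasAllMoments X P) : Integrable X P :=
  memLp_one_iff_integrable.1 (by simpa using hX 1)

lemma integral_add (hX : HasAllMoments X P) (hZ : HasAllMoments Z P) :
    ∫ ω, X ω + Z ω ∂P = ∫ ω, X ω ∂P + ∫ ω, Z ω ∂P :=
  MeasureTheory.integral_add hX.integrable hZ.integrable

lemma integral_sub (hX : HasAllMoments X P) (hZ : HasAllMoments Z P) :
    ∫ ω, X ω - Z ω ∂P = ∫ ω, X ω ∂P - ∫ ω, Z ω ∂P :=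
  MeasureTheory.integral_sub hX.integrable hZ.integrable

end HasAllMoments

end Moments

/-! ### Martingale sums driven by independent noise. -/

/-- The information carried by `ξ i`, `i < k`. -/
abbrev past {Ω : Type*} (ξ : ℕ → Ω → ℝ) (k : ℕ) : MeasurableSpace Ω :=
  ⨆ i ∈ Set.Iio k, MeasurableSpace.comap (ξ i) inferInstance

lemma past_mono {Ω : Type*} (ξ : ℕ → Ω → ℝ) {k m : ℕ} (h : k ≤ m) : past ξ k ≤ past ξ m :=
  biSup_mono fun _ hi => lt_of_lt_of_le hi h

lemma measurable_past {Ω : Type*} (ξ : ℕ → Ω → ℝ) {i k : ℕ} (h : i < k) : Measurable[past ξ k] (ξ i) := by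
  rw [measurable_iff_comap_le]
  exact le_biSup (fun i => MeasurableSpace.comap (ξ i) inferInstance) (Set.mem_Iio.2 h)

lemma measurable_sum_past {Ω : Type*} {ξ : ℕ → Ω → ℝ} {g h : ℕ → Ω → ℝ} (hg : ∀ k, Measurable[past ξ k] (g k))
    (hh : ∀ k, Measurable[past ξ k] (h k)) (n : ℕ) :
    Measurable[past ξ n] (fun ω => ∑ k ∈ Finset.range n,
      (g k ω * (ξ k ω ^ 2 - 1) + h k ω * ξ k ω)) := by
  refine Finset.measurable_sum _ fun k hk => ?_
  have hk := Finset.mem_range.1 hk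
  have h1 := (hg k).mono (past_mono ξ hk.le) le_rfl
  have h2 := (hh k).mono (past_mono ξ hk.le) le_rfl
  have h3 := measurable_past ξ hk
  exact (h1.mul ((h3.pow_const 2).sub measurable_const)).add (h2.mul h3)

section StandardNoise

variable {Ω : Type*} [MeasurableSpace Ω] {P : Measure Ω}

/-- Independent standardized noise with finite moments. -/
structure IsStdNoise (P : Measure Ω) (ξ : ℕ → Ω → ℝ) (m4 : ℝ) : Prop where
  measurable : ∀ k, Measurable (ξ k)
  indep : iIndepFun ξ P
  moments : ∀ k, HasAllMoments (ξ k) P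
  mean : ∀ k, ∫ ω, ξ k ω ∂P = 0
  var : ∀ k, ∫ ω, ξ k ω ^ 2 ∂P = 1
  fourth : ∀ k, ∫ ω, ξ k ω ^ 4 ∂P ≤ m4

namespace IsStdNoise

variable {ξ : ℕ → Ω → ℝ} {m4 : ℝ} (hξ : IsStdNoise P ξ m4)
include hξ

lemma past_le (k : ℕ) : past ξ k ≤ ‹MeasurableSpace Ω› :=
  iSup₂_le fun i _ => (hξ.measurable i).comap_le

lemma indep_past (k : ℕ) {X : Ω → ℝ} (hX : Measurable[past ξ k] X) : IndepFun X (ξ k) P := by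
  have h1 := indep_iSup_of_disjoint (fun i => (hξ.measurable i).comap_le) hξ.indep
    (S := Set.Iio k) (T := {k}) (by simp)
  rw [IndepFun_iff_Indep]
  refine indep_of_indep_of_le_right (indep_of_indep_of_le_left h1 hX.comap_le) ?_
  simp

/-- Under independence the product formula needs no integrability, so the orthogonality relations
derived from it ask only for measurability with respect to the past. -/
lemma integral_mul_of_past {k : ℕ} {X : Ω → ℝ} (hX : Measurable[past ξ k] X) {g : ℝ → ℝ}
    (hg : Measurable g) :
    ∫ ω, X ω * g (ξ k ω) ∂P = (∫ ω, X ω ∂P) * ∫ ω, g (ξ k ω) ∂P := by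
  have h := (hξ.indep_past k hX).comp measurable_id hg
  have hX' := hX.mono (hξ.past_le k) le_rfl
  exact IndepFun.integral_fun_mul_eq_mul_integral h hX'.aestronglyMeasurable
    (hg.comp (hξ.measurable k)).aestronglyMeasurable

lemma integral_mul_noise {k : ℕ} {X : Ω → ℝ} (hX : Measurable[past ξ k] X) :
    ∫ ω, X ω * ξ k ω ∂P = 0 := by
  rw [hξ.integral_mul_of_past hX measurable_id (g := fun x => x), hξ.mean, mul_zero]

lemma integral_mul_noise_sq {k : ℕ} {X : Ω → ℝ} (hX : Measurable[past ξ k] X) :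
    ∫ ω, X ω * ξ k ω ^ 2 ∂P = ∫ ω, X ω ∂P := by
  rw [hξ.integral_mul_of_past hX (g := fun x => x ^ 2) (by fun_prop), hξ.var, mul_one]

variable [IsProbabilityMeasure P]

lemma centered_sq_moments (k : ℕ) : HasAllMoments (fun ω => ξ k ω ^ 2 - 1) P :=
  (hξ.moments k).sq.sub (HasAllMoments.const 1)

lemma integral_mul_centered_sq {k : ℕ} {X : Ω → ℝ} (hX : Measurable[past ξ k] X) :
    ∫ ω, X ω * (ξ k ω ^ 2 - 1) ∂P = 0 := by
  rw [hξ.integral_mul_of_past hX (g := fun x => x ^ 2 - 1) (by fun_prop),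
    integral_sub (hξ.moments k).sq.integrable (integrable_const 1), hξ.var]
  simp

lemma integral_mul_centered_sq_sq_le {k : ℕ} {X : Ω → ℝ} (hX : Measurable[past ξ k] X)
    (h0 : ∀ ω, 0 ≤ X ω) :
    ∫ ω, X ω * (ξ k ω ^ 2 - 1) ^ 2 ∂P ≤ m4 * ∫ ω, X ω ∂P := by
  rw [hξ.integral_mul_of_past hX (g := fun x => (x ^ 2 - 1) ^ 2) (by fun_prop), mul_comm m4]
  refine mul_le_mul_of_nonneg_left ?_ (integral_nonneg h0)
  have h2 := (hξ.moments k).sq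
  have h4 := h2.sq
  have e : ∀ ω, (ξ k ω ^ 2 - 1) ^ 2 = ((ξ k ω ^ 2) ^ 2 - 2 * ξ k ω ^ 2) + 1 := fun ω => by ring
  simp_rw [e]
  rw [(h4.sub (h2.const_mul 2)).integral_add (HasAllMoments.const 1),
    h4.integral_sub (h2.const_mul 2), integral_const_mul, hξ.var]
  have := hξ.fourth k
  have e2 : ∀ ω, (ξ k ω ^ 2) ^ 2 = ξ k ω ^ 4 := fun ω => by ring
  simp_rw [e2]
  simp only [integral_const, probReal_univ, smul_eq_mul]
  linarith

lemma moments_sum {g h : ℕ → Ω → ℝ}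
    (hgm : ∀ k, HasAllMoments (g k) P) (hhm : ∀ k, HasAllMoments (h k) P) (n : ℕ) :
    HasAllMoments (fun ω => ∑ k ∈ Finset.range n,
      (g k ω * (ξ k ω ^ 2 - 1) + h k ω * ξ k ω)) P :=
  HasAllMoments.sum _ fun k _ =>
    ((hgm k).mul (hξ.centered_sq_moments k)).add ((hhm k).mul (hξ.moments k))

/-- Second moment of a sum of martingale differences that are quadratic in the noise. -/
lemma integral_sq_sum_le {g h : ℕ → Ω → ℝ} (hg : ∀ k, Measurable[past ξ k] (g k))
    (hh : ∀ k, Measurable[past ξ k] (h k)) (hgm : ∀ k, HasAllMoments (g k) P)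
    (hhm : ∀ k, HasAllMoments (h k) P) (n : ℕ) :
    ∫ ω, (∑ k ∈ Finset.range n, (g k ω * (ξ k ω ^ 2 - 1) + h k ω * ξ k ω)) ^ 2 ∂P ≤
      ∑ k ∈ Finset.range n, (2 * m4 * ∫ ω, g k ω ^ 2 ∂P + 2 * ∫ ω, h k ω ^ 2 ∂P) := by
  induction n with
  | zero => simp
  | succ n ih =>
    rw [Finset.sum_range_succ]
    simp_rw [Finset.sum_range_succ]
    have hTm := measurable_sum_past hg hh n
    have hT := moments_sum hξ hgm hhm n
    set T : Ω → ℝ := fun ω => ∑ k ∈ Finset.range n, (g k ω * (ξ k ω ^ 2 - 1) + h k ω * ξ k ω)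
      with hTdef
    have hc := hξ.centered_sq_moments n
    have hx := hξ.moments n
    have i1 := hT.sq
    have i2 := (((hT.const_mul 2).mul (hgm n)).mul hc)
    have i3 := (((hT.const_mul 2).mul (hhm n)).mul hx)
    have i4 := (((hgm n).sq.const_mul 2).mul hc.sq)
    have i5 := (((hhm n).sq.const_mul 2).mul hx.sq)
    -- The exact square of the increment would bring in the third moment of the noise. Bounding it
    -- by twice the sum of the two squares avoids this and produces the factors 2.
    have key : ∫ ω, (T ω + (g n ω * (ξ n ω ^ 2 - 1) + h n ω * ξ n ω)) ^ 2 ∂P ≤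
        ∫ ω, (T ω ^ 2 + 2 * T ω * g n ω * (ξ n ω ^ 2 - 1) + 2 * T ω * h n ω * ξ n ω
          + 2 * g n ω ^ 2 * (ξ n ω ^ 2 - 1) ^ 2 + 2 * h n ω ^ 2 * ξ n ω ^ 2) ∂P := by
      refine integral_mono ?_ ((((i1.add i2).add i3).add i4).add i5).integrable fun ω => ?_
      · exact ((hT.add (((hgm n).mul hc).add ((hhm n).mul hx))).sq).integrable
      · dsimp only
        nlinarith [sq_nonneg (g n ω * (ξ n ω ^ 2 - 1) - h n ω * ξ n ω)]
    refine key.trans ?_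
    rw [(((i1.add i2).add i3).add i4).integral_add i5, ((i1.add i2).add i3).integral_add i4,
      (i1.add i2).integral_add i3, i1.integral_add i2,
      hξ.integral_mul_centered_sq (X := fun ω => 2 * T ω * g n ω)
        ((measurable_const.mul hTm).mul (hg n)),
      hξ.integral_mul_noise (X := fun ω => 2 * T ω * h n ω)
        ((measurable_const.mul hTm).mul (hh n)),
      hξ.integral_mul_noise_sq (X := fun ω => 2 * h n ω ^ 2)
        (measurable_const.mul ((hh n).pow_const 2))]
    have := hξ.integral_mul_centered_sq_sq_le (X := fun ω => 2 * g n ω ^ 2)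
      (measurable_const.mul ((hg n).pow_const 2)) (fun ω => by positivity)
    rw [integral_const_mul] at this
    rw [integral_const_mul]
    linarith

lemma integral_sq_linear_le {h : ℕ → Ω → ℝ} (hh : ∀ k, Measurable[past ξ k] (h k))
    (hhm : ∀ k, HasAllMoments (h k) P) (n : ℕ) :
    ∫ ω, (∑ k ∈ Finset.range n, h k ω * ξ k ω) ^ 2 ∂P ≤
      2 * ∑ k ∈ Finset.range n, ∫ ω, h k ω ^ 2 ∂P := by
  have := hξ.integral_sq_sum_le (g := fun _ _ => 0) (fun _ => measurable_const) hh
    (fun _ => HasAllMoments.const 0) hhm n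
  simpa [Finset.mul_sum] using this

/-- Summation by parts: a martingale square integrated against a predictable increasing
process that is bounded by `s`. -/
lemma integral_sum_sq_mul_sq_le {c r : ℕ → Ω → ℝ} (hc : ∀ k, Measurable[past ξ k] (c k))
    (hr : ∀ k, Measurable[past ξ k] (r k)) (hcm : ∀ k, HasAllMoments (c k) P)
    (hrm : ∀ k, HasAllMoments (r k) P) (n : ℕ) :
    ∑ k ∈ Finset.range n, ∫ ω, c k ω ^ 2 * (∑ i ∈ Finset.range k, r i ω * ξ i ω) ^ 2 ∂P ≤
      ∫ ω, (∑ k ∈ Finset.range n, c k ω ^ 2) * (∑ i ∈ Finset.range n, r i ω * ξ i ω) ^ 2 ∂P := by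
  induction n with
  | zero => simp
  | succ n ih =>
    rw [Finset.sum_range_succ]
    have hRm : Measurable[past ξ n] fun ω => ∑ i ∈ Finset.range n, r i ω * ξ i ω := by
      simpa using measurable_sum_past (g := fun _ _ => 0) (fun _ => measurable_const) hr n
    have hR : HasAllMoments (fun ω => ∑ i ∈ Finset.range n, r i ω * ξ i ω) P :=
      HasAllMoments.sum _ fun i _ => (hrm i).mul (hξ.moments i)
    -- Since `c n` is known before `ξ n`, the energy including `c n` is still predictable. Hence the
    -- cross term of the expansion has mean zero, and the remaining square term is nonnegative and
    -- can be dropped.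
    have hVm : Measurable[past ξ n] fun ω => ∑ k ∈ Finset.range (n + 1), c k ω ^ 2 :=
      Finset.measurable_sum _ fun k hk => ((hc k).mono
        (past_mono ξ (by simpa [Nat.lt_succ_iff] using hk)) le_rfl).pow_const 2
    have hV : HasAllMoments (fun ω => ∑ k ∈ Finset.range (n + 1), c k ω ^ 2) P :=
      HasAllMoments.sum _ fun k _ => (hcm k).sq
    have hV' : HasAllMoments (fun ω => ∑ k ∈ Finset.range n, c k ω ^ 2) P :=
      HasAllMoments.sum _ fun k _ => (hcm k).sq
    have hx := hξ.moments n
    have e : ∀ ω, (∑ k ∈ Finset.range (n + 1), c k ω ^ 2) *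
        (∑ i ∈ Finset.range (n + 1), r i ω * ξ i ω) ^ 2 =
        (((∑ k ∈ Finset.range n, c k ω ^ 2) * (∑ i ∈ Finset.range n, r i ω * ξ i ω) ^ 2 +
          c n ω ^ 2 * (∑ i ∈ Finset.range n, r i ω * ξ i ω) ^ 2) +
        2 * (∑ k ∈ Finset.range (n + 1), c k ω ^ 2) * (∑ i ∈ Finset.range n, r i ω * ξ i ω) *
          r n ω * ξ n ω) + (∑ k ∈ Finset.range (n + 1), c k ω ^ 2) * r n ω ^ 2 * ξ n ω ^ 2 := by
      intro ω
      rw [Finset.sum_range_succ (fun i => r i ω * ξ i ω), Finset.sum_range_succ]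
      ring
    simp_rw [e]
    have i1 := (hV'.mul hR.sq)
    have i2 := ((hcm n).sq.mul hR.sq)
    have i3 := ((((hV.const_mul 2).mul hR).mul (hrm n)).mul hx)
    have i4 := ((hV.mul (hrm n).sq).mul hx.sq)
    rw [((i1.add i2).add i3).integral_add i4, (i1.add i2).integral_add i3, i1.integral_add i2,
      hξ.integral_mul_noise (X := fun ω => 2 * (∑ k ∈ Finset.range (n + 1), c k ω ^ 2) *
        (∑ i ∈ Finset.range n, r i ω * ξ i ω) * r n ω)
        (((measurable_const.mul hVm).mul hRm).mul (hr n))]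
    have : 0 ≤ ∫ ω, (∑ k ∈ Finset.range (n + 1), c k ω ^ 2) * r n ω ^ 2 * ξ n ω ^ 2 ∂P :=
      integral_nonneg fun ω => mul_nonneg
        (mul_nonneg (Finset.sum_nonneg fun _ _ => sq_nonneg _) (sq_nonneg _)) (sq_nonneg _)
    linarith

end IsStdNoise

end StandardNoise

/-! ### Quadratic forms in the sums over disjoint windows. -/

section QuadraticForm

variable {Ω : Type*} [MeasurableSpace Ω] {P : Measure Ω} {ι : Type*} [Fintype ι]

/-- Predictable weights `c l k` of the noise `ξ k` in the `l`-th window; the windows are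
disjoint and the energy of each of them up to time `n` is at most `s`. -/
structure IsWindowWeight {Ω ι : Type*} (ξ : ℕ → Ω → ℝ) (n : ℕ) (s : ℝ) (c : ι → ℕ → Ω → ℝ) : Prop where
  measurable : ∀ l k, Measurable[past ξ k] (c l k)
  disjoint : ∀ l m k ω, l ≠ m → c l k ω * c m k ω = 0
  energy : ∀ l ω, ∑ k ∈ Finset.range n, c l k ω ^ 2 ≤ s
  vanish : ∀ l k ω, n ≤ k → c l k ω = 0

lemma sq_sum_eq_of_orthogonal {ι : Type*} {s : Finset ι} (x : ι → ℝ) (h : ∀ l m, l ≠ m → x l * x m = 0)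
    (a : ι → ℝ) : (∑ l ∈ s, a l * x l) ^ 2 = ∑ l ∈ s, a l ^ 2 * x l ^ 2 := by
  rw [pow_two, Finset.sum_mul_sum]
  refine Finset.sum_congr rfl fun l hl => ?_
  rw [Finset.sum_eq_single l]
  · ring
  · intro m _ hm
    have := h l m hm.symm
    linear_combination a l * a m * this
  · exact fun h => absurd hl h

/-- One-step expansion of a quadratic form, when the increments have disjoint supports. -/
lemma quadForm_step (G : ι → ι → ℝ) (hG : ∀ l m, G l m = G m l) (X x : ι → ℝ) (e : ℝ)
    (h : ∀ l m, l ≠ m → x l * x m = 0) :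
    ∑ l, ∑ m, G l m * ((X l + x l * e) * (X m + x m * e)) - ∑ l, G l l * x l ^ 2 =
      ∑ l, ∑ m, G l m * (X l * X m) + ((∑ l, G l l * x l ^ 2) * (e ^ 2 - 1) +
        (2 * ∑ l, x l * ∑ m, G l m * X m) * e) := by
  have h1 : ∑ l, ∑ m, G l m * (x l * x m) = ∑ l, G l l * x l ^ 2 := by
    refine Finset.sum_congr rfl fun l _ => ?_
    rw [Finset.sum_eq_single l]
    · ring
    · intro m _ hm
      rw [h l m hm.symm, mul_zero]
    · simp
  have h2 : ∑ l, ∑ m, G l m * (X l * x m) = ∑ l, x l * ∑ m, G l m * X m := by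
    rw [Finset.sum_comm]
    refine Finset.sum_congr rfl fun l _ => ?_
    rw [Finset.mul_sum]
    exact Finset.sum_congr rfl fun m _ => by rw [hG m l]; ring
  have h3 : ∑ l, ∑ m, G l m * (x l * X m) = ∑ l, x l * ∑ m, G l m * X m := by
    refine Finset.sum_congr rfl fun l _ => ?_
    rw [Finset.mul_sum]
    exact Finset.sum_congr rfl fun m _ => by ring
  have h4 : ∑ l, ∑ m, G l m * ((X l + x l * e) * (X m + x m * e)) =
      ∑ l, ∑ m, G l m * (X l * X m) + e * ∑ l, ∑ m, G l m * (X l * x m)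
        + e * ∑ l, ∑ m, G l m * (x l * X m) + e ^ 2 * ∑ l, ∑ m, G l m * (x l * x m) := by
    simp only [Finset.mul_sum, ← Finset.sum_add_distrib]
    exact Finset.sum_congr rfl fun l _ => Finset.sum_congr rfl fun m _ => by ring
  rw [h4, h1, h2, h3]
  ring

/-- A discrete Itô formula. Disjoint supports leave only the diagonal of `G` in the compensator, and
the increments have exactly the shape treated by `integral_sq_sum_le`. -/
lemma quadForm_eq_sum (G : ι → ι → ℝ) (hG : ∀ l m, G l m = G m l) (x : ι → ℕ → ℝ) (e : ℕ → ℝ)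
    (h : ∀ l m k, l ≠ m → x l k * x m k = 0) (n : ℕ) :
    ∑ l, ∑ m, G l m * ((∑ k ∈ Finset.range n, x l k * e k) * (∑ k ∈ Finset.range n, x m k * e k))
      - ∑ l, G l l * ∑ k ∈ Finset.range n, x l k ^ 2 =
    ∑ k ∈ Finset.range n, ((∑ l, G l l * x l k ^ 2) * (e k ^ 2 - 1) +
        (2 * ∑ l, x l k * ∑ i ∈ Finset.range k, (∑ m, G l m * x m i) * e i) * e k) := by
  induction n with
  | zero => simp
  | succ n ih =>
    rw [Finset.sum_range_succ, ← ih]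
    simp only [Finset.sum_range_succ _ n, mul_add (G _ _), Finset.sum_add_distrib (s := Finset.univ)]
    have := quadForm_step G hG (fun l => ∑ k ∈ Finset.range n, x l k * e k) (fun l => x l n) (e n)
      (fun l m => h l m n)
    have h5 : ∀ l, ∑ m, G l m * ∑ k ∈ Finset.range n, x m k * e k =
        ∑ i ∈ Finset.range n, (∑ m, G l m * x m i) * e i := by
      intro l
      simp only [Finset.mul_sum, Finset.sum_mul]
      rw [Finset.sum_comm]
      exact Finset.sum_congr rfl fun _ _ => Finset.sum_congr rfl fun _ _ => by ring
    simp only [h5] at this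
    linarith

namespace IsWindowWeight

variable {ξ : ℕ → Ω → ℝ} {m4 s : ℝ} {n : ℕ} {c : ι → ℕ → Ω → ℝ}

section

variable (hc : IsWindowWeight ξ n s c)
include hc

lemma sq_le (hs : 0 ≤ s) (l : ι) (k : ℕ) (ω : Ω) : c l k ω ^ 2 ≤ s := by
  rcases lt_or_ge k n with hk | hk
  · exact (Finset.single_le_sum (f := fun k => c l k ω ^ 2) (fun _ _ => sq_nonneg _)
      (Finset.mem_range.2 hk)).trans (hc.energy l ω)
  · rw [hc.vanish l k ω hk]
    simpa using hs

lemma moments [IsProbabilityMeasure P] (hξ : IsStdNoise P ξ m4) (hs : 0 ≤ s) (l : ι) (k : ℕ) :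
    HasAllMoments (c l k) P :=
  HasAllMoments.of_bound ((hc.measurable l k).mono (hξ.past_le k) le_rfl) (Real.sqrt s)
    fun ω => Real.abs_le_sqrt (hc.sq_le hs l k ω)

/-- Second moment of a linear combination of the window sums. -/
lemma integral_linear_sq_le [IsProbabilityMeasure P] (hξ : IsStdNoise P ξ m4) (hs : 0 ≤ s)
    (a : ι → ℝ) :
    ∫ ω, (∑ k ∈ Finset.range n, (∑ l, a l * c l k ω) * ξ k ω) ^ 2 ∂P ≤
      2 * (s * ∑ l, a l ^ 2) := by
  have hm : ∀ k, HasAllMoments (fun ω => ∑ l, a l * c l k ω) P := fun k =>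
    HasAllMoments.sum _ fun l _ => (hc.moments hξ hs l k).const_mul (a l)
  refine (hξ.integral_sq_linear_le (h := fun k ω => ∑ l, a l * c l k ω)
    (fun k => Finset.measurable_sum _ fun l _ => (hc.measurable l k).const_mul (a l)) hm n).trans ?_
  rw [← integral_finsetSum _ fun k _ => (hm k).sq.integrable]
  refine mul_le_mul_of_nonneg_left ?_ zero_le_two
  refine (integral_mono (integrable_finsetSum _ fun k _ => (hm k).sq.integrable)
    (integrable_const (s * ∑ l, a l ^ 2)) fun ω => ?_).trans (by simp)
  dsimp only
  simp_rw [sq_sum_eq_of_orthogonal (fun l => c l _ ω) (fun l m h => hc.disjoint l m _ ω h) a]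
  rw [Finset.sum_comm, Finset.mul_sum]
  refine Finset.sum_le_sum fun l _ => ?_
  rw [← Finset.mul_sum, mul_comm s]
  exact mul_le_mul_of_nonneg_left (hc.energy l ω) (sq_nonneg _)

/-- Second moment of a centred quadratic form in the window sums. -/
lemma integral_quadForm_sq_le [IsProbabilityMeasure P] (hξ : IsStdNoise P ξ m4) (hs : 0 ≤ s)
    (hm4 : 0 ≤ m4) (G : ι → ι → ℝ) (hG : ∀ l m, G l m = G m l) :
    ∫ ω, (∑ l, ∑ m, G l m * ((∑ k ∈ Finset.range n, c l k ω * ξ k ω) *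
        (∑ k ∈ Finset.range n, c m k ω * ξ k ω))
        - ∑ l, G l l * ∑ k ∈ Finset.range n, c l k ω ^ 2) ^ 2 ∂P ≤
      s ^ 2 * (2 * m4 + 16) * ∑ l, ∑ m, G l m ^ 2 := by
  have hcm := hc.moments hξ hs
  have hrm : ∀ l i, HasAllMoments (fun ω => ∑ m, G l m * c m i ω) P := fun l i =>
    HasAllMoments.sum _ fun m _ => (hcm m i).const_mul _
  have hr : ∀ l i, Measurable[past ξ i] (fun ω => ∑ m, G l m * c m i ω) := fun l i =>
    Finset.measurable_sum _ fun m _ => (hc.measurable m i).const_mul _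
  have hRm : ∀ l k, HasAllMoments
      (fun ω => ∑ i ∈ Finset.range k, (∑ m, G l m * c m i ω) * ξ i ω) P := fun l k =>
    HasAllMoments.sum _ fun i _ => (hrm l i).mul (hξ.moments i)
  have hR : ∀ l k, Measurable[past ξ k]
      (fun ω => ∑ i ∈ Finset.range k, (∑ m, G l m * c m i ω) * ξ i ω) := fun l k => by
    simpa using measurable_sum_past (g := fun _ _ => 0) (fun _ => measurable_const) (hr l) k
  have hgm : ∀ k, HasAllMoments (fun ω => ∑ l, G l l * c l k ω ^ 2) P := fun k =>
    HasAllMoments.sum _ fun l _ => (hcm l k).sq.const_mul _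
  have hxm : ∀ k, HasAllMoments (fun ω => ∑ l, c l k ω *
      ∑ i ∈ Finset.range k, (∑ m, G l m * c m i ω) * ξ i ω) P := fun k =>
    HasAllMoments.sum _ fun l _ => (hcm l k).mul (hRm l k)
  have key := hξ.integral_sq_sum_le (g := fun k ω => ∑ l, G l l * c l k ω ^ 2)
    (h := fun k ω => 2 * ∑ l, c l k ω * ∑ i ∈ Finset.range k, (∑ m, G l m * c m i ω) * ξ i ω)
    (fun k => Finset.measurable_sum _ fun l _ => ((hc.measurable l k).pow_const 2).const_mul _)
    (fun k => (Finset.measurable_sum _ fun l _ => (hc.measurable l k).mul (hR l k)).const_mul _)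
    hgm (fun k => (hxm k).const_mul 2) n
  simp_rw [fun ω => quadForm_eq_sum G hG (fun l k => c l k ω) (fun k => ξ k ω)
    (fun l m k h => hc.disjoint l m k ω h) n]
  refine key.trans ?_
  rw [Finset.sum_add_distrib, ← Finset.mul_sum, ← Finset.mul_sum]
  have hdiag : ∑ l, G l l ^ 2 ≤ ∑ l, ∑ m, G l m ^ 2 := Finset.sum_le_sum fun l _ =>
    Finset.single_le_sum (f := fun m => G l m ^ 2) (fun _ _ => sq_nonneg _) (Finset.mem_univ l)
  -- Diagonal part: at each time at most one window is active, and the fourth powers of its weights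
  -- sum to at most `s ^ 2`, because each square is itself at most `s`.
  have b1 : ∑ k ∈ Finset.range n, ∫ ω, (∑ l, G l l * c l k ω ^ 2) ^ 2 ∂P ≤
      s ^ 2 * ∑ l, ∑ m, G l m ^ 2 := by
    refine le_trans ?_ (mul_le_mul_of_nonneg_left hdiag (sq_nonneg s))
    rw [← integral_finsetSum _ fun k _ => (hgm k).sq.integrable]
    refine (integral_mono (integrable_finsetSum _ fun k _ => (hgm k).sq.integrable)
      (integrable_const (s ^ 2 * ∑ l, G l l ^ 2)) fun ω => ?_).trans (by simp)
    dsimp only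
    have : ∀ k, (∑ l, G l l * c l k ω ^ 2) ^ 2 = ∑ l, G l l ^ 2 * (c l k ω ^ 2) ^ 2 := fun k =>
      sq_sum_eq_of_orthogonal (fun l => c l k ω ^ 2) (fun l m h => by
        rw [← mul_pow, hc.disjoint l m k ω h]; simp) fun l => G l l
    simp_rw [this]
    rw [Finset.sum_comm, Finset.mul_sum]
    refine Finset.sum_le_sum fun l _ => ?_
    rw [← Finset.mul_sum, mul_comm (s ^ 2)]
    refine mul_le_mul_of_nonneg_left ?_ (sq_nonneg _)
    calc ∑ k ∈ Finset.range n, (c l k ω ^ 2) ^ 2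
        ≤ ∑ k ∈ Finset.range n, s * c l k ω ^ 2 := Finset.sum_le_sum fun k _ => by
          rw [pow_two (c l k ω ^ 2)]
          exact mul_le_mul_of_nonneg_right (hc.sq_le hs l k ω) (sq_nonneg _)
      _ ≤ s ^ 2 := by
          rw [← Finset.mul_sum, pow_two]
          exact mul_le_mul_of_nonneg_left (hc.energy l ω) hs
  have b2 : ∑ k ∈ Finset.range n, ∫ ω, (2 * ∑ l, c l k ω *
      ∑ i ∈ Finset.range k, (∑ m, G l m * c m i ω) * ξ i ω) ^ 2 ∂P ≤
      8 * s ^ 2 * ∑ l, ∑ m, G l m ^ 2 := by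
    have e : ∀ k ω, (2 * ∑ l, c l k ω *
        ∑ i ∈ Finset.range k, (∑ m, G l m * c m i ω) * ξ i ω) ^ 2 =
        4 * ∑ l, c l k ω ^ 2 * (∑ i ∈ Finset.range k, (∑ m, G l m * c m i ω) * ξ i ω) ^ 2 := by
      intro k ω
      have := sq_sum_eq_of_orthogonal (s := Finset.univ) (fun l => c l k ω)
        (fun l m h => hc.disjoint l m k ω h)
        fun l => ∑ i ∈ Finset.range k, (∑ m, G l m * c m i ω) * ξ i ω
      rw [mul_pow]
      simp_rw [mul_comm (c _ k ω)]
      rw [this]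
      simp_rw [mul_comm (c _ k ω ^ 2)]
      norm_num
    simp_rw [e, integral_const_mul]
    rw [← Finset.mul_sum]
    simp_rw [fun k => integral_finsetSum (μ := P) Finset.univ fun l _ =>
      ((hcm l k).sq.mul (hRm l k).sq).integrable]
    rw [Finset.sum_comm]
    -- Off-diagonal part: for fixed `l`, summation by parts replaces the running martingale by its
    -- terminal value. The energy of the window then comes out as `s`, and the linear estimate
    -- supplies the second `s`.
    have : ∀ l, ∑ k ∈ Finset.range n, ∫ ω, c l k ω ^ 2 *
        (∑ i ∈ Finset.range k, (∑ m, G l m * c m i ω) * ξ i ω) ^ 2 ∂P ≤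
        s * (2 * (s * ∑ m, G l m ^ 2)) := by
      intro l
      refine (hξ.integral_sum_sq_mul_sq_le (hc.measurable l) (hr l) (hcm l) (hrm l) n).trans ?_
      refine le_trans ?_ (mul_le_mul_of_nonneg_left
        (hc.integral_linear_sq_le hξ hs (fun m => G l m)) hs)
      rw [← integral_const_mul]
      refine integral_mono ((HasAllMoments.sum _ fun k _ => (hcm l k).sq).mul
        (hRm l n).sq).integrable ((hRm l n).sq.const_mul s).integrable fun ω => ?_
      exact mul_le_mul_of_nonneg_right (hc.energy l ω) (sq_nonneg _)
    calc _ ≤ 4 * ∑ l, s * (2 * (s * ∑ m, G l m ^ 2)) :=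
          mul_le_mul_of_nonneg_left (Finset.sum_le_sum fun l _ => this l) (by norm_num)
      _ = _ := by simp only [← Finset.mul_sum]; ring
  nlinarith [mul_le_mul_of_nonneg_left b1 (mul_nonneg zero_le_two hm4)]

end

end IsWindowWeight

end QuadraticForm

/-! ### The deterministic oracle inequality. -/

section Oracle

/-- Young's inequality with the normalization kept explicit. The hypothesis `h` is needed because `x
^ 2 / 0 = 0` would otherwise hide the deviation. -/
lemma two_mul_abs_le_add_div {x A e : ℝ} (hA : 0 ≤ A) (he : 0 < e) (h : A = 0 → x = 0) :
    2 * |x| ≤ e * A + x ^ 2 / A / e := by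
  rcases hA.eq_or_lt with h0 | h0
  · simp [h h0.symm, ← h0]
  · have e1 : e * A + x ^ 2 / A / e - 2 * |x| = (e * A - |x|) ^ 2 / (A * e) := by
      rw [← sq_abs x]
      field_simp
      ring
    have : 0 ≤ (e * A - |x|) ^ 2 / (A * e) := by positivity
    linarith

lemma sum_two_mul_le {ι : Type*} (s : Finset ι) (f g : ι → ℝ) {e : ℝ} (he : 0 < e) :
    2 * ∑ i ∈ s, f i * g i ≤ e * ∑ i ∈ s, f i ^ 2 + (∑ i ∈ s, g i ^ 2) / e := by
  rw [Finset.mul_sum, Finset.mul_sum, Finset.sum_div, ← Finset.sum_add_distrib]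
  refine Finset.sum_le_sum fun i _ => ?_
  have e1 : e * f i ^ 2 + g i ^ 2 / e - 2 * (f i * g i) = (e * f i - g i) ^ 2 / e := by
    field_simp
    ring
  have : 0 ≤ (e * f i - g i) ^ 2 / e := by positivity
  linarith

variable {ι : Type*} [Fintype ι]

/-- Normalized deviation of the weighted sum of squared noise coefficients. -/
noncomputable def devQuad (N ψ : ι → ℝ) (p : ℝ) (w : ι → ℝ) : ℝ :=
  (∑ j, w j * (N j ^ 2 - ψ j)) ^ 2 / (p * ∑ j, w j ^ 2)

/-- Normalized linear form in the noise coefficients. -/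
noncomputable def devLin (θ N w : ι → ℝ) : ℝ := (∑ j, w j * θ j * N j) ^ 2 / ∑ j, w j ^ 2 * θ j ^ 2

lemma devQuad_nonneg (N ψ : ι → ℝ) {p : ℝ} (hp : 0 < p) (w : ι → ℝ) : 0 ≤ devQuad N ψ p w :=
  div_nonneg (sq_nonneg _) (mul_nonneg hp.le (Finset.sum_nonneg fun _ _ => sq_nonneg _))

lemma devLin_nonneg (θ N w : ι → ℝ) : 0 ≤ devLin θ N w :=
  div_nonneg (sq_nonneg _) (Finset.sum_nonneg fun _ _ => by positivity)

/-- The uniform lower bound `p` on `ψ` turns the normalization `p * ∑ w ^ 2` into a multiple of the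
penalty, which is the quantity able to absorb it. -/
lemma two_mul_quad_le (N ψ : ι → ℝ) {p e : ℝ} (hp : 0 < p) (he : 0 < e) (hψ : ∀ j, p ≤ ψ j)
    (w : ι → ℝ) :
    2 * |∑ j, w j * (N j ^ 2 - ψ j)| ≤
      e * (∑ j, w j ^ 2 * ψ j) + devQuad N ψ p w / e := by
  have h0 : 0 ≤ p * ∑ j, w j ^ 2 := mul_nonneg hp.le (Finset.sum_nonneg fun _ _ => sq_nonneg _)
  refine (two_mul_abs_le_add_div h0 he fun h => ?_).trans (add_le_add_left
    (mul_le_mul_of_nonneg_left ?_ he.le) _)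
  · have h1 : ∑ j, w j ^ 2 = 0 := by simpa [hp.ne'] using h
    rw [Finset.sum_eq_zero_iff_of_nonneg fun _ _ => sq_nonneg _] at h1
    exact Finset.sum_eq_zero fun j hj => by
      rw [pow_eq_zero_iff two_ne_zero |>.1 (h1 j hj), zero_mul]
  · rw [Finset.mul_sum]
    exact Finset.sum_le_sum fun j _ => by nlinarith [sq_nonneg (w j), hψ j]

lemma two_mul_lin_le (θ N w : ι → ℝ) {e : ℝ} (he : 0 < e) :
    2 * |∑ j, w j * θ j * N j| ≤ e * (∑ j, w j ^ 2 * θ j ^ 2) + devLin θ N w / e := by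
  refine two_mul_abs_le_add_div (Finset.sum_nonneg fun _ _ => by positivity) he fun h => ?_
  rw [Finset.sum_eq_zero_iff_of_nonneg fun _ _ => by positivity] at h
  refine Finset.sum_eq_zero fun j hj => ?_
  have := h j hj
  rw [← mul_pow, pow_eq_zero_iff two_ne_zero] at this
  rw [this, zero_mul]

/-- The remainder of the pathwise oracle inequality. -/
noncomputable def oracleRem (θ β N ψ : ι → ℝ) (p : ℝ) (lam lam' : ι → ℝ) : ℝ :=
  ∑ j, β j ^ 2 + devQuad N ψ p lam' + devQuad N ψ p lam + devQuad N ψ p (fun j => lam' j ^ 2) +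
    devQuad N ψ p (fun j => lam j ^ 2) + devLin θ N (fun j => lam' j - lam j) +
    devLin θ N (fun j => lam j * (1 - lam j))

lemma sum_sq_noise_le (N ψ : ι → ℝ) {p : ℝ} (hp : 0 < p) (hψ : ∀ j, p ≤ ψ j) {lam : ι → ℝ}
    (hl : ∀ j, lam j ∈ Set.Icc (0 : ℝ) 1) :
    |∑ j, lam j ^ 2 * N j ^ 2 - ∑ j, lam j ^ 2 * ψ j| ≤
      (∑ j, lam j ^ 2 * ψ j) / 2 + devQuad N ψ p (fun j => lam j ^ 2) / 2 := by
  have h := two_mul_quad_le N ψ hp one_pos hψ (fun j => lam j ^ 2)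
  have h2 : ∑ j, (lam j ^ 2) ^ 2 * ψ j ≤ ∑ j, lam j ^ 2 * ψ j := Finset.sum_le_sum fun j _ => by
    refine mul_le_mul_of_nonneg_right ?_ (hp.le.trans (hψ j))
    have : lam j ^ 2 ≤ 1 := pow_le_one₀ (hl j).1 (hl j).2
    nlinarith [sq_nonneg (lam j)]
  simp only [mul_sub, Finset.sum_sub_distrib] at h
  linarith

/-- The penalty is dominated by the loss of the estimator. -/
lemma penalty_le_loss (θ β N ψ : ι → ℝ) {p : ℝ} (hp : 0 < p) (hψ : ∀ j, p ≤ ψ j) {lam : ι → ℝ}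
    (hl : ∀ j, lam j ∈ Set.Icc (0 : ℝ) 1) :
    ∑ j, lam j ^ 2 * ψ j ≤ 4 * ∑ j, (lam j * (θ j + β j + N j) - θ j) ^ 2 + 12 * ∑ j, β j ^ 2 +
      8 * devLin θ N (fun j => lam j * (1 - lam j)) + devQuad N ψ p (fun j => lam j ^ 2) := by
  have hz := two_mul_lin_le θ N (fun j => lam j * (1 - lam j)) (e := 1 / 2) (by norm_num)
  have hF := abs_le.1 (sum_sq_noise_le N ψ hp hψ hl)
  have hz' := (abs_le.1 (le_refl |∑ j, lam j * (1 - lam j) * θ j * N j|)).2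
  have h1 : ∑ j, (lam j * (1 - lam j)) ^ 2 * θ j ^ 2 ≤ ∑ j, (1 - lam j) ^ 2 * θ j ^ 2 :=
    Finset.sum_le_sum fun j _ => by
      refine mul_le_mul_of_nonneg_right ?_ (sq_nonneg _)
      have : lam j ^ 2 ≤ 1 := pow_le_one₀ (hl j).1 (hl j).2
      nlinarith [sq_nonneg (1 - lam j)]
  -- The error is `λN + λβ - (1-λ)θ`. The two products containing `β` cost half of each of the
  -- squares of `λN` and `(1-λ)θ`, together with `3β²`. The product of `θ` and `N` is kept, for
  -- `devLin`.
  have h2 : ∑ j, (lam j ^ 2 * N j ^ 2 / 2 - 3 * β j ^ 2 - 2 * (lam j * (1 - lam j) * θ j * N j)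
      + (1 - lam j) ^ 2 * θ j ^ 2 / 2) ≤ ∑ j, (lam j * (θ j + β j + N j) - θ j) ^ 2 :=
    Finset.sum_le_sum fun j _ => by
      have : lam j ^ 2 ≤ 1 := pow_le_one₀ (hl j).1 (hl j).2
      nlinarith [sq_nonneg (lam j * N j + 2 * lam j * β j),
        sq_nonneg ((1 - lam j) * θ j - 2 * lam j * β j), mul_nonneg (sub_nonneg.2 this) (sq_nonneg (β j))]
  simp only [Finset.sum_add_distrib, Finset.sum_sub_distrib, ← Finset.mul_sum, ← Finset.sum_div]
    at h2
  linarith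

/-- Bookkeeping for `oracle_pathwise`: `u`, `v` are the losses of the selected and the reference
weight, `P'`, `P` their penalties, `F'`, `F` the weighted noise energies. Every fluctuation is
absorbed at rate `δ / 64`. The occurrences of `P'` then total `21 / 64` of `δ P'`, less than the `-δ
P'` supplied by minimality, while `P` is paid for by the loss `v` through `hP`. -/
lemma oracle_arith {u v P P' F F' T b q q' q2 q2' z1 z2 δ X1 X2 X3 X4 X5 : ℝ}
    (hδ : 0 < δ) (hδ1 : δ ≤ 1 / 12) (hu : 0 ≤ u) (hv : 0 ≤ v) (hP' : 0 ≤ P')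
    (hb : 0 ≤ b) (hq : 0 ≤ q) (hq' : 0 ≤ q') (hq2 : 0 ≤ q2) (hq2' : 0 ≤ q2') (hz1 : 0 ≤ z1)
    (hz2 : 0 ≤ z2)
    (h : u ≤ v + 2 * X1 + 2 * X2 + 2 * X3 + 2 * X4 - 2 * X5 - δ * P' + δ * P)
    (h1 : 2 * X1 ≤ δ / 64 * (2 * u + 2 * v) + b / (δ / 64))
    (h2 : 2 * X2 ≤ δ / 64 * (2 * F' + 2 * F) + b / (δ / 64))
    (h3 : 2 * X3 ≤ δ / 64 * T + z1 / (δ / 64))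
    (h4 : 2 * X4 ≤ δ / 64 * P' + q' / (δ / 64))
    (h5 : -(2 * X5) ≤ δ / 64 * P + q / (δ / 64))
    (hT : T ≤ 4 * u + 4 * v + 4 * b + 8 * F' + 8 * F)
    (hF' : F' ≤ 2 * P' + q2') (hF : F ≤ 2 * P + q2)
    (hP : P ≤ 4 * v + 12 * b + 8 * z2 + q2) :
    u ≤ (1 + 4 * δ) / (1 - 6 * δ) * v + 300 / δ * (b + q' + q + q2' + q2 + z1 + z2) := by
  set R := b + q' + q + q2' + q2 + z1 + z2 with hR
  have hR0 : 0 ≤ R := by positivity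
  have e : ∀ x : ℝ, x / (δ / 64) = 64 * (x / δ) := fun x => by field_simp
  rw [e] at h1 h2 h3 h4 h5
  have hRd : 0 ≤ R / δ := by positivity
  have hinv : δ * R ≤ R / δ := by
    rw [le_div_iff₀ hδ]
    nlinarith [mul_nonneg hR0 hδ.le]
  have hFF : δ * (10 * F' + 10 * F) ≤ δ * (20 * P' + 20 * P + 10 * q2' + 10 * q2) :=
    mul_le_mul_of_nonneg_left (by linarith) hδ.le
  have hPP : δ * P ≤ δ * (4 * v + 12 * R) :=
    mul_le_mul_of_nonneg_left (by linarith) hδ.le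
  have hTT : δ * T ≤ δ * (4 * u + 4 * v + 4 * b + 8 * F' + 8 * F) :=
    mul_le_mul_of_nonneg_left hT hδ.le
  have hbb : δ * (4 * b + 10 * q2' + 10 * q2) ≤ δ * (10 * R) :=
    mul_le_mul_of_nonneg_left (by linarith) hδ.le
  have hsum : b / δ + b / δ + z1 / δ + q' / δ + q / δ ≤ 2 * (R / δ) := by
    rw [← add_div, ← add_div, ← add_div, ← add_div, ← mul_div_assoc]
    exact div_le_div_of_nonneg_right (by linarith) hδ.le
  have hPd : 0 ≤ δ * P' := by positivity
  have main : u * (1 - δ / 8) ≤ v * (1 + 6 * δ) + 150 * (R / δ) := by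
    have : 0 ≤ δ * v := by positivity
    have : 0 ≤ δ * u := by positivity
    linarith
  have hd : 0 < 1 - δ / 8 := by linarith
  have hd6 : 0 < 1 - 6 * δ := by linarith
  have h6 : (1 + 6 * δ) / (1 - δ / 8) ≤ (1 + 4 * δ) / (1 - 6 * δ) := by
    rw [div_le_div_iff₀ hd hd6]
    nlinarith
  calc u ≤ (v * (1 + 6 * δ) + 150 * (R / δ)) / (1 - δ / 8) := (le_div_iff₀ hd).2 main
    _ = (1 + 6 * δ) / (1 - δ / 8) * v + 150 * (R / δ) / (1 - δ / 8) := by ring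
    _ ≤ (1 + 4 * δ) / (1 - 6 * δ) * v + 300 * (R / δ) := by
        refine add_le_add (mul_le_mul_of_nonneg_right h6 hv) ?_
        rw [div_le_iff₀ hd]
        nlinarith
    _ = _ := by ring

/-- Pathwise oracle inequality for the minimizer of the penalized cost. -/
theorem oracle_pathwise (θ β N ψ : ι → ℝ) {p δ : ℝ} (hp : 0 < p) (hψ : ∀ j, p ≤ ψ j)
    (hδ : 0 < δ) (hδ1 : δ ≤ 1 / 12) {lam lam' : ι → ℝ}
    (hl : ∀ j, lam j ∈ Set.Icc (0 : ℝ) 1) (hl' : ∀ j, lam' j ∈ Set.Icc (0 : ℝ) 1)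
    {θh : ι → ℝ} (hθh : ∀ j, θh j = θ j + β j + N j)
    (hJ : ∑ j, lam' j ^ 2 * θh j ^ 2 - 2 * ∑ j, lam' j * (θh j ^ 2 - ψ j)
        + δ * ∑ j, lam' j ^ 2 * ψ j ≤
      ∑ j, lam j ^ 2 * θh j ^ 2 - 2 * ∑ j, lam j * (θh j ^ 2 - ψ j)
        + δ * ∑ j, lam j ^ 2 * ψ j) :
    ∑ j, (lam' j * θh j - θ j) ^ 2 ≤
      (1 + 4 * δ) / (1 - 6 * δ) * ∑ j, (lam j * θh j - θ j) ^ 2 +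
        300 / δ * oracleRem θ β N ψ p lam lam' := by
  obtain rfl : θh = fun j => θ j + β j + N j := funext hθh
  have hδ64 : 0 < δ / 64 := by positivity
  have hψ0 : ∀ j, 0 ≤ ψ j := fun j => hp.le.trans (hψ j)
  have hμ : ∀ j, (lam' j - lam j) ^ 2 ≤ 1 := fun j => by
    rw [sq_le_one_iff_abs_le_one, abs_le]
    constructor <;> linarith [(hl j).1, (hl j).2, (hl' j).1, (hl' j).2]
  have hF' := (abs_le.1 (sum_sq_noise_le N ψ hp hψ hl')).2
  have hF := (abs_le.1 (sum_sq_noise_le N ψ hp hψ hl)).2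
  have hz := (mul_le_mul_of_nonneg_left (le_abs_self _) zero_le_two).trans
    (two_mul_lin_le θ N (fun j => lam' j - lam j) hδ64)
  have hq' := (mul_le_mul_of_nonneg_left (le_abs_self _) zero_le_two).trans
    (two_mul_quad_le N ψ hp hδ64 hψ lam')
  have hq := (mul_le_mul_of_nonneg_left (neg_le_abs _) zero_le_two).trans
    (two_mul_quad_le N ψ hp hδ64 hψ lam)
  have hPn : ∀ l : ι → ℝ, 0 ≤ ∑ j, l j ^ 2 * ψ j := fun l =>
    Finset.sum_nonneg fun j _ => mul_nonneg (sq_nonneg _) (hψ0 j)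
  have c1 := sum_two_mul_le Finset.univ
    (fun j => (lam' j - lam j) * (θ j + β j + N j)) β hδ64
  have c2 := sum_two_mul_le Finset.univ (fun j => (lam' j - lam j) * N j) β hδ64
  have c3 : ∑ j, ((lam' j - lam j) * (θ j + β j + N j)) ^ 2 ≤
      2 * ∑ j, (lam' j * (θ j + β j + N j) - θ j) ^ 2 +
      2 * ∑ j, (lam j * (θ j + β j + N j) - θ j) ^ 2 := by
    rw [Finset.mul_sum, Finset.mul_sum, ← Finset.sum_add_distrib]
    refine Finset.sum_le_sum fun j _ => ?_
    nlinarith [sq_nonneg ((lam' j * (θ j + β j + N j) - θ j) + (lam j * (θ j + β j + N j) - θ j))]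
  have c4 : ∑ j, ((lam' j - lam j) * N j) ^ 2 ≤
      2 * ∑ j, lam' j ^ 2 * N j ^ 2 + 2 * ∑ j, lam j ^ 2 * N j ^ 2 := by
    rw [Finset.mul_sum, Finset.mul_sum, ← Finset.sum_add_distrib]
    refine Finset.sum_le_sum fun j _ => ?_
    nlinarith [sq_nonneg ((lam' j + lam j) * N j)]
  -- The normalization of `devLin` involves the unknown `θ`. Substituting `θ = θh - β - N` reduces
  -- it to losses, bias and noise energy.
  have c5 : ∑ j, (lam' j - lam j) ^ 2 * θ j ^ 2 ≤
      2 * ∑ j, ((lam' j - lam j) * (θ j + β j + N j)) ^ 2 + 4 * ∑ j, β j ^ 2 +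
      4 * ∑ j, ((lam' j - lam j) * N j) ^ 2 := by
    simp only [Finset.mul_sum, ← Finset.sum_add_distrib]
    refine Finset.sum_le_sum fun j _ => ?_
    have hb : (lam' j - lam j) ^ 2 * β j ^ 2 ≤ β j ^ 2 :=
      mul_le_of_le_one_left (sq_nonneg _) (hμ j)
    nlinarith [sq_nonneg ((lam' j - lam j) * (θ j + 2 * (β j + N j))),
      sq_nonneg ((lam' j - lam j) * (β j - N j))]
  refine oracle_arith (u := ∑ j, (lam' j * (θ j + β j + N j) - θ j) ^ 2)
    (X1 := ∑ j, (lam' j - lam j) * (θ j + β j + N j) * β j)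
    (X2 := ∑ j, (lam' j - lam j) * N j * β j)
    (X3 := ∑ j, (lam' j - lam j) * θ j * N j)
    (X4 := ∑ j, lam' j * (N j ^ 2 - ψ j)) (X5 := ∑ j, lam j * (N j ^ 2 - ψ j))
    (P' := ∑ j, lam' j ^ 2 * ψ j) (P := ∑ j, lam j ^ 2 * ψ j)
    (F' := ∑ j, lam' j ^ 2 * N j ^ 2) (F := ∑ j, lam j ^ 2 * N j ^ 2)
    (T := ∑ j, (lam' j - lam j) ^ 2 * θ j ^ 2)
    hδ hδ1 (Finset.sum_nonneg fun _ _ => sq_nonneg _)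
    (Finset.sum_nonneg fun _ _ => sq_nonneg _) (hPn _) (Finset.sum_nonneg fun _ _ => sq_nonneg _)
    (devQuad_nonneg _ _ hp _) (devQuad_nonneg _ _ hp _) (devQuad_nonneg _ _ hp _)
    (devQuad_nonneg _ _ hp _) (devLin_nonneg _ _ _) (devLin_nonneg _ _ _)
    ?_ ?_ ?_ hz hq' (by linarith) (by linarith) ?_ ?_ (penalty_le_loss θ β N ψ hp hψ hl)
  -- The cost uses `θh² - ψ` in place of the unknown `θ θh`. Their difference is `θh β + N β + θ N +
  -- (N² - ψ)`, which gives the terms `X1` to `X5`, the last summand being split between `lam'` and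
  -- `lam`.
  · rw [← sub_nonneg] at hJ ⊢
    refine hJ.trans (le_of_eq ?_)
    simp only [Finset.mul_sum, ← Finset.sum_sub_distrib, ← Finset.sum_add_distrib]
    exact Finset.sum_congr rfl fun j _ => by ring
  · exact c1.trans (add_le_add_left (mul_le_mul_of_nonneg_left c3 hδ64.le) _)
  · exact c2.trans (add_le_add_left (mul_le_mul_of_nonneg_left c4 hδ64.le) _)
  · linarith [hPn lam', devQuad_nonneg N ψ hp fun j => lam' j ^ 2]
  · linarith [hPn lam, devQuad_nonneg N ψ hp fun j => lam j ^ 2]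

end Oracle

/-! ### The sequential estimator as a sum with predictable weights. -/

namespace Design

variable (D : Design)

lemma Q_eq_zero_or_one (l j : ℕ) : D.Q l j = 0 ∨ D.Q l j = 1 := by
  unfold Q
  by_cases h : (D.x j - D.z l) / D.h ∈ Set.Icc (-1 : ℝ) 1 <;> simp [h]

lemma A_self (l : ℕ) (y : ℕ → ℝ) (k : ℕ) : D.A l y k k = 0 := by simp [A]

lemma A_succ (l : ℕ) (y : ℕ → ℝ) {k i : ℕ} (h : k ≤ i) :
    D.A l y k (i + 1) = D.A l y k i + D.Q l (i + 1) * y i ^ 2 := by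
  unfold A
  rw [Finset.sum_Icc_succ_top (by omega)]
  simp

lemma A_mono (l : ℕ) (y : ℕ → ℝ) (k : ℕ) : Monotone (D.A l y k) := fun _ _ h =>
  Finset.sum_le_sum_of_subset_of_nonneg (Finset.Icc_subset_Icc_right h) fun _ _ _ =>
    mul_nonneg (D.Q_nonneg l _) (sq_nonneg _)

lemma A_nonneg (l : ℕ) (y : ℕ → ℝ) (k i : ℕ) : 0 ≤ D.A l y k i :=
  Finset.sum_nonneg fun _ _ => mul_nonneg (D.Q_nonneg l _) (sq_nonneg _)

/-- The weight of `y (i + 1)` in the sequential estimator, in a form that depends only on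
`y 0, …, y i`. -/
noncomputable def wt (l i : ℕ) (y : ℕ → ℝ) : ℝ :=
  -- The increment of `min A H` is `Q y²` before the threshold, `H - A = ϰ² Q y²` at the crossing
  -- step and `0` afterwards. Its root times the sign of `y i` is therefore `Q y`, `ϰ Q y` and `0`
  -- in turn, with no mention of `τ`.
  if D.iota l ≤ i ∧ i < D.k2 l then
    Real.sqrt (min (D.A l y (D.iota l) (i + 1)) (D.H l y) - min (D.A l y (D.iota l) i) (D.H l y))
      / D.H l y * (y i / |y i|)
  else 0

lemma min_A_step_nonneg (l i : ℕ) (y : ℕ → ℝ) (c : ℝ) (k : ℕ) :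
    0 ≤ min (D.A l y k (i + 1)) c - min (D.A l y k i) c :=
  sub_nonneg.2 (min_le_min_right _ (D.A_mono l y k (Nat.le_succ i)))

lemma wt_sq (l i : ℕ) (y : ℕ → ℝ) (h : D.iota l ≤ i ∧ i < D.k2 l) :
    D.wt l i y ^ 2 = (min (D.A l y (D.iota l) (i + 1)) (D.H l y) -
      min (D.A l y (D.iota l) i) (D.H l y)) / D.H l y ^ 2 := by
  unfold wt
  rw [if_pos h]
  -- At `y i = 0` the sign factor `y i / |y i|` is `0`, but then the increment of `A` is `0` as
  -- well.
  by_cases hy : y i = 0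
  · rw [D.A_succ l y h.1, hy]
    simp
  · rw [mul_pow, div_pow, Real.sq_sqrt (D.min_A_step_nonneg _ _ _ _ _), div_pow, sq_abs,
      div_self (pow_ne_zero 2 hy), mul_one]

lemma sum_wt_sq (l : ℕ) (y : ℕ → ℝ) {n : ℕ} (hn : D.k2 l ≤ n) (hι : D.iota l ≤ D.k2 l)
    (hH : 0 < D.H l y) :
    ∑ i ∈ Finset.range n, D.wt l i y ^ 2 =
      min (D.A l y (D.iota l) (D.k2 l)) (D.H l y) / D.H l y ^ 2 := by
  have h1 : ∑ i ∈ Finset.range n, D.wt l i y ^ 2 =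
      ∑ i ∈ Finset.Ico (D.iota l) (D.k2 l), D.wt l i y ^ 2 := by
    symm
    refine Finset.sum_subset (fun i hi => ?_) fun i _ hi => ?_
    · have := Finset.mem_Ico.1 hi
      exact Finset.mem_range.2 (by omega)
    · rw [Finset.mem_Ico] at hi
      simp [wt, hi]
  rw [h1, Finset.sum_congr rfl fun i hi => D.wt_sq l i y (Finset.mem_Ico.1 hi), ← Finset.sum_div,
    Finset.sum_Ico_sub (fun i => min (D.A l y (D.iota l) i) (D.H l y)) hι, D.A_self,
    min_eq_left hH.le, sub_zero]

/-- Valid on every path, not only on `Γ_l`; this lets moments be computed without conditioning on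
`Γ`. -/
lemma sum_wt_sq_le (l : ℕ) (y : ℕ → ℝ) {n : ℕ} (hn : D.k2 l ≤ n) (hι : D.iota l ≤ D.k2 l)
    (hH : 0 < D.H l y) : ∑ i ∈ Finset.range n, D.wt l i y ^ 2 ≤ 1 / D.H l y := by
  rw [D.sum_wt_sq l y hn hι hH, div_le_div_iff₀ (by positivity) hH, one_mul, pow_two]
  exact mul_le_mul_of_nonneg_right (min_le_right _ _) hH.le

lemma iota_lt_of_mem_GammaAt (l : ℕ) (y : ℕ → ℝ) (hH : 0 < D.H l y) (hy : y ∈ D.GammaAt l) :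
    D.iota l + 1 ≤ D.k2 l - 1 := by
  have hy2 : D.H l y ≤ D.A l y (D.iota l) (D.k2 l - 1) := hy
  by_contra hc
  have : D.A l y (D.iota l) (D.k2 l - 1) = 0 := by
    unfold A
    rw [Finset.Icc_eq_empty hc, Finset.sum_empty]
  linarith

/-- The purpose of the correction `ϰ`: on `Γ_l` the threshold is reached, so the telescoped energy
has the observable value `σ_l²`. -/
lemma sum_wt_sq_eq (l : ℕ) (y : ℕ → ℝ) {n : ℕ} (hn : D.k2 l ≤ n) (hH : 0 < D.H l y)
    (hy : y ∈ D.GammaAt l) : ∑ i ∈ Finset.range n, D.wt l i y ^ 2 = 1 / D.H l y := by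
  have h1 := D.iota_lt_of_mem_GammaAt l y hH hy
  rw [D.sum_wt_sq l y hn (by omega) hH, min_eq_right, pow_two, ← div_div, div_self hH.ne']
  exact le_trans hy (D.A_mono l y _ (Nat.sub_le _ _))

lemma tau_spec (l : ℕ) (y : ℕ → ℝ) (hH : 0 < D.H l y) (hy : y ∈ D.GammaAt l) :
    ∃ t, D.tau l y = t + 1 ∧ D.iota l ≤ t ∧ t + 1 < D.k2 l ∧
      D.A l y (D.iota l) t < D.H l y ∧ D.H l y ≤ D.A l y (D.iota l) (t + 1) := by
  have hlt := D.iota_lt_of_mem_GammaAt l y hH hy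
  have hmem := Nat.sInf_mem (s := insert (D.k2 l)
    {k | D.iota l + 1 ≤ k ∧ k ≤ D.k2 l ∧ D.H l y ≤ D.A l y (D.iota l) k}) ⟨_, Or.inl rfl⟩
  have hle : D.tau l y ≤ D.k2 l - 1 := Nat.sInf_le (Or.inr ⟨hlt, by omega, hy⟩)
  change D.tau l y ∈ _ at hmem
  rcases hmem with hmem | ⟨h1, h2, h3⟩
  · omega
  obtain ⟨t, ht⟩ : ∃ t, D.tau l y = t + 1 := ⟨D.tau l y - 1, by omega⟩
  rw [ht] at h1 h3 hle
  refine ⟨t, ht, by omega, by omega, ?_, h3⟩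
  by_contra hc
  push Not at hc
  by_cases h4 : D.iota l + 1 ≤ t
  · have h5 : D.tau l y ≤ t := Nat.sInf_le (Or.inr ⟨h4, by omega, hc⟩)
    omega
  · have : t = D.iota l := by omega
    rw [this, D.A_self] at hc
    linarith

lemma sqrt_Q_mul_sq (l j : ℕ) (v : ℝ) : Real.sqrt (D.Q l j * v ^ 2) = D.Q l j * |v| := by
  rcases D.Q_eq_zero_or_one l j with h | h <;> simp [h, Real.sqrt_sq_eq_abs]

lemma abs_mul_div_abs (v : ℝ) : |v| * (v / |v|) = v := by
  by_cases h : v = 0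
  · simp [h]
  · field_simp

lemma wt_of_lt (l : ℕ) (y : ℕ → ℝ) {i : ℕ} (hi : D.iota l ≤ i ∧ i < D.k2 l)
    (h : D.A l y (D.iota l) (i + 1) ≤ D.H l y) :
    D.wt l i y = D.Q l (i + 1) * y i / D.H l y := by
  unfold wt
  have h' := (D.A_mono l y (D.iota l) (Nat.le_succ i)).trans h
  rw [if_pos hi, min_eq_left h, min_eq_left h', D.A_succ l y hi.1, add_sub_cancel_left,
    sqrt_Q_mul_sq]
  calc _ = D.Q l (i + 1) * (|y i| * (y i / |y i|)) / D.H l y := by ring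
    _ = _ := by rw [abs_mul_div_abs]

lemma wt_of_ge (l : ℕ) (y : ℕ → ℝ) {i : ℕ} (h : D.H l y ≤ D.A l y (D.iota l) i) :
    D.wt l i y = 0 := by
  unfold wt
  have h' := h.trans (D.A_mono l y (D.iota l) (Nat.le_succ i))
  rw [min_eq_right h, min_eq_right h']
  simp

lemma wt_tau (l : ℕ) (y : ℕ → ℝ) {t : ℕ} (ht : D.tau l y = t + 1)
    (hi : D.iota l ≤ t ∧ t < D.k2 l) (h1 : D.A l y (D.iota l) t < D.H l y)
    (h2 : D.H l y ≤ D.A l y (D.iota l) (t + 1)) :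
    D.wt l t y = D.kappa l y * D.Q l (t + 1) * y t / D.H l y := by
  unfold wt kappa
  rw [if_pos hi, min_eq_right h2, min_eq_left h1.le, ht, Nat.add_sub_cancel]
  rw [D.A_succ l y hi.1] at h2
  have hpos : 0 < D.Q l (t + 1) * y t ^ 2 := by linarith
  have hQ : D.Q l (t + 1) = 1 := by
    rcases D.Q_eq_zero_or_one l (t + 1) with h | h
    · simp [h] at hpos
    · exact h
  rw [hQ, one_mul, Real.sqrt_div (by linarith), Real.sqrt_sq_eq_abs]
  ring

/-- On `Γ_l` the sequential estimator is a linear form in the observations. -/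
lemma seqEst_eq_sum (l : ℕ) (y : ℕ → ℝ) {n : ℕ} (hn : D.k2 l ≤ n) (hH : 0 < D.H l y)
    (hy : y ∈ D.GammaAt l) :
    D.seqEst l y = ∑ i ∈ Finset.range n, D.wt l i y * y (i + 1) := by
  obtain ⟨t, ht, hι, hk, h1, h2⟩ := D.tau_spec l y hH hy
  have hs : ∑ i ∈ Finset.range n, D.wt l i y * y (i + 1) =
      ∑ i ∈ Finset.Ico (D.iota l) (t + 1), D.wt l i y * y (i + 1) := by
    symm
    refine Finset.sum_subset (fun i hi => ?_) fun i _ hi => ?_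
    · have := Finset.mem_Ico.1 hi
      exact Finset.mem_range.2 (by omega)
    · rw [Finset.mem_Ico] at hi
      by_cases hi' : D.iota l ≤ i
      · rw [D.wt_of_ge l y (h2.trans (D.A_mono l y _ (by omega))), zero_mul]
      · simp [wt, hi']
  have hw : ∀ i ∈ Finset.Ico (D.iota l) t, D.wt l i y * y (i + 1) =
      1 / D.H l y * (D.Q l (i + 1) * y (i + 1 - 1) * y (i + 1)) := fun i hi => by
    rw [Finset.mem_Ico] at hi
    rw [D.wt_of_lt l y ⟨hi.1, by omega⟩ ((D.A_mono l y _ (by omega : i + 1 ≤ t)).trans h1.le),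
      Nat.add_sub_cancel]
    ring
  rw [hs, Finset.sum_Ico_succ_top hι, Finset.sum_congr rfl hw, ← Finset.mul_sum,
    Finset.sum_Ico_add' (fun j => D.Q l j * y (j - 1) * y j), D.wt_tau l y ht ⟨hι, by omega⟩ h1 h2]
  unfold seqEst
  rw [Set.indicator_of_mem hy, ht, Nat.add_sub_cancel]
  have : Finset.Icc (D.iota l + 1) t = Finset.Ico (D.iota l + 1) (t + 1) := by
    ext j
    simp only [Finset.mem_Icc, Finset.mem_Ico]
    omega
  rw [this]
  ring

/-- Error decomposition of the sequential estimator for an autoregressive path. -/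
lemma abs_seqEst_sub_le (l : ℕ) (y e s : ℕ → ℝ) {n : ℕ} (hn : D.k2 l ≤ n) (hH : 0 < D.H l y)
    (hy : y ∈ D.GammaAt l) (hrec : ∀ i < n, y (i + 1) = s i * y i + e i) {s0 η M : ℝ}
    (hs : ∀ i < n, |s i| ≤ 1) (hs0 : |s0| ≤ 1) (hη : ∀ i < n, D.Q l (i + 1) ≠ 0 → |s i - s0| ≤ η)
    (hη0 : 0 ≤ η) (hM : ∀ i < n, y i ^ 2 ≤ M) :
    |D.seqEst l y - s0 - ∑ i ∈ Finset.range n, D.wt l i y * e i| ≤ η + 2 * M / D.H l y := by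
  obtain ⟨t, ht, hι, hk, h1, h2⟩ := D.tau_spec l y hH hy
  have hM0 : 0 ≤ M := (sq_nonneg _).trans (hM t (by omega))
  have hV := D.sum_wt_sq_eq l y hn hH hy
  have e1 : D.seqEst l y - s0 - ∑ i ∈ Finset.range n, D.wt l i y * e i =
      ∑ i ∈ Finset.range n, (D.wt l i y * s i * y i - D.H l y * D.wt l i y ^ 2 * s0) := by
    -- The numbers `H * wt ^ 2` are nonnegative and sum to one, so `s0` can be distributed over the
    -- observations.
    have : s0 = ∑ i ∈ Finset.range n, D.H l y * D.wt l i y ^ 2 * s0 := by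
      rw [← Finset.sum_mul, ← Finset.mul_sum, hV, mul_one_div_cancel hH.ne', one_mul]
    rw [D.seqEst_eq_sum l y hn hH hy]
    nth_rw 1 [this]
    rw [← Finset.sum_sub_distrib, ← Finset.sum_sub_distrib]
    refine Finset.sum_congr rfl fun i hi => ?_
    rw [hrec i (Finset.mem_range.1 hi)]
    ring
  rw [e1]
  refine (Finset.abs_sum_le_sum_abs _ _).trans ?_
  have hterm : ∀ i ∈ Finset.range n,
      |D.wt l i y * s i * y i - D.H l y * D.wt l i y ^ 2 * s0| ≤
        D.H l y * D.wt l i y ^ 2 * η + if i = t then 2 * M / D.H l y else 0 := by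
    intro i hi
    rw [Finset.mem_range] at hi
    have hnn : 0 ≤ D.H l y * D.wt l i y ^ 2 * η := by positivity
    rcases lt_trichotomy i t with h | h | h
    · rw [if_neg h.ne, add_zero]
      by_cases hi' : D.iota l ≤ i
      · rw [D.wt_of_lt l y ⟨hi', by omega⟩ ((D.A_mono l y _ (by omega : i + 1 ≤ t)).trans h1.le)]
        rcases D.Q_eq_zero_or_one l (i + 1) with hQ | hQ
        · simp [hQ]
        · rw [hQ]
          have e2 : 1 * y i / D.H l y * s i * y i - D.H l y * (1 * y i / D.H l y) ^ 2 * s0 =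
              D.H l y * (1 * y i / D.H l y) ^ 2 * (s i - s0) := by
            field_simp
          rw [e2, abs_mul, abs_of_nonneg (by positivity)]
          exact mul_le_mul_of_nonneg_left (hη i hi (by rw [hQ]; exact one_ne_zero)) (by positivity)
      · simp [wt, hi']
    -- At the stopping step `wt * y` contains `ϰ` while `H * wt ^ 2` contains `ϰ ^ 2`, so the two no
    -- longer cancel. Each is bounded separately by `y ^ 2 / H`.
    · subst h
      rw [if_pos rfl]
      refine le_add_of_nonneg_of_le hnn ?_
      have hb : D.wt l i y ^ 2 ≤ y i ^ 2 / D.H l y ^ 2 := by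
        rw [D.wt_sq l i y ⟨hι, by omega⟩]
        refine div_le_div_of_nonneg_right ?_ (sq_nonneg _)
        rw [min_eq_left h1.le]
        have := D.A_succ l y hι
        have hm := min_le_left (D.A l y (D.iota l) (i + 1)) (D.H l y)
        have hQ1 : D.Q l (i + 1) * y i ^ 2 ≤ y i ^ 2 := by
          rcases D.Q_eq_zero_or_one l (i + 1) with hQ | hQ <;> rw [hQ]
          · simpa using sq_nonneg (y i)
          · simp
        linarith
      have hb' : |D.wt l i y| ≤ |y i| / D.H l y := by
        rw [← div_pow, sq_le_sq, abs_div, abs_of_pos hH] at hb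
        exact hb
      have c1 : |D.wt l i y * s i * y i| ≤ y i ^ 2 / D.H l y := by
        rw [abs_mul, abs_mul]
        calc |D.wt l i y| * |s i| * |y i| ≤ |y i| / D.H l y * 1 * |y i| := by
              gcongr
              exact hs i hi
          _ = _ := by rw [← sq_abs]; ring
      have c2 : |D.H l y * D.wt l i y ^ 2 * s0| ≤ y i ^ 2 / D.H l y := by
        rw [abs_mul, abs_of_nonneg (by positivity)]
        calc D.H l y * D.wt l i y ^ 2 * |s0| ≤ D.H l y * (y i ^ 2 / D.H l y ^ 2) * 1 := by gcongr
          _ = _ := by field_simp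
      calc _ ≤ _ := abs_sub _ _
        _ ≤ 2 * y i ^ 2 / D.H l y := by rw [mul_div_assoc]; linarith
        _ ≤ _ := by
          have := hM i hi
          gcongr
    · rw [D.wt_of_ge l y (h2.trans (D.A_mono l y _ (by omega)))]
      simp [h.ne']
  refine (Finset.sum_le_sum hterm).trans ?_
  rw [Finset.sum_add_distrib, ← Finset.sum_mul, ← Finset.mul_sum, hV, mul_one_div_cancel hH.ne',
    one_mul, Finset.sum_ite_eq']
  have : 0 ≤ 2 * M / D.H l y := by positivity
  split_ifs <;> linarith

lemma seqEst_sq_le (l : ℕ) (y : ℕ → ℝ) {n : ℕ} (hn : D.k2 l ≤ n) (hH : 0 < D.H l y) :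
    D.seqEst l y ^ 2 ≤ (∑ i ∈ Finset.range n, y (i + 1) ^ 2) / D.H l y := by
  by_cases hy : y ∈ D.GammaAt l
  · rw [D.seqEst_eq_sum l y hn hH hy]
    refine (Finset.sum_mul_sq_le_sq_mul_sq _ _ _).trans (le_of_eq ?_)
    rw [D.sum_wt_sq_eq l y hn hH hy]
    ring
  · unfold seqEst
    rw [Set.indicator_of_notMem hy]
    have : 0 ≤ ∑ i ∈ Finset.range n, y (i + 1) ^ 2 := Finset.sum_nonneg fun _ _ => sq_nonneg _
    rw [zero_pow two_ne_zero]
    exact div_nonneg this hH.le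

lemma epsT_pos : 0 < D.epsT :=
  one_div_pos.2 (by linarith [Real.log_natCast_nonneg D.n])

lemma epsT_le : D.epsT ≤ 1 / 2 :=
  one_div_le_one_div_of_le two_pos (by linarith [Real.log_natCast_nonneg D.n])

lemma abs_SProj_le (l : ℕ) (y : ℕ → ℝ) : |D.SProj l y| ≤ 1 - D.epsT := by
  rw [abs_le]
  have := D.epsT_le
  exact ⟨le_min ((le_max_right _ _).trans' (by linarith)) (by linarith), min_le_right _ _⟩

lemma one_sub_SProj_sq (l : ℕ) (y : ℕ → ℝ) :
    D.epsT ≤ 1 - D.SProj l y ^ 2 ∧ 1 - D.SProj l y ^ 2 ≤ 1 := by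
  have h := D.abs_SProj_le l y
  have h0 := abs_nonneg (D.SProj l y)
  have h1 := D.epsT_pos
  have h2 := D.epsT_le
  rw [← sq_abs]
  constructor <;> nlinarith

lemma H_factor_bounds (l : ℕ) (y : ℕ → ℝ) :
    1 / 2 ≤ (1 - D.epsT) / (1 - D.SProj l y ^ 2) ∧
      (1 - D.epsT) / (1 - D.SProj l y ^ 2) ≤ 2 + Real.log D.n := by
  obtain ⟨h1, h2⟩ := D.one_sub_SProj_sq l y
  have h3 := D.epsT_pos
  have h4 := D.epsT_le
  have hpos := h3.trans_le h1
  constructor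
  · rw [le_div_iff₀ hpos]
    linarith
  · have e : 2 + Real.log D.n = 1 / D.epsT := by simp [epsT]
    rw [e]
    exact div_le_div₀ zero_le_one (by linarith) h3 h1

/-- Degenerate windows. If `H = 0` the factor `1 / H` vanishes. Otherwise the set of stopping
candidates is empty, so `τ = k2`, the sum is empty, and `ϰ` is the root of a nonpositive number. -/
lemma seqEst_eq_zero (l : ℕ) (y : ℕ → ℝ) (h : D.k2 l ≤ D.iota l + 1) : D.seqEst l y = 0 := by
  unfold seqEst
  by_cases hy : y ∈ D.GammaAt l
  swap
  · rw [Set.indicator_of_notMem hy]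
  rw [Set.indicator_of_mem hy]
  have hf := (D.H_factor_bounds l y).1
  rcases h.eq_or_lt with h | h
  · have : D.H l y = 0 := by simp [H, h]
    simp [this]
  · have hH : D.H l y ≤ 0 := mul_nonpos_of_nonneg_of_nonpos (by linarith) (by
      have : (D.k2 l : ℝ) + 1 ≤ D.iota l + 1 := by exact_mod_cast h
      linarith)
    have hτ : D.tau l y = D.k2 l := by
      unfold tau
      have : {k | D.iota l + 1 ≤ k ∧ k ≤ D.k2 l ∧ D.H l y ≤ D.A l y (D.iota l) k} = ∅ := by
        ext k
        simp only [Set.mem_ofPred_eq, Set.mem_empty_iff_false, iff_false]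
        omega
      rw [this]
      simp
    have hκ : D.kappa l y = 0 := by
      unfold kappa
      refine Real.sqrt_eq_zero_of_nonpos (div_nonpos_of_nonpos_of_nonneg ?_
        (mul_nonneg (D.Q_nonneg _ _) (sq_nonneg _)))
      linarith [D.A_nonneg l y (D.iota l) (D.tau l y - 1)]
    rw [hκ, hτ, Finset.Icc_eq_empty (by omega)]
    simp

/-- Bound on the sequential estimator, without any condition on the design. -/
lemma seqEst_sq_le_two_mul (l : ℕ) (y : ℕ → ℝ) {n : ℕ} (hn : D.k2 l ≤ n) :
    D.seqEst l y ^ 2 ≤ 2 * ∑ i ∈ Finset.range n, y (i + 1) ^ 2 := by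
  have h0 : 0 ≤ ∑ i ∈ Finset.range n, y (i + 1) ^ 2 := Finset.sum_nonneg fun _ _ => sq_nonneg _
  rcases le_or_gt (D.k2 l) (D.iota l + 1) with h | h
  · rw [D.seqEst_eq_zero l y h]
    simpa using h0
  -- The length is an integer, hence at least one once it is positive. This gives `H ≥ 1 / 2` and
  -- the factor 2.
  · have hK : (1 : ℝ) ≤ (D.k2 l : ℝ) - D.iota l - 1 := by
      have : (D.iota l : ℝ) + 1 + 1 ≤ D.k2 l := by exact_mod_cast h
      linarith
    have hH : 1 / 2 ≤ D.H l y := by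
      have := (D.H_factor_bounds l y).1
      unfold H
      nlinarith
    refine (D.seqEst_sq_le l y hn (by linarith)).trans ?_
    rw [div_le_iff₀ (by linarith)]
    nlinarith

section Measurability

variable {Ω : Type*} [MeasurableSpace Ω] {y : Ω → ℕ → ℝ}

lemma measurable_A (l k m : ℕ) (hy : ∀ j < m, Measurable fun ω => y ω j) :
    Measurable fun ω => D.A l (y ω) k m := by
  unfold A
  refine Finset.measurable_sum _ fun j hj => ?_
  rw [Finset.mem_Icc] at hj
  exact ((hy (j - 1) (by omega)).pow_const 2).const_mul _

lemma measurable_H (l : ℕ) (hy : ∀ j ≤ D.iota l, Measurable fun ω => y ω j) :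
    Measurable fun ω => D.H l (y ω) := by
  have h1 : Measurable fun ω => D.SAux l (y ω) := by
    unfold SAux
    refine (Finset.measurable_sum _ fun j hj => ?_).div
      (D.measurable_A l 0 _ fun j hj => hy j hj.le)
    rw [Finset.mem_Icc] at hj
    exact ((hy (j - 1) (by omega)).const_mul _).mul (hy j hj.2)
  have h2 : Measurable fun ω => D.SProj l (y ω) := (h1.max measurable_const).min measurable_const
  unfold H
  exact (measurable_const.div (measurable_const.sub (h2.pow_const 2))).mul measurable_const

lemma measurable_wt (l i : ℕ) (hy : ∀ j ≤ i, Measurable fun ω => y ω j) :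
    Measurable fun ω => D.wt l i (y ω) := by
  unfold wt
  by_cases h : D.iota l ≤ i ∧ i < D.k2 l
  · simp only [if_pos h]
    have hH := D.measurable_H l fun j hj => hy j (hj.trans h.1)
    have hA1 := D.measurable_A l (D.iota l) (i + 1) fun j hj => hy j (by omega)
    have hA := D.measurable_A l (D.iota l) i fun j hj => hy j (by omega)
    have hyi := hy i le_rfl
    exact (((hA1.min hH).sub (hA.min hH)).sqrt.div hH).mul
      (hyi.div (continuous_abs.measurable.comp hyi))
  · simp only [if_neg h]
    exact measurable_const

end Measurability

end Design

/-! ### Geometry of the windows and size of the thresholds. -/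

namespace Design

variable (D : Design)

lemma d_pos (hn : 1 ≤ D.n) : 0 < D.d := Nat.sqrt_pos.2 hn

lemma d_le_sqrt : (D.d : ℝ) ≤ Real.sqrt D.n := Real.le_sqrt_of_sq_le (by
  exact_mod_cast Nat.sqrt_le' D.n)

lemma sqrt_le_two_mul_d (hn : 1 ≤ D.n) : Real.sqrt D.n ≤ 2 * D.d := by
  have h1 : (D.n : ℝ) ≤ ((D.d : ℝ) + 1) ^ 2 := by exact_mod_cast (Nat.lt_succ_sqrt' D.n).le
  have h2 : (1 : ℝ) ≤ D.d := by exact_mod_cast D.d_pos hn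
  calc Real.sqrt D.n ≤ (D.d : ℝ) + 1 := Real.sqrt_le_iff.2 ⟨by positivity, h1⟩
    _ ≤ 2 * D.d := by linarith

lemma sqrt_le_ratio (hn : 1 ≤ D.n) : Real.sqrt D.n ≤ (D.n : ℝ) / D.d := by
  have hd : (0 : ℝ) < D.d := by exact_mod_cast D.d_pos hn
  rw [le_div_iff₀ hd]
  calc Real.sqrt D.n * D.d ≤ Real.sqrt D.n * Real.sqrt D.n :=
        mul_le_mul_of_nonneg_left D.d_le_sqrt (Real.sqrt_nonneg _)
    _ = D.n := Real.mul_self_sqrt (Nat.cast_nonneg _)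

lemma ratio_le (hn : 1 ≤ D.n) : (D.n : ℝ) / D.d ≤ 2 * Real.sqrt D.n := by
  have hd : (0 : ℝ) < D.d := by exact_mod_cast D.d_pos hn
  rw [div_le_iff₀ hd]
  calc (D.n : ℝ) = Real.sqrt D.n * Real.sqrt D.n := (Real.mul_self_sqrt (Nat.cast_nonneg _)).symm
    _ ≤ Real.sqrt D.n * (2 * D.d) :=
        mul_le_mul_of_nonneg_left (D.sqrt_le_two_mul_d hn) (Real.sqrt_nonneg _)
    _ = _ := by ring

lemma k2_le (l : ℕ) : D.k2 l ≤ D.n := min_le_right _ _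

section Geometry

variable {D} (hab : D.a < D.b) (hn : 1 ≤ D.n)
include hab hn

lemma k1_eq (l : ℕ) :
    D.k1 l = ⌊(D.n : ℝ) / D.d * l - (D.n : ℝ) / D.d / 2⌋₊ + 1 := by
  have hd : (D.d : ℝ) ≠ 0 := by exact_mod_cast (D.d_pos hn).ne'
  have hba : D.b - D.a ≠ 0 := by linarith
  unfold k1 z h
  congr 2
  field_simp
  ring

lemma k2_eq (l : ℕ) :
    D.k2 l = min ⌊(D.n : ℝ) / D.d * l + (D.n : ℝ) / D.d / 2⌋₊ D.n := by
  have hd : (D.d : ℝ) ≠ 0 := by exact_mod_cast (D.d_pos hn).ne'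
  have hba : D.b - D.a ≠ 0 := by linarith
  unfold k2 z h
  congr 2
  field_simp
  ring

/-- In units of `n / d` the windows end at `l + 1/2` and start at `m - 1/2`, so consecutive ones
share the same floor. Hence the weights of different windows never act at the same time. -/
lemma k2_le_iota {l m : ℕ} (h : l < m) : D.k2 l ≤ D.iota m := by
  have h1 : D.k2 l ≤ D.k1 m := by
    rw [k1_eq hab hn, k2_eq hab hn]
    refine (min_le_left _ _).trans ((Nat.floor_mono ?_).trans (Nat.le_succ _))
    have h2 : (l : ℝ) + 1 ≤ m := by exact_mod_cast h
    have h3 : (0 : ℝ) ≤ (D.n : ℝ) / D.d := by positivity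
    nlinarith
  exact h1.trans (Nat.le_add_right _ _)

lemma wt_mul_wt {l m : ℕ} (h : l ≠ m) (i : ℕ) (y : ℕ → ℝ) : D.wt l i y * D.wt m i y = 0 := by
  unfold wt
  by_cases h1 : D.iota l ≤ i ∧ i < D.k2 l
  · by_cases h2 : D.iota m ≤ i ∧ i < D.k2 m
    · rcases h.lt_or_gt with h' | h'
      · have := k2_le_iota hab hn h'
        omega
      · have := k2_le_iota hab hn h'
        omega
    · rw [if_neg h2, mul_zero]
  · rw [if_neg h1, zero_mul]

lemma window_le (l : ℕ) : (D.k2 l : ℝ) - D.iota l - 1 ≤ 2 * Real.sqrt D.n := by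
  have h0 : (0 : ℝ) ≤ (D.n : ℝ) / D.d := by positivity
  have h1 : (D.k2 l : ℝ) ≤ (D.n : ℝ) / D.d * l + (D.n : ℝ) / D.d / 2 := by
    rw [k2_eq hab hn]
    push_cast
    exact (min_le_left _ _).trans (Nat.floor_le (by positivity))
  have h2 : (D.n : ℝ) / D.d * l - (D.n : ℝ) / D.d / 2 ≤ D.iota l := by
    unfold iota
    rw [k1_eq hab hn]
    push_cast
    have := (Nat.lt_floor_add_one ((D.n : ℝ) / D.d * l - (D.n : ℝ) / D.d / 2)).le
    have hq : (0 : ℝ) ≤ D.q := Nat.cast_nonneg _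
    linarith
  linarith [D.ratio_le hn]

/-- Only half a window is guaranteed, because the last one, `l = d`, is cut at time `n`. -/
lemma window_ge {l : ℕ} (hl : 1 ≤ l) (hld : l ≤ D.d) (h4 : 4 ≤ D.n) :
    (D.n : ℝ) / D.d / 2 - 2 - ((D.n : ℝ) / D.d / 2) ^ D.mu0 ≤ (D.k2 l : ℝ) - D.iota l - 1 := by
  have hd : (0 : ℝ) < D.d := by exact_mod_cast D.d_pos hn
  have h0 : (0 : ℝ) ≤ (D.n : ℝ) / D.d := by positivity
  have hl' : (1 : ℝ) ≤ l := by exact_mod_cast hl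
  have hld' : (l : ℝ) ≤ D.d := by exact_mod_cast hld
  have ht : 2 ≤ (D.n : ℝ) / D.d := by
    refine le_trans ?_ (D.sqrt_le_ratio hn)
    exact Real.le_sqrt_of_sq_le (by exact_mod_cast h4)
  have h1 : (D.n : ℝ) / D.d * l ≤ D.k2 l := by
    rw [k2_eq hab hn]
    push_cast
    refine le_min ?_ ?_
    · have := (Nat.lt_floor_add_one ((D.n : ℝ) / D.d * l + (D.n : ℝ) / D.d / 2)).le
      linarith
    · rw [div_mul_eq_mul_div, div_le_iff₀ hd]
      exact mul_le_mul_of_nonneg_left hld' (Nat.cast_nonneg _)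
  have hq : (D.q : ℝ) ≤ ((D.n : ℝ) / D.d / 2) ^ D.mu0 := by
    have hba : D.b - D.a ≠ 0 := by linarith
    have e : (D.n : ℝ) * (D.h / (D.b - D.a)) = (D.n : ℝ) / D.d / 2 := by
      unfold h
      field_simp
    unfold q
    rw [e]
    exact Nat.floor_le (by positivity)
  have h2 : (D.iota l : ℝ) ≤ (D.n : ℝ) / D.d * l - (D.n : ℝ) / D.d / 2 + 1 + D.q := by
    unfold iota
    rw [k1_eq hab hn]
    push_cast
    have := Nat.floor_le (a := (D.n : ℝ) / D.d * l - (D.n : ℝ) / D.d / 2) (by nlinarith)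
    linarith
  linarith

lemma x_mem {k : ℕ} (hk : k ≤ D.n) : D.x k ∈ Set.Icc D.a D.b := by
  have hn' : (0 : ℝ) < D.n := by exact_mod_cast hn
  have hk' : (k : ℝ) ≤ D.n := by exact_mod_cast hk
  have hba : 0 ≤ D.b - D.a := by linarith
  unfold x
  constructor
  · have : 0 ≤ (k : ℝ) * (D.b - D.a) / D.n := by positivity
    linarith
  · have : (k : ℝ) * (D.b - D.a) / D.n ≤ D.b - D.a := by
      rw [div_le_iff₀ hn', mul_comm]
      exact mul_le_mul_of_nonneg_left hk' hba
    linarith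

lemma z_mem {l : ℕ} (hl : l ≤ D.d) : D.z l ∈ Set.Icc D.a D.b := by
  have hd : (0 : ℝ) < D.d := by exact_mod_cast D.d_pos hn
  have hl' : (l : ℝ) / D.d ≤ 1 := (div_le_one hd).2 (by exact_mod_cast hl)
  have hba : 0 ≤ D.b - D.a := by linarith
  have h0 : (0 : ℝ) ≤ (l : ℝ) / D.d := by positivity
  unfold z
  constructor <;> nlinarith

lemma h_pos : 0 < D.h := by
  have hd : (0 : ℝ) < D.d := by exact_mod_cast D.d_pos hn
  have hba : 0 < D.b - D.a := by linarith
  unfold h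
  positivity

lemma abs_x_sub_z_le {l j : ℕ} (h : D.Q l j ≠ 0) : |D.x j - D.z l| ≤ D.h := by
  have hh := h_pos hab hn
  have := Set.mem_of_indicator_ne_zero h
  rw [Set.mem_Icc, ← abs_le, abs_div, abs_of_pos hh, div_le_one hh] at this
  exact this

end Geometry

/-- All windows are long enough for the sequential estimation. -/
def IsRegular : Prop :=
  ∀ l ∈ Finset.Icc 1 D.d, Real.sqrt D.n / 4 ≤ (D.k2 l : ℝ) - D.iota l - 1

/-- With `x = n / (2d)`, the auxiliary estimation step uses at most `x ^ mu0` observations,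
negligible compared with `x` since `mu0 < 1`. -/
lemma eventually_isRegular {a b mu0 : ℝ} (hab : a < b) (hmu : mu0 < 1) :
    ∀ᶠ n : ℕ in atTop, (⟨a, b, mu0, n⟩ : Design).IsRegular := by
  have h1 : ∀ᶠ x : ℝ in atTop, x ^ (-(1 - mu0)) ≤ 1 / 4 :=
    (tendsto_rpow_neg_atTop (by linarith)).eventually_le_const (by norm_num)
  have h2 : ∀ᶠ x : ℝ in atTop, x / 2 ≤ x - 2 - x ^ mu0 := by
    filter_upwards [h1, eventually_ge_atTop 8] with x hx hx8
    have e : x ^ mu0 = x * x ^ (-(1 - mu0)) := by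
      nth_rw 2 [← Real.rpow_one x]
      rw [← Real.rpow_add (by linarith)]
      congr 1
      ring
    rw [e]
    nlinarith
  obtain ⟨x0, hx0⟩ := eventually_atTop.1 h2
  have h3 : Tendsto (fun n : ℕ => Real.sqrt n) atTop atTop :=
    Real.tendsto_sqrt_atTop.comp tendsto_natCast_atTop_atTop
  filter_upwards [h3.eventually_ge_atTop (2 * x0), eventually_ge_atTop 4] with n hn hn4 l hl
  rw [Finset.mem_Icc] at hl
  set D : Design := ⟨a, b, mu0, n⟩
  have hn1 : 1 ≤ D.n := le_trans (by norm_num) hn4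
  have hr := D.sqrt_le_ratio hn1
  refine le_trans ?_ (window_ge (D := D) hab hn1 hl.1 hl.2 hn4)
  have hx : x0 ≤ (D.n : ℝ) / D.d / 2 := by
    change Real.sqrt D.n ≥ _ at hn
    linarith
  have := hx0 _ hx
  change _ ≤ (D.n : ℝ) / D.d / 2 - 2 - ((D.n : ℝ) / D.d / 2) ^ D.mu0 at this
  linarith

lemma H_bounds (hab : D.a < D.b) (hn : 1 ≤ D.n) (hD : D.IsRegular) {l : ℕ}
    (hl : l ∈ Finset.Icc 1 D.d) (y : ℕ → ℝ) :
    Real.sqrt D.n / 8 ≤ D.H l y ∧ D.H l y ≤ 2 * Real.sqrt D.n * (2 + Real.log D.n) := by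
  obtain ⟨h1, h2⟩ := D.H_factor_bounds l y
  have h3 := hD l hl
  have h4 := window_le hab hn l
  have h5 := Real.sqrt_nonneg (D.n : ℝ)
  unfold H
  constructor
  · nlinarith
  · rw [mul_comm]
    exact mul_le_mul h4 h2 (by linarith) (by positivity)

lemma sqrt_pos (hn : 1 ≤ D.n) : 0 < Real.sqrt D.n := Real.sqrt_pos.2 (by exact_mod_cast hn)

lemma H_pos (hab : D.a < D.b) (hn : 1 ≤ D.n) (hD : D.IsRegular) {l : ℕ}
    (hl : l ∈ Finset.Icc 1 D.d) (y : ℕ → ℝ) : 0 < D.H l y :=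
  lt_of_lt_of_le (by have := D.sqrt_pos hn; positivity) (D.H_bounds hab hn hD hl y).1

lemma iota_le_k2 (hD : D.IsRegular) {l : ℕ} (hl : l ∈ Finset.Icc 1 D.d) : D.iota l ≤ D.k2 l := by
  have h := hD l hl
  have : (D.iota l : ℝ) ≤ D.k2 l := by linarith [Real.sqrt_nonneg (D.n : ℝ)]
  exact_mod_cast this

lemma measurable_process {Ω : Type*} [MeasurableSpace Ω] (S : ℝ → ℝ) (y0 : ℝ) {ξ : ℕ → Ω → ℝ}
    {i : ℕ} (hξ : ∀ j < i, Measurable (ξ (j + 1))) :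
    Measurable fun ω => D.process S y0 (fun k => ξ k ω) i := by
  induction i with
  | zero => exact measurable_const
  | succ i ih =>
    exact ((ih fun j hj => hξ j (by omega)).const_mul _).add (hξ i (by omega))

end Design

/-! ### Parseval identities for orthonormal rows. -/

section Orthogonal

variable {ι κ : Type*} [Fintype ι] [Fintype κ] [DecidableEq ι]

lemma sum_sq_of_orthonormal {U : ι → κ → ℝ}
    (hU : ∀ i j, ∑ l, U i l * U j l = if i = j then 1 else 0) (v : ι → ℝ) :
    ∑ l, (∑ j, v j * U j l) ^ 2 = ∑ j, v j ^ 2 := by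
  have : ∀ l, (∑ j, v j * U j l) ^ 2 = ∑ i, ∑ j, v i * v j * (U i l * U j l) := fun l => by
    rw [pow_two, Finset.sum_mul_sum]
    exact Finset.sum_congr rfl fun _ _ => Finset.sum_congr rfl fun _ _ => by ring
  simp_rw [this]
  rw [Finset.sum_comm]
  refine Finset.sum_congr rfl fun i _ => ?_
  rw [Finset.sum_comm]
  simp_rw [← Finset.mul_sum, hU]
  simp [pow_two]

/-- The Hilbert–Schmidt norm of `Uᵀ diag(w) U` is the Euclidean norm of `w`. This makes the
deviation bounds uniform in the weights. -/
lemma sum_sq_gram_of_orthonormal {U : ι → κ → ℝ}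
    (hU : ∀ i j, ∑ l, U i l * U j l = if i = j then 1 else 0) (w : ι → ℝ) :
    ∑ l, ∑ m, (∑ j, w j * U j l * U j m) ^ 2 = ∑ j, w j ^ 2 := by
  have h1 : ∀ l, ∑ m, (∑ j, w j * U j l * U j m) ^ 2 = ∑ j, (w j * U j l) ^ 2 := fun l =>
    sum_sq_of_orthonormal hU fun j => w j * U j l
  simp_rw [h1]
  rw [Finset.sum_comm]
  refine Finset.sum_congr rfl fun j _ => ?_
  have := hU j j
  simp only [if_true] at this
  simp_rw [mul_pow]
  rw [← Finset.mul_sum]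
  simp_rw [pow_two (U j _)]
  rw [this, mul_one]

lemma orthonormal_transpose {U : ι → ι → ℝ}
    (hU : ∀ i j, ∑ l, U i l * U j l = if i = j then 1 else 0) (l m : ι) :
    ∑ j, U j l * U j m = if l = m then 1 else 0 := by
  have h1 : (Matrix.of U) * (Matrix.of U).transpose = 1 := by
    ext i j
    simp [Matrix.mul_apply, hU, Matrix.one_apply]
  have h1' : (Matrix.of U).transpose * (Matrix.of U) = 1 := mul_eq_one_comm.1 h1
  have h2 := congrFun (congrFun h1' l) m
  simpa [Matrix.mul_apply, Matrix.one_apply] using h2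

/-- Loss of a diagonal estimator in the transformed and in the original coordinates. -/
lemma sum_sq_sub_of_orthonormal {U : ι → ι → ℝ}
    (hU : ∀ i j, ∑ l, U i l * U j l = if i = j then 1 else 0) (v f : ι → ℝ) :
    ∑ l, (∑ j, v j * U j l - f l) ^ 2 = ∑ j, (v j - ∑ l, U j l * f l) ^ 2 := by
  rw [← sum_sq_of_orthonormal hU fun j => v j - ∑ l, U j l * f l]
  refine Finset.sum_congr rfl fun l _ => ?_
  congr 1
  simp_rw [sub_mul, Finset.sum_sub_distrib]
  congr 1
  simp_rw [Finset.sum_mul]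
  rw [Finset.sum_comm]
  have : ∀ m, ∑ j, U j m * f m * U j l = f m * if m = l then 1 else 0 := fun m => by
    rw [← orthonormal_transpose hU m l, Finset.mul_sum]
    exact Finset.sum_congr rfl fun _ _ => by ring
  simp_rw [this]
  simp

end Orthogonal

lemma lipschitz_of_mem_stabilitySet {a b ε L : ℝ} (S : ℝ → ℝ)
    (hS : S ∈ stabilitySet a b ε L) {s t : ℝ} (hs : s ∈ Set.Icc a b)
    (ht : t ∈ Set.Icc a b) : |S s - S t| ≤ L * |s - t| := by
  have := (convex_Icc a b).norm_image_sub_le_of_norm_derivWithin_le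
    (hS.1.differentiableOn (by norm_num)) (fun x hx => hS.2.2 x hx) ht hs
  simpa using this

lemma sq_add_le {δ : ℝ} (hδ : 0 < δ) (x y : ℝ) :
    (x + y) ^ 2 ≤ (1 + δ) * x ^ 2 + (1 + 1 / δ) * y ^ 2 := by
  have e : (1 + δ) * x ^ 2 + (1 + 1 / δ) * y ^ 2 - (x + y) ^ 2 = (δ * x - y) ^ 2 / δ := by
    field_simp
    ring
  have : 0 ≤ (δ * x - y) ^ 2 / δ := by positivity
  linarith

/-! ### Comparison of integrated and grid losses. -/

namespace Design

variable (D : Design)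

lemma sum_Icc_one_eq (n : ℕ) (f : ℕ → ℝ) :
    ∑ l ∈ Finset.Icc 1 n, f l = ∑ i ∈ Finset.range n, f (i + 1) := by
  rw [Finset.range_eq_Ico, Finset.sum_Ico_add' f 0 n 1]
  rfl

lemma sum_Icc_eq_sum_fin (n : ℕ) (f : ℕ → ℝ) :
    ∑ l ∈ Finset.Icc 1 n, f l = ∑ i : Fin n, f (i + 1) := by
  rw [sum_Icc_one_eq, Finset.sum_range]

/-- Mean square error on the grid. -/
noncomputable def gridLoss (w : ℕ → ℝ) (S : ℝ → ℝ) : ℝ :=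
  (D.b - D.a) / D.d * ∑ l ∈ Finset.Icc 1 D.d, (w l - S (D.z l)) ^ 2

lemma z_succ_sub (i : ℕ) : D.z (i + 1) - D.z i = (D.b - D.a) / D.d := by
  unfold z
  push_cast
  ring

lemma z_zero : D.z 0 = D.a := by simp [z]

lemma z_d (hn : 1 ≤ D.n) : D.z D.d = D.b := by
  have hd : (D.d : ℝ) ≠ 0 := by exact_mod_cast (D.d_pos hn).ne'
  simp [z, hd]

lemma z_mono (hab : D.a < D.b) : Monotone D.z := monotone_nat_of_le_succ fun i => by
  have := D.z_succ_sub i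
  have h2 : 0 ≤ (D.b - D.a) / D.d := div_nonneg (by linarith) (Nat.cast_nonneg _)
  linarith

section

variable {D} (hab : D.a < D.b) (hn : 1 ≤ D.n)
include hab hn

lemma wls_eq (φ : Fin D.d → ℝ → ℝ) (lam : Fin D.d → ℝ) (y : ℕ → ℝ) {i : ℕ} (hi : i < D.d)
    {t : ℝ} (ht : t ∈ Set.Ioc (D.z i) (D.z (i + 1))) :
    D.wls φ lam y t = D.wlsGrid φ lam y (i + 1) := by
  have hm := D.z_mono hab
  unfold wls
  have hother : ∀ l, 2 ≤ l → l ≠ i + 1 → t ∉ Set.Ioc (D.z (l - 1)) (D.z l) := by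
    intro l hl hne hmem
    rcases Nat.lt_or_gt_of_ne hne with h | h
    · have := hm (show l ≤ i by omega)
      exact absurd hmem.2 (not_le.2 (this.trans_lt ht.1))
    · have := hm (show i + 1 ≤ l - 1 by omega)
      exact absurd hmem.1 (not_lt.2 (ht.2.trans this))
  by_cases h0 : i = 0
  · subst h0
    rw [Set.indicator_of_mem, Finset.sum_eq_zero, add_zero]
    · intro l hl
      rw [Finset.mem_Icc] at hl
      exact Set.indicator_of_notMem (hother l hl.1 (by omega)) _
    · rw [z_zero] at ht
      exact ⟨ht.1.le, ht.2⟩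
  · rw [Set.indicator_of_notMem, zero_add, Finset.sum_eq_single (i + 1)]
    · rw [Set.indicator_of_mem]
      simpa using ht
    · intro l hl hne
      rw [Finset.mem_Icc] at hl
      exact Set.indicator_of_notMem (hother l hl.1 hne) _
    · intro h
      rw [Finset.mem_Icc] at h
      omega
    · intro h
      have := hm (show 1 ≤ i by omega)
      exact absurd h.2 (not_le.2 (this.trans_lt ht.1))

lemma sqNorm_step_eq {f S : ℝ → ℝ} {w : ℕ → ℝ} (hS : ContinuousOn S (Set.Icc D.a D.b))
    (hf : ∀ i < D.d, ∀ t ∈ Set.Ioc (D.z i) (D.z (i + 1)), f t = w (i + 1)) :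
    D.sqNorm (fun t => f t - S t) =
      ∑ i ∈ Finset.range D.d, ∫ t in D.z i..D.z (i + 1), (w (i + 1) - S t) ^ 2 := by
  have hm := D.z_mono hab
  have hsub : ∀ i < D.d, Set.uIcc (D.z i) (D.z (i + 1)) ⊆ Set.Icc D.a D.b := fun i hi => by
    rw [Set.uIcc_of_le (hm (Nat.le_succ i))]
    exact Set.Icc_subset_Icc (z_mem hab hn hi.le).1 (z_mem hab hn hi).2
  have hint : ∀ i < D.d, IntervalIntegrable (fun t => (w (i + 1) - S t) ^ 2) volume
      (D.z i) (D.z (i + 1)) := fun i hi =>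
    ((continuousOn_const.sub (hS.mono (hsub i hi))).pow 2).intervalIntegrable
  have hae : ∀ i < D.d, ∀ t ∈ Set.uIoc (D.z i) (D.z (i + 1)),
      (w (i + 1) - S t) ^ 2 = (f t - S t) ^ 2 := fun i hi t ht => by
    rw [Set.uIoc_of_le (hm (Nat.le_succ i))] at ht
    rw [hf i hi t ht]
  unfold sqNorm
  rw [← D.z_d hn]
  nth_rw 1 [← D.z_zero]
  rw [← intervalIntegral.sum_integral_adjacent_intervals fun i hi =>
    (hint i hi).congr fun t ht => hae i hi t ht]
  refine Finset.sum_congr rfl fun i hi => ?_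
  exact intervalIntegral.integral_congr_ae (Eventually.of_forall fun t ht =>
    (hae i (Finset.mem_range.1 hi) t ht).symm)

/-- Integrated and grid losses of a step function agree up to the modulus of continuity. -/
lemma sqNorm_step_bounds {f S : ℝ → ℝ} {w : ℕ → ℝ} {L δ : ℝ} (hδ : 0 < δ)
    (hS : ContinuousOn S (Set.Icc D.a D.b))
    (hLip : ∀ s ∈ Set.Icc D.a D.b, ∀ t ∈ Set.Icc D.a D.b, |S s - S t| ≤ L * |s - t|)
    (hL : 0 ≤ L)
    (hf : ∀ i < D.d, ∀ t ∈ Set.Ioc (D.z i) (D.z (i + 1)), f t = w (i + 1)) :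
    D.sqNorm (fun t => f t - S t) ≤ (1 + δ) * D.gridLoss w S +
        (1 + 1 / δ) * ((D.b - D.a) * (L * ((D.b - D.a) / D.d)) ^ 2) ∧
      D.gridLoss w S ≤ (1 + δ) * D.sqNorm (fun t => f t - S t) +
        (1 + 1 / δ) * ((D.b - D.a) * (L * ((D.b - D.a) / D.d)) ^ 2) := by
  have hm := D.z_mono hab
  have hd : (0 : ℝ) < D.d := by exact_mod_cast D.d_pos hn
  have hc : 0 ≤ (D.b - D.a) / D.d := div_nonneg (by linarith) hd.le
  rw [sqNorm_step_eq hab hn hS hf]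
  set q := L * ((D.b - D.a) / D.d)
  set c := (D.b - D.a) / D.d with hcdef
  have hsub : ∀ i < D.d, Set.Icc (D.z i) (D.z (i + 1)) ⊆ Set.Icc D.a D.b := fun i hi =>
    Set.Icc_subset_Icc (z_mem hab hn hi.le).1 (z_mem hab hn hi).2
  have hint : ∀ i < D.d, IntervalIntegrable (fun t => (w (i + 1) - S t) ^ 2) volume
      (D.z i) (D.z (i + 1)) := fun i hi =>
    ((continuousOn_const.sub (hS.mono (by
      rw [Set.uIcc_of_le (hm (Nat.le_succ i))]
      exact hsub i hi))).pow 2).intervalIntegrable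
  have hclose : ∀ i < D.d, ∀ t ∈ Set.Icc (D.z i) (D.z (i + 1)),
      (S (D.z (i + 1)) - S t) ^ 2 ≤ q ^ 2 := fun i hi t ht => by
    have h1 := hLip _ (z_mem hab hn hi) t (hsub i hi ht)
    rw [← sq_abs]
    refine pow_le_pow_left₀ (abs_nonneg _) (h1.trans (mul_le_mul_of_nonneg_left ?_ hL)) 2
    rw [abs_of_nonneg (by linarith [ht.2])]
    linarith [ht.1, D.z_succ_sub i]
  have hg : D.gridLoss w S = ∑ i ∈ Finset.range D.d, c * (w (i + 1) - S (D.z (i + 1))) ^ 2 := by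
    unfold gridLoss
    rw [sum_Icc_one_eq, Finset.mul_sum]
  have hconst : ∀ x : ℝ, ∀ i, ∫ _ in D.z i..D.z (i + 1), x = c * x := fun x i => by
    rw [intervalIntegral.integral_const, D.z_succ_sub, smul_eq_mul]
  have hq : (1 + 1 / δ) * ((D.b - D.a) * q ^ 2) =
      ∑ _i ∈ Finset.range D.d, c * ((1 + 1 / δ) * q ^ 2) := by
    rw [Finset.sum_const, Finset.card_range, nsmul_eq_mul, hcdef]
    field_simp
  have hδ' : 0 ≤ 1 + 1 / δ := by positivity
  constructor
  · rw [hg, hq, Finset.mul_sum, ← Finset.sum_add_distrib]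
    refine Finset.sum_le_sum fun i hi => ?_
    have hi := Finset.mem_range.1 hi
    have : (1 + δ) * (c * (w (i + 1) - S (D.z (i + 1))) ^ 2) + c * ((1 + 1 / δ) * q ^ 2) =
        ∫ _ in D.z i..D.z (i + 1),
          ((1 + δ) * (w (i + 1) - S (D.z (i + 1))) ^ 2 + (1 + 1 / δ) * q ^ 2) := by
      rw [hconst]
      ring
    rw [this]
    refine intervalIntegral.integral_mono_on (hm (Nat.le_succ i)) (hint i hi)
      intervalIntegrable_const fun t ht => ?_
    have h1 := sq_add_le hδ (w (i + 1) - S (D.z (i + 1))) (S (D.z (i + 1)) - S t)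
    have h2 := mul_le_mul_of_nonneg_left (hclose i hi t ht) hδ'
    rw [sub_add_sub_cancel] at h1
    linarith
  · rw [hg, hq, Finset.mul_sum, ← Finset.sum_add_distrib]
    refine Finset.sum_le_sum fun i hi => ?_
    have hi := Finset.mem_range.1 hi
    rw [← intervalIntegral.integral_const_mul, ← hconst, ← hconst,
      ← intervalIntegral.integral_add ((hint i hi).const_mul _) intervalIntegrable_const]
    refine intervalIntegral.integral_mono_on (hm (Nat.le_succ i)) intervalIntegrable_const
      (((hint i hi).const_mul _).add intervalIntegrable_const) fun t ht => ?_
    have h1 := sq_add_le hδ (w (i + 1) - S t) (S t - S (D.z (i + 1)))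
    have h2 := mul_le_mul_of_nonneg_left (hclose i hi t ht) hδ'
    rw [sub_add_sub_cancel, ← sq_abs (S t - _), abs_sub_comm, sq_abs] at h1
    linarith

end

end Design

/-! ### Moments of the noise and of the autoregressive path. -/

lemma HasAllMoments.pow {Ω : Type*} [MeasurableSpace Ω] {P : Measure Ω} [IsFiniteMeasure P]
    {X : Ω → ℝ} (hX : HasAllMoments X P) (m : ℕ) : HasAllMoments (fun ω => X ω ^ m) P := by
  induction m with
  | zero => simpa using HasAllMoments.const 1
  | succ m ih => simpa only [pow_succ] using ih.mul hX

lemma hasAllMoments_of_even {Ω : Type*} [MeasurableSpace Ω] {P : Measure Ω} [IsFiniteMeasure P]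
    {X : Ω → ℝ} (hX : Measurable X) (h : ∀ m, 1 ≤ m → Integrable (fun ω => |X ω| ^ (2 * m)) P) :
    HasAllMoments X P := fun q => by
  have h1 := h (q + 1) (by omega)
  have h2 : MemLp X ((2 * (q + 1) : ℕ) : ℝ≥0∞) P := by
    rw [← integrable_norm_rpow_iff hX.aestronglyMeasurable (by simp) (ENNReal.natCast_ne_top _)]
    convert h1 using 2
    rw [ENNReal.toReal_natCast, Real.rpow_natCast, Real.norm_eq_abs]
  exact h2.mono_exponent (by exact_mod_cast (by omega : q ≤ 2 * (q + 1)))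

section Noise

variable {Ω : Type*} [MeasurableSpace Ω] {P : Measure Ω} {ς : ℝ} {p : ℝ → ℝ}
  {ξ : ℕ → Ω → ℝ} (hp : IsNoiseDensity ς p) (hξ : IsNoise P p ξ)
include hp hξ

lemma integral_comp_noise {k : ℕ} (hk : 1 ≤ k) {g : ℝ → ℝ} (hg : Measurable g) :
    ∫ ω, g (ξ k ω) ∂P = ∫ x, g x * p x := by
  rw [← integral_map (hξ.measurable k hk).aemeasurable hg.aestronglyMeasurable, hξ.law k hk,
    integral_withDensity_eq_integral_toReal_smul hp.measurable.ennreal_ofReal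
      (Eventually.of_forall fun _ => ENNReal.ofReal_lt_top)]
  refine integral_congr_ae (Eventually.of_forall fun x => ?_)
  simp only [ENNReal.toReal_ofReal (hp.nonneg x), smul_eq_mul, mul_comm]

lemma integrable_comp_noise {k : ℕ} (hk : 1 ≤ k) {g : ℝ → ℝ}
    (hi : Integrable fun x => g x * p x) : Integrable (fun ω => g (ξ k ω)) P := by
  have : Integrable g (P.map (ξ k)) := by
    rw [hξ.law k hk, integrable_withDensity_iff hp.measurable.ennreal_ofReal
      (Eventually.of_forall fun _ => ENNReal.ofReal_lt_top)]
    simpa only [ENNReal.toReal_ofReal (hp.nonneg _)] using hi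
  exact this.comp_measurable (hξ.measurable k hk)

lemma integral_even_noise_le (hς : 1 ≤ ς) {k m : ℕ} (hk : 1 ≤ k) (hm : 1 ≤ m) :
    ∫ ω, ξ k ω ^ (2 * m) ∂P ≤ ς ^ m * (Nat.doubleFactorial (2 * m - 1) : ℝ) := by
  rw [integral_comp_noise hp hξ hk (g := fun x => x ^ (2 * m)) (by fun_prop)]
  have h := hp.moment_le m hm
  have h0 : 0 < (Nat.doubleFactorial (2 * m - 1) : ℝ) := by
    exact_mod_cast Nat.doubleFactorial_pos _
  rw [div_le_one (by positivity)] at h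
  simpa only [pow_mul, sq_abs] using h

/-- The index is shifted by one so that `y_k` is measurable for `past` at `k`, while the new noise
is `ξ (k + 1)`. The constant is the fourth moment bound, with `3!! = 3`. -/
lemma isStdNoise [IsProbabilityMeasure P] (hς : 1 ≤ ς) :
    IsStdNoise P (fun k => ξ (k + 1)) (3 * ς ^ 2) where
  measurable k := hξ.measurable _ (by omega)
  indep := hξ.indep
  moments k := hasAllMoments_of_even (hξ.measurable _ (by omega)) fun m hm =>
    integrable_comp_noise hp hξ (by omega) (g := fun x => |x| ^ (2 * m))
      (hp.moment_integrable m hm)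
  mean k := by
    rw [integral_comp_noise hp hξ (by omega) (g := fun x => x) measurable_id, hp.mean]
  var k := by
    rw [integral_comp_noise hp hξ (by omega) (g := fun x => x ^ 2) (by fun_prop), hp.variance]
  fourth k := by
    refine (integral_even_noise_le hp hξ hς (by omega : 1 ≤ k + 1) (m := 2) (by omega)).trans
      (le_of_eq ?_)
    have : Nat.doubleFactorial (2 * 2 - 1) = 3 := by decide
    rw [this]
    push_cast
    ring

end Noise

namespace Design

variable (D : Design)

lemma process_measurable_past {Ω : Type*} {ξ : ℕ → Ω → ℝ} {S : ℝ → ℝ} {y0 : ℝ} (i : ℕ) :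
    Measurable[past (fun k => ξ (k + 1)) i] fun ω => D.process S y0 (fun k => ξ k ω) i :=
  @measurable_process D Ω (past (fun k => ξ (k + 1)) i) S y0 ξ i fun _ hj =>
    measurable_past (fun k => ξ (k + 1)) hj

section Path

variable {Ω : Type*} [MeasurableSpace Ω] {P : Measure Ω} [IsProbabilityMeasure P] {m4 : ℝ}
  {ξ : ℕ → Ω → ℝ} (hξ : IsStdNoise P (fun k => ξ (k + 1)) m4) {S : ℝ → ℝ} {y0 : ℝ}
include hξ

lemma process_moments (i : ℕ) : HasAllMoments (fun ω => D.process S y0 (fun k => ξ k ω) i) P := by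
  induction i with
  | zero => exact HasAllMoments.const y0
  | succ i ih => exact (ih.const_mul _).add (hξ.moments i)

/-- One step is dominated by the convex combination of `|y|` and `|ξ| / ε` with weights `1 - ε` and
`ε`. Convexity of the even power then gives a contraction with a bound uniform in time. -/
lemma integral_process_pow_le {ε C : ℝ} (hε : 0 < ε) (hε1 : ε < 1) {N m : ℕ}
    (hS : ∀ i < N, |S (D.x (i + 1))| ≤ 1 - ε) (hC : ∀ k, ∫ ω, ξ (k + 1) ω ^ (2 * m) ∂P ≤ C)
    (hC0 : 0 ≤ C) {i : ℕ} (hi : i ≤ N) :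
    ∫ ω, D.process S y0 (fun k => ξ k ω) i ^ (2 * m) ∂P ≤ y0 ^ (2 * m) + C / ε ^ (2 * m) := by
  have h0 : 0 ≤ C / ε ^ (2 * m) := by positivity
  induction i with
  | zero => simpa [process] using h0
  | succ i ih =>
    have ih := ih (by omega)
    have hy := (D.process_moments hξ (S := S) (y0 := y0) i).pow (2 * m)
    have hx := (hξ.moments i).pow (2 * m)
    have key : ∫ ω, D.process S y0 (fun k => ξ k ω) (i + 1) ^ (2 * m) ∂P ≤
        ∫ ω, ((1 - ε) * D.process S y0 (fun k => ξ k ω) i ^ (2 * m) +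
          ε / ε ^ (2 * m) * ξ (i + 1) ω ^ (2 * m)) ∂P := by
      refine integral_mono ((D.process_moments hξ (S := S) (y0 := y0) (i + 1)).pow _).integrable
        ((hy.const_mul _).add (hx.const_mul _)).integrable fun ω => ?_
      dsimp only
      set u := D.process S y0 (fun k => ξ k ω) i
      have hstep : D.process S y0 (fun k => ξ k ω) (i + 1) = S (D.x (i + 1)) * u + ξ (i + 1) ω := rfl
      have hab : |S (D.x (i + 1)) * u + ξ (i + 1) ω| ≤ (1 - ε) * |u| + ε * (|ξ (i + 1) ω| / ε) := by
        refine (abs_add_le _ _).trans (add_le_add ?_ (le_of_eq ?_))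
        · rw [abs_mul]
          exact mul_le_mul_of_nonneg_right (hS i (by omega)) (abs_nonneg _)
        · field_simp
      have hcv := (convexOn_pow (𝕜 := ℝ) (2 * m)).2 (abs_nonneg u)
        (show 0 ≤ |ξ (i + 1) ω| / ε by positivity) (by linarith : 0 ≤ 1 - ε) hε.le (by ring)
      simp only [smul_eq_mul] at hcv
      have e : ∀ v : ℝ, |v| ^ (2 * m) = v ^ (2 * m) := fun v => by simp only [pow_mul, sq_abs]
      rw [hstep, ← e]
      refine (pow_le_pow_left₀ (abs_nonneg _) hab _).trans (hcv.trans (le_of_eq ?_))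
      rw [div_pow, e, e]
      ring
    refine key.trans ?_
    rw [(hy.const_mul (1 - ε)).integral_add (hx.const_mul (ε / ε ^ (2 * m))), integral_const_mul,
      integral_const_mul]
    have h1 := mul_le_mul_of_nonneg_left ih (by linarith : 0 ≤ 1 - ε)
    have h2 := mul_le_mul_of_nonneg_left (hC i) (by positivity : 0 ≤ ε / ε ^ (2 * m))
    have h3 : ε / ε ^ (2 * m) * C = ε * (C / ε ^ (2 * m)) := by ring
    have h4 : 0 ≤ ε * y0 ^ (2 * m) := mul_nonneg hε.le (by rw [pow_mul]; positivity)
    rw [h3] at h2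
    linarith

end Path

end Design

lemma le_add_pow_div {x T : ℝ} (hx : 0 ≤ x) (hT : 0 < T) (m : ℕ) :
    x ≤ T + x ^ (m + 1) / T ^ m := by
  rcases le_or_gt x T with h | h
  · have : 0 ≤ x ^ (m + 1) / T ^ m := by positivity
    linarith
  · have : x ≤ x ^ (m + 1) / T ^ m := by
      rw [le_div_iff₀ (by positivity), pow_succ']
      exact mul_le_mul_of_nonneg_left (pow_le_pow_left₀ hT.le h.le m) hx
    linarith

/-- Expectation of the maximum of `n` nonnegative variables with `(m+1)`-st moment at most `C`. -/
lemma lintegral_sup'_le {Ω : Type*} [MeasurableSpace Ω] {P : Measure Ω} [IsProbabilityMeasure P]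
    {n : ℕ} (hn : (Finset.range n).Nonempty) {Z : ℕ → Ω → ℝ} (hZ : ∀ i, HasAllMoments (Z i) P)
    (h0 : ∀ i ω, 0 ≤ Z i ω) {m : ℕ} {C : ℝ} (hC : ∀ i < n, ∫ ω, Z i ω ^ (m + 1) ∂P ≤ C) :
    ∫⁻ ω, ENNReal.ofReal ((Finset.range n).sup' hn fun i => Z i ω) ∂P ≤
      ENNReal.ofReal ((n : ℝ) ^ (1 / ((m : ℝ) + 1)) * (1 + C)) := by
  have hn0 : (0 : ℝ) < n := by
    rw [Finset.nonempty_range_iff] at hn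
    exact_mod_cast Nat.pos_of_ne_zero hn
  -- The truncation level is chosen so that `T ^ (m + 1) = n`; the tail contribution `n * C / T ^ m`
  -- then equals `T * C`.
  set T := (n : ℝ) ^ (1 / ((m : ℝ) + 1)) with hTdef
  have hT : 0 < T := Real.rpow_pos_of_pos hn0 _
  have hTm : T ^ (m + 1) = n := by
    rw [hTdef, ← Real.rpow_natCast, ← Real.rpow_mul hn0.le]
    push_cast
    rw [one_div_mul_cancel (by positivity), Real.rpow_one]
  have hsum : HasAllMoments (fun ω => ∑ i ∈ Finset.range n, 1 / T ^ m * Z i ω ^ (m + 1)) P :=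
    HasAllMoments.sum _ fun i _ => ((hZ i).pow (m + 1)).const_mul _
  calc _ ≤ ∫⁻ ω, ENNReal.ofReal (T + ∑ i ∈ Finset.range n, 1 / T ^ m * Z i ω ^ (m + 1)) ∂P := by
        refine lintegral_mono fun ω => ENNReal.ofReal_le_ofReal (Finset.sup'_le _ _ fun i hi => ?_)
        refine (le_add_pow_div (h0 i ω) hT m).trans (add_le_add_right ?_ T)
        rw [div_eq_inv_mul, ← one_div]
        exact Finset.single_le_sum (f := fun i => 1 / T ^ m * Z i ω ^ (m + 1))
          (fun i _ => mul_nonneg (by positivity) (pow_nonneg (h0 i ω) _)) hi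
    _ = ENNReal.ofReal (∫ ω, (T + ∑ i ∈ Finset.range n, 1 / T ^ m * Z i ω ^ (m + 1)) ∂P) := by
        rw [ofReal_integral_eq_lintegral_ofReal ((HasAllMoments.const T).add hsum).integrable]
        exact Eventually.of_forall fun ω => add_nonneg hT.le (Finset.sum_nonneg fun i _ =>
          mul_nonneg (by positivity) (pow_nonneg (h0 i ω) _))
    _ ≤ _ := by
        refine ENNReal.ofReal_le_ofReal ?_
        rw [(HasAllMoments.const T).integral_add hsum,
          integral_finsetSum _ fun i _ => (((hZ i).pow (m + 1)).const_mul _).integrable]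
        simp only [integral_const_mul, integral_const, probReal_univ, one_smul]
        have : ∑ i ∈ Finset.range n, 1 / T ^ m * ∫ ω, Z i ω ^ (m + 1) ∂P ≤
            ∑ i ∈ Finset.range n, 1 / T ^ m * C := Finset.sum_le_sum fun i hi =>
          mul_le_mul_of_nonneg_left (hC i (Finset.mem_range.1 hi)) (by positivity)
        rw [Finset.sum_const, Finset.card_range, nsmul_eq_mul, ← hTm] at this
        have e : T ^ (m + 1) * (1 / T ^ m * C) = T * C := by
          rw [pow_succ]
          field_simp
        linarith

/-! ### Expected size of the normalized deviations. -/

section Deviations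

variable {Ω : Type*} [MeasurableSpace Ω] {P : Measure Ω} [IsProbabilityMeasure P]
  {ι : Type*} [Fintype ι] {ξ : ℕ → Ω → ℝ} {m4 s : ℝ} {n : ℕ}
  {c : ι → ℕ → Ω → ℝ}

/-- Noise coefficients of the window sums in the basis `U`. -/
noncomputable def noiseCoef (U : ι → ι → ℝ) (r : ℝ) (n : ℕ) (x : ι → ℕ → ℝ) (e : ℕ → ℝ) (j : ι) :
    ℝ :=
  ∑ l, U j l * (Real.sqrt r * ∑ k ∈ Finset.range n, x l k * e k)

/-- Variance proxies of the noise coefficients. -/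
noncomputable def energyCoef (U : ι → ι → ℝ) (r : ℝ) (n : ℕ) (x : ι → ℕ → ℝ) (j : ι) : ℝ :=
  r * ∑ l, U j l ^ 2 * ∑ k ∈ Finset.range n, x l k ^ 2

lemma sum_noiseCoef_sq_sub (U : ι → ι → ℝ) {r : ℝ} (hr : 0 ≤ r) (n : ℕ) (x : ι → ℕ → ℝ)
    (e : ℕ → ℝ) (w : ι → ℝ) :
    ∑ j, w j * (noiseCoef U r n x e j ^ 2 - energyCoef U r n x j) =
      ∑ l, ∑ m, (r * ∑ j, w j * U j l * U j m) *
        ((∑ k ∈ Finset.range n, x l k * e k) * (∑ k ∈ Finset.range n, x m k * e k))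
        - ∑ l, (r * ∑ j, w j * U j l * U j l) * ∑ k ∈ Finset.range n, x l k ^ 2 := by
  simp only [mul_sub, Finset.sum_sub_distrib]
  congr 1
  · have : ∀ j, w j * noiseCoef U r n x e j ^ 2 = ∑ l, ∑ m, (r * (w j * U j l * U j m)) *
        ((∑ k ∈ Finset.range n, x l k * e k) * (∑ k ∈ Finset.range n, x m k * e k)) := fun j => by
      unfold noiseCoef
      rw [pow_two, Finset.sum_mul_sum, Finset.mul_sum]
      refine Finset.sum_congr rfl fun l _ => ?_
      rw [Finset.mul_sum]
      refine Finset.sum_congr rfl fun m _ => ?_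
      have := Real.mul_self_sqrt hr
      linear_combination (w j * U j l * U j m * (∑ k ∈ Finset.range n, x l k * e k) *
        (∑ k ∈ Finset.range n, x m k * e k)) * this
    simp_rw [this]
    rw [Finset.sum_comm]
    refine Finset.sum_congr rfl fun l _ => ?_
    rw [Finset.sum_comm]
    refine Finset.sum_congr rfl fun m _ => ?_
    rw [← Finset.sum_mul, ← Finset.mul_sum]
  · have : ∀ j, w j * energyCoef U r n x j =
        ∑ l, (r * (w j * U j l * U j l)) * ∑ k ∈ Finset.range n, x l k ^ 2 := fun j => by
      unfold energyCoef
      rw [Finset.mul_sum, Finset.mul_sum]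
      exact Finset.sum_congr rfl fun l _ => by ring
    simp_rw [this]
    rw [Finset.sum_comm]
    refine Finset.sum_congr rfl fun l _ => ?_
    rw [← Finset.sum_mul, ← Finset.mul_sum]

lemma sum_mul_noiseCoef (U : ι → ι → ℝ) (r : ℝ) (n : ℕ) (x : ι → ℕ → ℝ) (e : ℕ → ℝ) (v : ι → ℝ) :
    ∑ j, v j * noiseCoef U r n x e j =
      ∑ k ∈ Finset.range n, (∑ l, (Real.sqrt r * ∑ j, v j * U j l) * x l k) * e k := by
  simp only [noiseCoef, Finset.mul_sum, Finset.sum_mul]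
  rw [Finset.sum_comm]
  rw [Finset.sum_comm' (t' := Finset.univ) (s' := fun _ => Finset.range n) (by simp)]
  refine Finset.sum_congr rfl fun l _ => ?_
  rw [Finset.sum_comm]
  exact Finset.sum_congr rfl fun _ _ => Finset.sum_congr rfl fun _ _ => by ring

namespace IsWindowWeight

variable (hc : IsWindowWeight ξ n s c) (hξ : IsStdNoise P ξ m4) (hs : 0 ≤ s)
include hc hξ hs

lemma noiseCoef_moments (U : ι → ι → ℝ) (r : ℝ) (j : ι) :
    HasAllMoments (fun ω => noiseCoef U r n (fun l k => c l k ω) (fun k => ξ k ω) j) P :=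
  HasAllMoments.sum _ fun l _ => ((HasAllMoments.sum _ fun k _ =>
    (hc.moments hξ hs l k).mul (hξ.moments k)).const_mul _).const_mul _

lemma energyCoef_moments (U : ι → ι → ℝ) (r : ℝ) (j : ι) :
    HasAllMoments (fun ω => energyCoef U r n (fun l k => c l k ω) j) P :=
  (HasAllMoments.sum _ fun l _ => (HasAllMoments.sum _ fun k _ =>
    (hc.moments hξ hs l k).sq).const_mul _).const_mul _

lemma devQuad_moments (U : ι → ι → ℝ) (r p : ℝ) (w : ι → ℝ) :
    HasAllMoments (fun ω => devQuad (noiseCoef U r n (fun l k => c l k ω) (fun k => ξ k ω))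
      (energyCoef U r n (fun l k => c l k ω)) p w) P := by
  unfold devQuad
  simp_rw [div_eq_inv_mul]
  exact ((HasAllMoments.sum _ fun j _ => ((hc.noiseCoef_moments hξ hs U r j).sq.sub
    (hc.energyCoef_moments hξ hs U r j)).const_mul _).sq).const_mul _

lemma devLin_moments (U : ι → ι → ℝ) (r : ℝ) (θ w : ι → ℝ) :
    HasAllMoments (fun ω => devLin θ (noiseCoef U r n (fun l k => c l k ω) (fun k => ξ k ω)) w)
      P := by
  unfold devLin
  simp_rw [div_eq_inv_mul]
  exact ((HasAllMoments.sum _ fun j _ =>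
    (hc.noiseCoef_moments hξ hs U r j).const_mul _).sq).const_mul _

/-- The kernel `r * ∑ w U U` has squared Hilbert–Schmidt norm `r ^ 2 * ∑ w ^ 2`, which the
normalization cancels. Nothing depends on `w`, and `w = 0` is harmless because `x / 0 = 0`. -/
lemma integral_devQuad_le [DecidableEq ι] (hm4 : 0 ≤ m4) {U : ι → ι → ℝ}
    (hU : ∀ i j, ∑ l, U i l * U j l = if i = j then 1 else 0) {r p : ℝ} (hr : 0 ≤ r) (hp : 0 < p)
    (w : ι → ℝ) :
    ∫ ω, devQuad (noiseCoef U r n (fun l k => c l k ω) (fun k => ξ k ω))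
      (energyCoef U r n (fun l k => c l k ω)) p w ∂P ≤ s ^ 2 * (2 * m4 + 16) * (r ^ 2 / p) := by
  unfold devQuad
  have hw : 0 ≤ ∑ j, w j ^ 2 := Finset.sum_nonneg fun _ _ => sq_nonneg _
  have hK : 0 ≤ s ^ 2 * (2 * m4 + 16) := by positivity
  simp_rw [div_eq_mul_inv _ (p * _), integral_mul_const]
  simp_rw [sum_noiseCoef_sq_sub U hr]
  have h := hc.integral_quadForm_sq_le hξ hs hm4 (fun l m => r * ∑ j, w j * U j l * U j m)
    (fun l m => by
      congr 1
      exact Finset.sum_congr rfl fun _ _ => by ring)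
  simp_rw [mul_pow r, ← Finset.mul_sum, sum_sq_gram_of_orthonormal hU w] at h
  refine (mul_le_mul_of_nonneg_right h (inv_nonneg.2 (mul_nonneg hp.le hw))).trans ?_
  rcases hw.eq_or_lt with h0 | h0
  · rw [← h0]
    simpa using mul_nonneg hK (div_nonneg (sq_nonneg r) hp.le)
  · refine le_of_eq ?_
    field_simp

lemma integral_devLin_le [DecidableEq ι] {U : ι → ι → ℝ}
    (hU : ∀ i j, ∑ l, U i l * U j l = if i = j then 1 else 0) {r : ℝ} (hr : 0 ≤ r)
    (θ w : ι → ℝ) :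
    ∫ ω, devLin θ (noiseCoef U r n (fun l k => c l k ω) (fun k => ξ k ω)) w ∂P ≤
      2 * s * r := by
  unfold devLin
  have hw : 0 ≤ ∑ j, w j ^ 2 * θ j ^ 2 := Finset.sum_nonneg fun _ _ => by positivity
  simp_rw [div_eq_mul_inv _ (∑ j, _), integral_mul_const]
  simp_rw [fun ω => sum_mul_noiseCoef U r n (fun l k => c l k ω) (fun k => ξ k ω)
    fun j => w j * θ j]
  have h := hc.integral_linear_sq_le hξ hs (fun l => Real.sqrt r * ∑ j, w j * θ j * U j l)
  simp_rw [mul_pow (Real.sqrt r), ← Finset.mul_sum, Real.sq_sqrt hr,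
    sum_sq_of_orthonormal hU fun j => w j * θ j, mul_pow] at h
  refine (mul_le_mul_of_nonneg_right h (inv_nonneg.2 hw)).trans ?_
  rcases hw.eq_or_lt with h0 | h0
  · rw [← h0]
    simpa using mul_nonneg (mul_nonneg zero_le_two hs) hr
  · refine le_of_eq ?_
    field_simp

end IsWindowWeight

end Deviations

/-! ### The oracle inequality for grid losses. -/

namespace Design

variable (D : Design)

/-- The grid step `(b - a) / d`. -/
noncomputable def step : ℝ := (D.b - D.a) / D.d

/-- Normalized values of the basis functions on the grid. -/
noncomputable def basisMat (φ : Fin D.d → ℝ → ℝ) (j l : Fin D.d) : ℝ :=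
  Real.sqrt D.step * φ j (D.z (l + 1))

/-- Fourier coefficients of `S` for the empirical inner product. -/
noncomputable def coef (φ : Fin D.d → ℝ → ℝ) (S : ℝ → ℝ) (j : Fin D.d) : ℝ :=
  ∑ l, D.basisMat φ j l * (Real.sqrt D.step * S (D.z (l + 1)))

section

variable {D} (hab : D.a < D.b) (hn : 1 ≤ D.n)

section

include hab

lemma step_nonneg : 0 ≤ D.step := div_nonneg (by linarith) (Nat.cast_nonneg _)

lemma basisMat_orthonormal {φ : Fin D.d → ℝ → ℝ} (hφ : D.IsEmpOrthonormal φ) (i j : Fin D.d) :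
    ∑ l, D.basisMat φ i l * D.basisMat φ j l = if i = j then 1 else 0 := by
  rw [← hφ i j, empInner, sum_Icc_eq_sum_fin D.d fun l => φ i (D.z l) * φ j (D.z l),
    Finset.mul_sum]
  refine Finset.sum_congr rfl fun l _ => ?_
  have := Real.mul_self_sqrt (step_nonneg hab)
  unfold basisMat
  change _ = D.step * _
  linear_combination (φ i (D.z (l + 1)) * φ j (D.z (l + 1))) * this

lemma thetaHat_eq (φ : Fin D.d → ℝ → ℝ) (y : ℕ → ℝ) (j : Fin D.d) :
    D.thetaHat φ y j = ∑ l : Fin D.d, D.basisMat φ j l * (Real.sqrt D.step * D.Y (l + 1) y) := by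
  rw [thetaHat, sum_Icc_eq_sum_fin D.d fun l => D.Y l y * φ j (D.z l), Finset.mul_sum]
  refine Finset.sum_congr rfl fun l _ => ?_
  have := Real.mul_self_sqrt (step_nonneg hab)
  unfold basisMat
  change D.step * _ = _
  linear_combination -(φ j (D.z (l + 1)) * D.Y (l + 1) y) * this

lemma step_mul_sCoef_eq (φ : Fin D.d → ℝ → ℝ) (y : ℕ → ℝ) (j : Fin D.d) :
    D.step * D.sCoef φ y j =
      D.step * ∑ l : Fin D.d, D.basisMat φ j l ^ 2 * (1 / D.H (l + 1) y) := by
  rw [sCoef, sum_Icc_eq_sum_fin D.d fun l => D.sigmaSq l y * φ j (D.z l) ^ 2, Finset.mul_sum]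
  congr 1
  refine Finset.sum_congr rfl fun l _ => ?_
  unfold basisMat sigmaSq
  change D.step * _ = _
  rw [mul_pow, Real.sq_sqrt (step_nonneg hab)]
  ring

lemma gridLoss_wlsGrid_eq {φ : Fin D.d → ℝ → ℝ} (hφ : D.IsEmpOrthonormal φ) (S : ℝ → ℝ)
    (lam : Fin D.d → ℝ) {y : ℕ → ℝ} (hy : y ∈ D.Gamma) :
    D.gridLoss (D.wlsGrid φ lam y) S =
      ∑ j, (lam j * D.thetaHat φ y j - D.coef φ S j) ^ 2 := by
  unfold coef
  rw [← sum_sq_sub_of_orthonormal (basisMat_orthonormal hab hφ), gridLoss,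
    sum_Icc_eq_sum_fin D.d fun l => (D.wlsGrid φ lam y l - S (D.z l)) ^ 2, Finset.mul_sum]
  refine Finset.sum_congr rfl fun l _ => ?_
  have e : ∑ j, lam j * D.thetaHat φ y j * D.basisMat φ j l =
      Real.sqrt D.step * D.wlsGrid φ lam y (l + 1) := by
    unfold wlsGrid basisMat
    rw [Set.indicator_of_mem hy, Finset.mul_sum]
    exact Finset.sum_congr rfl fun _ _ => by ring
  rw [e, ← mul_sub, mul_pow, Real.sq_sqrt (step_nonneg hab)]
  rfl

lemma sum_coef_sq {φ : Fin D.d → ℝ → ℝ} (hφ : D.IsEmpOrthonormal φ) (f : Fin D.d → ℝ) :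
    ∑ j, (∑ l, D.basisMat φ j l * f l) ^ 2 = ∑ l, f l ^ 2 := by
  have := sum_sq_of_orthonormal (U := fun l j => D.basisMat φ j l)
    (orthonormal_transpose (basisMat_orthonormal hab hφ)) f
  simpa only [mul_comm] using this

end

lemma cost_eq (φ : Fin D.d → ℝ → ℝ) (δ : ℝ) (y : ℕ → ℝ) (lam : Fin D.d → ℝ) :
    D.cost φ δ y lam = ∑ j, lam j ^ 2 * D.thetaHat φ y j ^ 2 -
      2 * ∑ j, lam j * (D.thetaHat φ y j ^ 2 - D.step * D.sCoef φ y j) +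
      δ * ∑ j, lam j ^ 2 * (D.step * D.sCoef φ y j) := by
  unfold cost penalty thetaTilde step
  congr 2
  rw [Finset.mul_sum]
  exact Finset.sum_congr rfl fun _ _ => by ring

lemma succ_mem_Icc (l : Fin D.d) : (l : ℕ) + 1 ∈ Finset.Icc 1 D.d :=
  Finset.mem_Icc.2 ⟨by omega, l.2⟩

section

include hab hn

lemma step_pos : 0 < D.step := div_pos (by linarith) (by exact_mod_cast D.d_pos hn)

lemma sum_fin_step_le {f : Fin D.d → ℝ} {C : ℝ} (h : ∀ l, f l ≤ C) :
    ∑ l, D.step * f l ≤ (D.b - D.a) * C := by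
  have hd : (D.d : ℝ) ≠ 0 := by exact_mod_cast (D.d_pos hn).ne'
  refine (Finset.sum_le_sum fun l _ => mul_le_mul_of_nonneg_left (h l)
    (step_nonneg hab)).trans (le_of_eq ?_)
  rw [Finset.sum_const, Finset.card_univ, Fintype.card_fin, nsmul_eq_mul, step]
  field_simp

lemma isWindowWeight (hD : D.IsRegular) {Ω : Type*} {ξ : ℕ → Ω → ℝ} {S : ℝ → ℝ} {y0 : ℝ} :
    IsWindowWeight (fun k => ξ (k + 1)) D.n (8 / Real.sqrt D.n)
      (fun (l : Fin D.d) k ω => D.wt (l + 1) k (D.process S y0 fun k => ξ k ω)) where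
  measurable l k := @measurable_wt D Ω (past (fun k => ξ (k + 1)) k) _ _ _ fun j hj =>
    (D.process_measurable_past j).mono (past_mono _ hj) le_rfl
  disjoint l m k ω h := wt_mul_wt hab hn (by
    intro h'
    exact h (Fin.ext (by omega))) k _
  energy l ω := by
    have hl := succ_mem_Icc l
    refine (D.sum_wt_sq_le _ _ (D.k2_le _) (D.iota_le_k2 hD hl) (D.H_pos hab hn hD hl _)).trans ?_
    have h1 := (D.H_bounds hab hn hD hl (D.process S y0 fun k => ξ k ω)).1
    have h2 := D.sqrt_pos hn
    rw [div_le_div_iff₀ (D.H_pos hab hn hD hl _) h2]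
    linarith
  vanish l k ω h := by
    have := D.k2_le (l + 1)
    simp [wt, show ¬ k < D.k2 (l + 1) by omega]

/-- Pathwise oracle inequality for the grid losses on `Γ`. -/
theorem gridLoss_oracle (hD : D.IsRegular) {φ : Fin D.d → ℝ → ℝ} (hφ : D.IsEmpOrthonormal φ)
    {S : ℝ → ℝ} {ε L y0 : ℝ} (hε : 0 ≤ ε) (hL : 0 ≤ L) (hS : S ∈ stabilitySet D.a D.b ε L)
    {e y : ℕ → ℝ} (hy : y = D.process S y0 e) (hΓ : y ∈ D.Gamma) {M : ℝ}
    (hM : ∀ i < D.n, y i ^ 2 ≤ M) {δ : ℝ} (hδ : 0 < δ) (hδ1 : δ ≤ 1 / 12) {lam lam' : Fin D.d → ℝ}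
    (hl : ∀ j, lam j ∈ Set.Icc (0 : ℝ) 1) (hl' : ∀ j, lam' j ∈ Set.Icc (0 : ℝ) 1)
    (hJ : D.cost φ δ y lam' ≤ D.cost φ δ y lam) {N ψ : Fin D.d → ℝ} {p : ℝ}
    (hN : N = noiseCoef (D.basisMat φ) D.step D.n (fun l k => D.wt (l + 1) k y) fun k => e (k + 1))
    (hψ : ψ = energyCoef (D.basisMat φ) D.step D.n (fun l k => D.wt (l + 1) k y))
    (hp : p = D.step / (2 * Real.sqrt D.n * (2 + Real.log D.n))) :
    D.gridLoss (D.wlsGrid φ lam' y) S ≤ (1 + 4 * δ) / (1 - 6 * δ) *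
      D.gridLoss (D.wlsGrid φ lam y) S + 300 / δ *
      ((D.b - D.a) * (2 * (L * D.h) ^ 2 + 8 * M ^ 2 * (8 / Real.sqrt D.n) ^ 2) +
        devQuad N ψ p lam' + devQuad N ψ p lam + devQuad N ψ p (fun j => lam' j ^ 2) +
        devQuad N ψ p (fun j => lam j ^ 2) + devLin (D.coef φ S) N (fun j => lam' j - lam j) +
        devLin (D.coef φ S) N (fun j => lam j * (1 - lam j))) := by
  have hHpos : ∀ l : Fin D.d, 0 < D.H (l + 1) y := fun l =>
    D.H_pos hab hn hD (succ_mem_Icc l) y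
  have hsq := D.sqrt_pos hn
  have hHmax : 0 < 2 * Real.sqrt D.n * (2 + Real.log D.n) := by
    have := Real.log_natCast_nonneg D.n
    positivity
  have hstep := step_pos hab hn
  have hp0 : 0 < p := by rw [hp]; positivity
  have hmem : ∀ l : Fin D.d, y ∈ D.GammaAt (l + 1) := fun l => hΓ _ (succ_mem_Icc l)
  -- On `Γ` the energy of every window is exactly `1 / H_l`, so the observable penalty coincides
  -- with the compensator of the squared noise coefficient.
  have hψ' : ∀ j, ψ j = D.step * D.sCoef φ y j := fun j => by
    rw [hψ, step_mul_sCoef_eq hab, energyCoef]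
    congr 1
    exact Finset.sum_congr rfl fun l _ => by
      rw [D.sum_wt_sq_eq _ y (D.k2_le _) (hHpos l) (hmem l)]
  -- The squared entries of a row of `basisMat` sum to one, so `ψ j / step` is an average of the `1
  -- / H_l`, and the upper bound on `H` bounds it below.
  have hψp : ∀ j, p ≤ ψ j := fun j => by
    rw [hψ', step_mul_sCoef_eq hab, hp, div_eq_mul_inv]
    refine mul_le_mul_of_nonneg_left ?_ hstep.le
    have hu : ∑ l, D.basisMat φ j l ^ 2 = 1 := by
      simpa [pow_two] using basisMat_orthonormal hab hφ j j
    calc (2 * Real.sqrt D.n * (2 + Real.log D.n))⁻¹ =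
        ∑ l, D.basisMat φ j l ^ 2 * (2 * Real.sqrt D.n * (2 + Real.log D.n))⁻¹ := by
          rw [← Finset.sum_mul, hu, one_mul]
      _ ≤ _ := Finset.sum_le_sum fun l _ => mul_le_mul_of_nonneg_left (by
          rw [inv_eq_one_div]
          exact one_div_le_one_div_of_le (hHpos l)
            (D.H_bounds hab hn hD (succ_mem_Icc l) y).2) (sq_nonneg _)
  set bias : Fin D.d → ℝ := fun l => D.seqEst (l + 1) y - S (D.z (l + 1)) -
    ∑ k ∈ Finset.range D.n, D.wt (l + 1) k y * e (k + 1) with hbias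
  set β : Fin D.d → ℝ := fun j => ∑ l, D.basisMat φ j l * (Real.sqrt D.step * bias l) with hβ
  have hθ : ∀ j, D.thetaHat φ y j = D.coef φ S j + β j + N j := fun j => by
    rw [thetaHat_eq hab, hN, coef, noiseCoef, hβ, ← Finset.sum_add_distrib,
      ← Finset.sum_add_distrib]
    refine Finset.sum_congr rfl fun l _ => ?_
    rw [Y, Set.indicator_of_mem hΓ, hbias]
    ring
  have hS1 : ∀ t ∈ Set.Icc D.a D.b, |S t| ≤ 1 := fun t ht => (hS.2.1 t ht).trans (by linarith)
  have hM0 : 0 ≤ M := (sq_nonneg _).trans (hM 0 (by omega))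
  have hb : ∀ l, bias l ^ 2 ≤ 2 * (L * D.h) ^ 2 + 8 * M ^ 2 * (8 / Real.sqrt D.n) ^ 2 := fun l => by
    have hz := z_mem hab hn (show (l : ℕ) + 1 ≤ D.d from l.2)
    have h1 := D.abs_seqEst_sub_le (l + 1) y (fun k => e (k + 1)) (fun i => S (D.x (i + 1)))
      (D.k2_le _) (hHpos l) (hmem l) (fun i _ => by rw [hy]; rfl) (s0 := S (D.z (l + 1)))
      (η := L * D.h) (M := M) (fun i hi => hS1 _ (x_mem hab hn hi)) (hS1 _ hz)
      (fun i hi hQ => (lipschitz_of_mem_stabilitySet S hS (x_mem hab hn hi) hz).trans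
        (mul_le_mul_of_nonneg_left (abs_x_sub_z_le hab hn hQ) hL))
      (mul_nonneg hL (h_pos hab hn).le) hM
    have h2 : 2 * M / D.H (l + 1) y ≤ 2 * M * (8 / Real.sqrt D.n) := by
      rw [div_eq_mul_inv]
      refine mul_le_mul_of_nonneg_left ?_ (by positivity)
      rw [inv_eq_one_div, div_le_div_iff₀ (hHpos l) hsq]
      linarith [(D.H_bounds hab hn hD (succ_mem_Icc l) y).1]
    have h3 := h1.trans (add_le_add_right h2 _)
    rw [← sq_abs]
    refine (pow_le_pow_left₀ (abs_nonneg _) h3 2).trans ?_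
    nlinarith [sq_nonneg (L * D.h - 2 * M * (8 / Real.sqrt D.n))]
  have hβ2 : ∑ j, β j ^ 2 ≤
      (D.b - D.a) * (2 * (L * D.h) ^ 2 + 8 * M ^ 2 * (8 / Real.sqrt D.n) ^ 2) := by
    rw [hβ, sum_coef_sq hab hφ]
    simp_rw [mul_pow, Real.sq_sqrt hstep.le]
    refine (sum_fin_step_le hab hn hb).trans (le_of_eq ?_)
    ring
  rw [gridLoss_wlsGrid_eq hab hφ S lam' hΓ, gridLoss_wlsGrid_eq hab hφ S lam hΓ]
  rw [cost_eq, cost_eq] at hJ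
  simp_rw [← hψ'] at hJ
  refine (oracle_pathwise (D.coef φ S) β N ψ hp0 hψp hδ hδ1 hl hl' hθ hJ).trans
    (add_le_add_right (mul_le_mul_of_nonneg_left ?_ (by positivity)) _)
  unfold oracleRem
  linarith

/-- Bound on the grid loss that holds without any condition on the design. -/
lemma gridLoss_crude {φ : Fin D.d → ℝ → ℝ} (hφ : D.IsEmpOrthonormal φ) {S : ℝ → ℝ}
    (hS : ∀ t ∈ Set.Icc D.a D.b, |S t| ≤ 1) (y : ℕ → ℝ) {lam : Fin D.d → ℝ}
    (hl : ∀ j, lam j ∈ Set.Icc (0 : ℝ) 1) :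
    D.gridLoss (D.wlsGrid φ lam y) S ≤
      (D.b - D.a) * (4 * ∑ i ∈ Finset.range D.n, y (i + 1) ^ 2 + 2) := by
  have h0 : 0 ≤ ∑ i ∈ Finset.range D.n, y (i + 1) ^ 2 := Finset.sum_nonneg fun _ _ => sq_nonneg _
  have hS2 : ∀ l : Fin D.d, S (D.z (l + 1)) ^ 2 ≤ 1 := fun l => by
    rw [sq_le_one_iff_abs_le_one]
    exact hS _ (z_mem hab hn (show (l : ℕ) + 1 ≤ D.d from l.2))
  by_cases hy : y ∈ D.Gamma
  · rw [gridLoss_wlsGrid_eq hab hφ S lam hy]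
    have h1 : ∑ j, D.thetaHat φ y j ^ 2 ≤
        (D.b - D.a) * (2 * ∑ i ∈ Finset.range D.n, y (i + 1) ^ 2) := by
      simp_rw [thetaHat_eq hab]
      rw [sum_coef_sq hab hφ]
      simp_rw [mul_pow, Real.sq_sqrt (step_nonneg hab)]
      refine sum_fin_step_le hab hn fun l => ?_
      rw [Y, Set.indicator_of_mem hy]
      exact D.seqEst_sq_le_two_mul _ y (D.k2_le _)
    have h2 : ∑ j, D.coef φ S j ^ 2 ≤ (D.b - D.a) * 1 := by
      unfold coef
      rw [sum_coef_sq hab hφ]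
      simp_rw [mul_pow, Real.sq_sqrt (step_nonneg hab)]
      exact sum_fin_step_le hab hn hS2
    have h3 : ∑ j, (lam j * D.thetaHat φ y j - D.coef φ S j) ^ 2 ≤
        2 * ∑ j, D.thetaHat φ y j ^ 2 + 2 * ∑ j, D.coef φ S j ^ 2 := by
      rw [Finset.mul_sum, Finset.mul_sum, ← Finset.sum_add_distrib]
      refine Finset.sum_le_sum fun j _ => ?_
      have h4 : (lam j * D.thetaHat φ y j) ^ 2 ≤ D.thetaHat φ y j ^ 2 := by
        rw [mul_pow]
        exact mul_le_of_le_one_left (sq_nonneg _) (pow_le_one₀ (hl j).1 (hl j).2)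
      nlinarith [sq_nonneg (lam j * D.thetaHat φ y j + D.coef φ S j)]
    linarith
  · rw [gridLoss, sum_Icc_eq_sum_fin D.d fun l => (D.wlsGrid φ lam y l - S (D.z l)) ^ 2,
      Finset.mul_sum]
    refine sum_fin_step_le hab hn fun l => ?_
    rw [wlsGrid, Set.indicator_of_notMem hy, zero_sub, neg_sq]
    linarith [hS2 l]

end

end

end Design

/-! ### Subpolynomial growth and the remainder constants. -/

section SubPolynomial

/-- Sequences that grow more slowly than every positive power. -/
def IsSubPoly (f : ℕ → ℝ) : Prop :=
  ∀ r : ℝ, 0 < r → Tendsto (fun n : ℕ => f n / (n : ℝ) ^ r) atTop (𝓝 0)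

namespace IsSubPoly

variable {f g : ℕ → ℝ}

lemma add (hf : IsSubPoly f) (hg : IsSubPoly g) : IsSubPoly fun n => f n + g n := fun r hr => by
  simpa [add_div] using (hf r hr).add (hg r hr)

lemma mul (hf : IsSubPoly f) (hg : IsSubPoly g) : IsSubPoly fun n => f n * g n := fun r hr => by
  have h := (hf (r / 2) (by positivity)).mul (hg (r / 2) (by positivity))
  rw [mul_zero] at h
  refine h.congr' ?_
  filter_upwards [eventually_gt_atTop 0] with n hn
  have hn' : (0 : ℝ) < n := by exact_mod_cast hn
  rw [div_mul_div_comm, ← Real.rpow_add hn', add_halves]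

lemma const (c : ℝ) : IsSubPoly fun _ => c := fun _ hr =>
  ((tendsto_rpow_atTop hr).comp tendsto_natCast_atTop_atTop).const_div_atTop c

lemma pow (hf : IsSubPoly f) (m : ℕ) : IsSubPoly fun n => f n ^ m := by
  induction m with
  | zero => simpa using const 1
  | succ m ih => simpa only [pow_succ] using ih.mul hf

lemma log : IsSubPoly fun n => Real.log n := fun _ hr =>
  ((isLittleO_log_rpow_atTop hr).tendsto_div_nhds_zero).comp tendsto_natCast_atTop_atTop

lemma congr' (hf : IsSubPoly f) (h : f =ᶠ[atTop] g) : IsSubPoly g := fun r hr =>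
  (hf r hr).congr' (h.mono fun n hn => by simp only [hn])

/-- For a given exponent `r`, a single `m` with `1 / (m + 1) < r / 2` suffices. Taking the infimum
over `m` yields one sequence that works for all `r` at once. -/
lemma iInf_rpow_mul {F : ℕ → ℕ → ℝ} (h : ∀ m, IsSubPoly (F m)) (h0 : ∀ m n, 0 ≤ F m n) :
    IsSubPoly fun n => ⨅ m : ℕ, (n : ℝ) ^ (1 / ((m : ℝ) + 1)) * F m n := fun r hr => by
  obtain ⟨m, hm⟩ := exists_nat_one_div_lt (half_pos hr)
  have hnn : ∀ n m : ℕ, 0 ≤ (n : ℝ) ^ (1 / ((m : ℝ) + 1)) * F m n := fun n m =>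
    mul_nonneg (Real.rpow_nonneg (Nat.cast_nonneg _) _) (h0 m n)
  refine squeeze_zero' (Eventually.of_forall fun n => div_nonneg (Real.iInf_nonneg (hnn n))
    (Real.rpow_nonneg (Nat.cast_nonneg _) _)) ?_ (h m (r / 2) (half_pos hr))
  filter_upwards [eventually_ge_atTop 1] with n hn
  have hn' : (1 : ℝ) ≤ n := by exact_mod_cast hn
  have hn0 : (0 : ℝ) < n := by linarith
  have h1 : ⨅ m : ℕ, (n : ℝ) ^ (1 / ((m : ℝ) + 1)) * F m n ≤ (n : ℝ) ^ (r / 2) * F m n :=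
    (ciInf_le ⟨0, Set.forall_mem_range.2 (hnn n)⟩ m).trans
      (mul_le_mul_of_nonneg_right (Real.rpow_le_rpow_of_exponent_le hn' hm.le) (h0 m n))
  rw [div_le_div_iff₀ (by positivity) (by positivity)]
  calc _ ≤ (n : ℝ) ^ (r / 2) * F m n * (n : ℝ) ^ (r / 2) :=
        mul_le_mul_of_nonneg_right h1 (by positivity)
    _ = F m n * ((n : ℝ) ^ (r / 2) * (n : ℝ) ^ (r / 2)) := by ring
    _ = _ := by rw [← Real.rpow_add hn0, add_halves]

end IsSubPoly

end SubPolynomial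

/-- Moment factor in the bound for the fourth power of the largest observation. -/
noncomputable def pathFactor (y0 ε : ℝ) (ς : ℕ → ℝ) (m n : ℕ) : ℝ :=
  1 + (y0 ^ (2 * (2 * (m + 1))) + ς n ^ (2 * (m + 1)) *
    (Nat.doubleFactorial (2 * (2 * (m + 1)) - 1) : ℝ) / ε ^ (2 * (2 * (m + 1))))

/-- Bound for the expected fourth power of the largest observation. -/
noncomputable def pathBound (y0 ε : ℝ) (ς : ℕ → ℝ) (n : ℕ) : ℝ :=
  ⨅ m : ℕ, (n : ℝ) ^ (1 / ((m : ℝ) + 1)) * pathFactor y0 ε ς m n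

/-- The remainder constant for regular designs. -/
noncomputable def mainBound (a b ε L y0 : ℝ) (ς : ℕ → ℝ) (ν : ℕ → ℕ) (n : ℕ) : ℝ :=
  20 * (b - a) ^ 3 * L ^ 2 + 325 * (2 * (b - a) ^ 3 * L ^ 2 +
    ((ν n : ℝ) + 1) * (512 * (b - a) * (6 * ς n ^ 2 + 16) * (2 + Real.log n) + 32 * (b - a)) +
    512 * (b - a) * pathBound y0 ε ς n)

/-- The remainder constant for the finitely many irregular designs. -/
noncomputable def crudeBound (a b ε L y0 : ℝ) (n : ℕ) : ℝ :=
  n * (2 * ((b - a) * (4 * (n * (y0 ^ 2 + 1 / ε ^ 2)) + 2)) + 2 * ((b - a) * (L * (b - a)) ^ 2))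

open Classical in
/-- The remainder constant. -/
noncomputable def remainderBound (a b ε L mu0 y0 : ℝ) (ς : ℕ → ℝ) (ν : ℕ → ℕ) (n : ℕ) : ℝ :=
  if (⟨a, b, mu0, n⟩ : Design).IsRegular then mainBound a b ε L y0 ς ν n
  else crudeBound a b ε L y0 n

section Bounds

variable {a b ε L mu0 y0 : ℝ} {ς : ℕ → ℝ} {ν : ℕ → ℕ}

lemma pathFactor_nonneg (hε : 0 < ε) (hς1 : ∀ n, 1 ≤ ς n) (m n : ℕ) :
    0 ≤ pathFactor y0 ε ς m n := by
  have h1 := zero_le_one.trans (hς1 n)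
  have h2 : 0 ≤ y0 ^ (2 * (2 * (m + 1))) := by rw [pow_mul]; positivity
  unfold pathFactor
  positivity

lemma isSubPoly_mainBound (hε : 0 < ε) (hς1 : ∀ n, 1 ≤ ς n) (hς : IsSubPoly ς)
    (hν : IsSubPoly fun n => (ν n : ℝ)) : IsSubPoly (mainBound a b ε L y0 ς ν) := by
  have hpath : IsSubPoly (pathBound y0 ε ς) := by
    refine IsSubPoly.iInf_rpow_mul (fun m => ?_) (pathFactor_nonneg hε hς1)
    unfold pathFactor
    simp_rw [mul_div_assoc]
    exact (IsSubPoly.const _).add ((IsSubPoly.const _).add ((hς.pow _).mul (IsSubPoly.const _)))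
  unfold mainBound
  exact (IsSubPoly.const _).add ((IsSubPoly.const _).mul (((IsSubPoly.const _).add
    ((hν.add (IsSubPoly.const 1)).mul ((((IsSubPoly.const _).mul
    (((IsSubPoly.const 6).mul (hς.pow 2)).add (IsSubPoly.const 16))).mul
    ((IsSubPoly.const 2).add IsSubPoly.log)).add (IsSubPoly.const _)))).add
    ((IsSubPoly.const _).mul hpath)))

/-- The crude branch occurs for finitely many `n` only, so its size is irrelevant to the limit. -/
lemma isSubPoly_remainderBound (hab : a < b) (hmu1 : mu0 < 1) (hε : 0 < ε) (hς1 : ∀ n, 1 ≤ ς n)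
    (hς : IsSubPoly ς) (hν : IsSubPoly fun n => (ν n : ℝ)) :
    IsSubPoly (remainderBound a b ε L mu0 y0 ς ν) :=
  (isSubPoly_mainBound (a := a) (b := b) (L := L) (y0 := y0) hε hς1 hς hν).congr'
    ((Design.eventually_isRegular hab hmu1).mono fun n hn => by simp [remainderBound, hn])

end Bounds

lemma oracle_const_bounds {δ : ℝ} (hδ : 0 < δ) (hδ1 : δ ≤ 1 / 12) :
    1 ≤ (1 + 4 * δ) / (1 - 6 * δ) ∧ (1 + 4 * δ) / (1 - 6 * δ) ≤ 8 / 3 := by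
  have h : 0 < 1 - 6 * δ := by linarith
  constructor
  · rw [le_div_iff₀ h]; linarith
  · rw [div_le_iff₀ h]; linarith

/-- Passage from the oracle inequality for grid losses to the one for integrated losses. -/
lemma integrated_oracle_arith {δ u v l l' E R : ℝ} (hδ : 0 < δ) (hδ1 : δ ≤ 1 / 12) (hE : 0 ≤ E)
    (hR : 0 ≤ R) (h1 : l' ≤ (1 + δ) * u + (1 + 1 / δ) * E) (h2 : v ≤ (1 + δ) * l + (1 + 1 / δ) * E)
    (h3 : u ≤ (1 + 4 * δ) / (1 - 6 * δ) * v + 300 / δ * R) :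
    l' ≤ (1 + 4 * δ) * (1 + δ) ^ 2 / (1 - 6 * δ) * l + (5 * E + 325 * R) / δ := by
  obtain ⟨hρ1, hρ⟩ := oracle_const_bounds hδ hδ1
  have e1 : (1 + 4 * δ) * (1 + δ) ^ 2 / (1 - 6 * δ) * l =
      (1 + δ) * ((1 + 4 * δ) / (1 - 6 * δ) * ((1 + δ) * l)) := by ring
  rw [e1]
  set ρ := (1 + 4 * δ) / (1 - 6 * δ)
  have hEδ : 0 ≤ E / δ := by positivity
  have hRδ : 0 ≤ R / δ := by positivity
  have c1 : (1 + 1 / δ) * E ≤ 13 / 12 * (E / δ) := by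
    have e : (1 + 1 / δ) * E = (1 + δ) * (E / δ) := by field_simp; ring
    rw [e]
    exact mul_le_mul_of_nonneg_right (by linarith) hEδ
  have c2 : ρ * v ≤ ρ * ((1 + δ) * l) + 8 / 3 * (13 / 12 * (E / δ)) := by
    have := mul_le_mul_of_nonneg_left (h2.trans (add_le_add_right c1 _)) (by linarith : 0 ≤ ρ)
    have h4 := mul_le_mul_of_nonneg_right hρ (by positivity : 0 ≤ 13 / 12 * (E / δ))
    linarith
  have e2 : 300 / δ * R = 300 * (R / δ) := by ring
  rw [e2] at h3
  have c3 : (1 + δ) * u ≤ (1 + δ) * (ρ * ((1 + δ) * l)) +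
      13 / 12 * (8 / 3 * (13 / 12 * (E / δ)) + 300 * (R / δ)) := by
    have h5 := mul_le_mul_of_nonneg_left (h3.trans (add_le_add_left c2 _))
      (by linarith : 0 ≤ 1 + δ)
    have h6 := mul_le_mul_of_nonneg_right (by linarith : 1 + δ ≤ 13 / 12)
      (by positivity : 0 ≤ 8 / 3 * (13 / 12 * (E / δ)) + 300 * (R / δ))
    linarith
  have e3 : (5 * E + 325 * R) / δ = 5 * (E / δ) + 325 * (R / δ) := by ring
  rw [e3]
  linarith

/-! ### From pathwise losses to risks. -/

namespace Design

variable {D : Design}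

lemma sqNorm_nonneg (hab : D.a < D.b) (f : ℝ → ℝ) : 0 ≤ D.sqNorm f :=
  intervalIntegral.integral_nonneg hab.le fun _ _ => sq_nonneg _

/-- All estimators vanish off `Γ`, so there the comparison of losses is trivial. -/
lemma wls_of_notMem_Gamma (φ : Fin D.d → ℝ → ℝ) (lam lam' : Fin D.d → ℝ) {y : ℕ → ℝ}
    (hy : y ∉ D.Gamma) : D.wls φ lam y = D.wls φ lam' y := by
  have h : ∀ lam : Fin D.d → ℝ, ∀ l, D.wlsGrid φ lam y l = 0 := fun lam l =>
    Set.indicator_of_notMem hy _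
  funext t
  simp only [wls, h]

lemma sqNorm_wls_bounds (hab : D.a < D.b) (hn : 1 ≤ D.n) (φ : Fin D.d → ℝ → ℝ)
    (lam : Fin D.d → ℝ) (y : ℕ → ℝ) {S : ℝ → ℝ} {ε L δ : ℝ} (hδ : 0 < δ) (hL : 0 ≤ L)
    (hS : S ∈ stabilitySet D.a D.b ε L) :
    D.sqNorm (fun t => D.wls φ lam y t - S t) ≤ (1 + δ) * D.gridLoss (D.wlsGrid φ lam y) S +
        (1 + 1 / δ) * ((D.b - D.a) * (L * D.step) ^ 2) ∧
      D.gridLoss (D.wlsGrid φ lam y) S ≤ (1 + δ) * D.sqNorm (fun t => D.wls φ lam y t - S t) +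
        (1 + 1 / δ) * ((D.b - D.a) * (L * D.step) ^ 2) :=
  sqNorm_step_bounds hab hn hδ hS.1.continuousOn
    (fun _ hs _ ht => lipschitz_of_mem_stabilitySet S hS hs ht) hL
    fun _ hi _ ht => wls_eq hab hn φ lam y hi ht

lemma step_le (hab : D.a < D.b) (hn : 1 ≤ D.n) : D.step ≤ 2 * (D.b - D.a) / Real.sqrt D.n := by
  have hd : (0 : ℝ) < D.d := by exact_mod_cast D.d_pos hn
  unfold step
  rw [div_le_div_iff₀ hd (D.sqrt_pos hn)]
  nlinarith [D.sqrt_le_two_mul_d hn]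

lemma step_sq_le (hab : D.a < D.b) (hn : 1 ≤ D.n) : D.step ^ 2 ≤ 4 * (D.b - D.a) ^ 2 / D.n := by
  refine (pow_le_pow_left₀ (step_nonneg hab) (step_le hab hn) 2).trans (le_of_eq ?_)
  rw [div_pow, Real.sq_sqrt (Nat.cast_nonneg _)]
  ring

end Design

namespace Design

section Risk

variable {D : Design} (hab : D.a < D.b) (hn : 1 ≤ D.n) {Ω : Type*} [MeasurableSpace Ω]
  {P : Measure Ω} [IsProbabilityMeasure P] {ξ : ℕ → Ω → ℝ} {S : ℝ → ℝ} {ε L y0 : ℝ}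
  {φ : Fin D.d → ℝ → ℝ} {y : Ω → ℕ → ℝ}

/-- Martingale part of the remainder for the comparison with a fixed weight `lam`. -/
noncomputable def martRem (D : Design) (φ : Fin D.d → ℝ → ℝ) (S : ℝ → ℝ)
    (Λ : Finset (Fin D.d → ℝ)) (lam : Fin D.d → ℝ) (N ψ : Fin D.d → ℝ) (p : ℝ) : ℝ :=
  (devQuad N ψ p lam + devQuad N ψ p (fun j => lam j ^ 2) +
    devLin (D.coef φ S) N (fun j => lam j * (1 - lam j))) +
  ∑ mu ∈ Λ, (devQuad N ψ p mu + devQuad N ψ p (fun j => mu j ^ 2) +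
    devLin (D.coef φ S) N (fun j => mu j - lam j))

include hab hn

lemma integral_martRem_le (hD : D.IsRegular) (hφ : D.IsEmpOrthonormal φ) {m4 : ℝ} (hm4 : 0 ≤ m4)
    (hξ : IsStdNoise P (fun k => ξ (k + 1)) m4)
    (hy : ∀ ω, y ω = D.process S y0 (fun k => ξ k ω))
    (Λ : Finset (Fin D.d → ℝ)) (lam : Fin D.d → ℝ) {p : ℝ}
    (hp : p = D.step / (2 * Real.sqrt D.n * (2 + Real.log D.n))) :
    Integrable (fun ω => D.martRem φ S Λ lam
      (noiseCoef (D.basisMat φ) D.step D.n (fun l k => D.wt (l + 1) k (y ω)) fun k => ξ (k + 1) ω)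
      (energyCoef (D.basisMat φ) D.step D.n (fun l k => D.wt (l + 1) k (y ω))) p) P ∧
    ∫ ω, D.martRem φ S Λ lam
      (noiseCoef (D.basisMat φ) D.step D.n (fun l k => D.wt (l + 1) k (y ω)) fun k => ξ (k + 1) ω)
      (energyCoef (D.basisMat φ) D.step D.n (fun l k => D.wt (l + 1) k (y ω))) p ∂P ≤
      ((Λ.card : ℝ) + 1) * (512 * (D.b - D.a) * (2 * m4 + 16) * (2 + Real.log D.n) +
        32 * (D.b - D.a)) / D.n := by
  have hs : 0 ≤ 8 / Real.sqrt D.n := by positivity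
  have hstep := step_pos hab hn
  have hsq := D.sqrt_pos hn
  have hlog := Real.log_natCast_nonneg D.n
  have hn0 : (0 : ℝ) < D.n := by exact_mod_cast hn
  have hp0 : 0 < p := by rw [hp]; positivity
  have hc := isWindowWeight hab hn hD (ξ := ξ) (S := S) (y0 := y0)
  have hU := basisMat_orthonormal hab hφ
  simp only [← hy] at hc
  set N : Ω → Fin D.d → ℝ := fun ω => noiseCoef (D.basisMat φ) D.step D.n
    (fun l k => D.wt (l + 1) k (y ω)) fun k => ξ (k + 1) ω
  set ψ : Ω → Fin D.d → ℝ := fun ω => energyCoef (D.basisMat φ) D.step D.n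
    (fun l k => D.wt (l + 1) k (y ω))
  have hQm : ∀ w, HasAllMoments (fun ω => devQuad (N ω) (ψ ω) p w) P := fun w =>
    hc.devQuad_moments hξ hs (D.basisMat φ) D.step p w
  have hLm : ∀ w, HasAllMoments (fun ω => devLin (D.coef φ S) (N ω) w) P := fun w =>
    hc.devLin_moments hξ hs (D.basisMat φ) D.step (D.coef φ S) w
  have hstep_le := step_le hab hn
  have hsqn : Real.sqrt D.n ^ 2 = D.n := Real.sq_sqrt hn0.le
  have hQ : ∀ w, ∫ ω, devQuad (N ω) (ψ ω) p w ∂P ≤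
      256 * (D.b - D.a) * (2 * m4 + 16) * (2 + Real.log D.n) / D.n := fun w => by
    refine (hc.integral_devQuad_le hξ hs hm4 hU hstep.le hp0 w).trans ?_
    -- The logarithm comes from the ratio between the upper and lower bounds on the thresholds `H`.
    have e : D.step ^ 2 / p = D.step * (2 * Real.sqrt D.n * (2 + Real.log D.n)) := by
      rw [hp]
      field_simp
    rw [e, div_pow, hsqn]
    calc 8 ^ 2 / (D.n : ℝ) * (2 * m4 + 16) * (D.step * (2 * Real.sqrt D.n * (2 + Real.log D.n)))
        ≤ 8 ^ 2 / (D.n : ℝ) * (2 * m4 + 16) * (2 * (D.b - D.a) / Real.sqrt D.n *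
          (2 * Real.sqrt D.n * (2 + Real.log D.n))) := by gcongr
      _ = _ := by
        field_simp
        ring
  have hLin : ∀ w, ∫ ω, devLin (D.coef φ S) (N ω) w ∂P ≤ 32 * (D.b - D.a) / D.n := fun w => by
    refine (hc.integral_devLin_le hξ hs hU hstep.le (D.coef φ S) w).trans ?_
    calc 2 * (8 / Real.sqrt D.n) * D.step
        ≤ 2 * (8 / Real.sqrt D.n) * (2 * (D.b - D.a) / Real.sqrt D.n) := by gcongr
      _ = 32 * (D.b - D.a) / Real.sqrt D.n ^ 2 := by
        field_simp
        ring
      _ = _ := by rw [hsqn]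
  have htriple : ∀ w1 w2 w3, HasAllMoments (fun ω => devQuad (N ω) (ψ ω) p w1 +
      devQuad (N ω) (ψ ω) p w2 + devLin (D.coef φ S) (N ω) w3) P := fun w1 w2 w3 =>
    ((hQm w1).add (hQm w2)).add (hLm w3)
  have htriple_le : ∀ w1 w2 w3, ∫ ω, (devQuad (N ω) (ψ ω) p w1 +
      devQuad (N ω) (ψ ω) p w2 + devLin (D.coef φ S) (N ω) w3) ∂P ≤
      (512 * (D.b - D.a) * (2 * m4 + 16) * (2 + Real.log D.n) + 32 * (D.b - D.a)) / D.n :=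
    fun w1 w2 w3 => by
      rw [((hQm w1).add (hQm w2)).integral_add (hLm w3), (hQm w1).integral_add (hQm w2), add_div]
      have e : 512 * (D.b - D.a) * (2 * m4 + 16) * (2 + Real.log D.n) / D.n =
        2 * (256 * (D.b - D.a) * (2 * m4 + 16) * (2 + Real.log D.n) / D.n) := by ring
      linarith [hQ w1, hQ w2, hLin w3]
  have hsum := HasAllMoments.sum Λ fun mu _ =>
    htriple mu (fun j => mu j ^ 2) (fun j => mu j - lam j)
  have hhead := htriple lam (fun j => lam j ^ 2) (fun j => lam j * (1 - lam j))
  refine ⟨(hhead.add hsum).integrable, ?_⟩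
  unfold martRem
  rw [hhead.integral_add hsum, integral_finsetSum _ fun mu _ => (htriple mu _ _).integrable]
  have h1 := Finset.sum_le_card_nsmul Λ _ _ fun mu _ =>
    htriple_le mu (fun j => mu j ^ 2) (fun j => mu j - lam j)
  have h2 := htriple_le lam (fun j => lam j ^ 2) (fun j => lam j * (1 - lam j))
  rw [nsmul_eq_mul] at h1
  rw [mul_div_assoc]
  linarith

/-- The fourth power enters because the stopping-step bias is of order `y ^ 2` and is squared in the
loss. The bound holds for every moment order, hence for the infimum. -/
lemma lintegral_sup'_process_le {ς : ℕ → ℝ} {p : ℝ → ℝ} (hε : 0 < ε) (hε1 : ε < 1)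
    (hς1 : ∀ n, 1 ≤ ς n) (hp : IsNoiseDensity (ς D.n) p) (hξ : IsNoise P p ξ)
    (hS : S ∈ stabilitySet D.a D.b ε L)
    (hy : ∀ ω, y ω = D.process S y0 (fun k => ξ k ω)) (hne : (Finset.range D.n).Nonempty) :
    ∫⁻ ω, ENNReal.ofReal ((Finset.range D.n).sup' hne fun i => y ω i ^ 4) ∂P ≤
      ENNReal.ofReal (pathBound y0 ε ς D.n) := by
  have hstd := isStdNoise hp hξ (hς1 D.n)
  have hmom : ∀ i, HasAllMoments (fun ω => y ω i) P := fun i => by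
    simp only [hy]
    exact D.process_moments hstd i
  have h : ∀ m : ℕ, ∫⁻ ω, ENNReal.ofReal ((Finset.range D.n).sup' hne fun i => y ω i ^ 4) ∂P ≤
      ENNReal.ofReal ((D.n : ℝ) ^ (1 / ((m : ℝ) + 1)) * pathFactor y0 ε ς m D.n) := fun m => by
    refine lintegral_sup'_le hne (Z := fun i ω => y ω i ^ 4) (fun i => (hmom i).pow 4)
      (fun i ω => by positivity) fun i hi => ?_
    have h1 := D.integral_process_pow_le hstd (S := S) (y0 := y0) hε hε1 (N := D.n)
      (m := 2 * (m + 1)) (fun i hi => hS.2.1 _ (x_mem hab hn hi))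
      (fun k => integral_even_noise_le hp hξ (hς1 D.n) (by omega : 1 ≤ k + 1) (by omega))
      (mul_nonneg (pow_nonneg (zero_le_one.trans (hς1 _)) _) (Nat.cast_nonneg _)) hi.le
    have e : ∀ ω, (y ω i ^ 4) ^ (m + 1) =
        D.process S y0 (fun k => ξ k ω) i ^ (2 * (2 * (m + 1))) := fun ω => by
      rw [hy, ← pow_mul]
      congr 1
      ring
    simp_rw [e]
    exact h1
  have hfin := ne_top_of_le_ne_top ENNReal.ofReal_ne_top (h 0)
  have hle : ∀ m : ℕ, (∫⁻ ω, ENNReal.ofReal ((Finset.range D.n).sup' hne fun i => y ω i ^ 4) ∂P).toReal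
      ≤ (D.n : ℝ) ^ (1 / ((m : ℝ) + 1)) * pathFactor y0 ε ς m D.n := fun m =>
    ENNReal.toReal_le_of_le_ofReal (mul_nonneg (Real.rpow_nonneg (Nat.cast_nonneg _) _)
      (pathFactor_nonneg hε hς1 m _)) (h m)
  rw [← ENNReal.ofReal_toReal hfin]
  exact ENNReal.ofReal_le_ofReal (le_ciInf hle)

/-- Pathwise oracle inequality for the integrated losses. -/
lemma sqNorm_oracle (hD : D.IsRegular) (hφ : D.IsEmpOrthonormal φ) (hε : 0 ≤ ε) (hL : 0 ≤ L)
    (hS : S ∈ stabilitySet D.a D.b ε L) {e y : ℕ → ℝ} (hy : y = D.process S y0 e)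
    {δ : ℝ} (hδ : 0 < δ) (hδ1 : δ ≤ 1 / 12) {Λ : Finset (Fin D.d → ℝ)}
    (hΛ : ∀ lam ∈ Λ, ∀ j, lam j ∈ Set.Icc (0 : ℝ) 1) {lam lam' : Fin D.d → ℝ} (hl : lam ∈ Λ)
    (hl' : lam' ∈ Λ) (hJ : D.cost φ δ y lam' ≤ D.cost φ δ y lam)
    (hne : (Finset.range D.n).Nonempty) {N ψ : Fin D.d → ℝ} {p : ℝ}
    (hN : N = noiseCoef (D.basisMat φ) D.step D.n (fun l k => D.wt (l + 1) k y) fun k => e (k + 1))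
    (hψ : ψ = energyCoef (D.basisMat φ) D.step D.n (fun l k => D.wt (l + 1) k y))
    (hp : p = D.step / (2 * Real.sqrt D.n * (2 + Real.log D.n))) :
    D.sqNorm (fun t => D.wls φ lam' y t - S t) ≤
      (1 + 4 * δ) * (1 + δ) ^ 2 / (1 - 6 * δ) * D.sqNorm (fun t => D.wls φ lam y t - S t) +
      (5 * ((D.b - D.a) * (L * D.step) ^ 2) + 325 * ((D.b - D.a) * (2 * (L * D.h) ^ 2 +
        8 * (Finset.range D.n).sup' hne (fun i => y i ^ 4) * (8 / Real.sqrt D.n) ^ 2) +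
        D.martRem φ S Λ lam N ψ p)) / δ := by
  have hlog := Real.log_natCast_nonneg D.n
  have hsq := D.sqrt_pos hn
  have hp0 : 0 < p := by
    rw [hp]
    have := step_pos hab hn
    positivity
  set Y4 := (Finset.range D.n).sup' hne (fun i => y i ^ 4)
  have hY4 : ∀ i < D.n, y i ^ 4 ≤ Y4 := fun i hi =>
    Finset.le_sup' (fun i => y i ^ 4) (Finset.mem_range.2 hi)
  have hY40 : 0 ≤ Y4 := (by positivity : 0 ≤ y 0 ^ 4).trans (hY4 0 hn)
  have hba : 0 ≤ D.b - D.a := by linarith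
  have hterm : ∀ mu ∈ Λ, 0 ≤ devQuad N ψ p mu + devQuad N ψ p (fun j => mu j ^ 2) +
      devLin (D.coef φ S) N (fun j => mu j - lam j) := fun mu _ =>
    add_nonneg (add_nonneg (devQuad_nonneg _ _ hp0 _) (devQuad_nonneg _ _ hp0 _))
      (devLin_nonneg _ _ _)
  have hmart : devQuad N ψ p lam' + devQuad N ψ p lam + devQuad N ψ p (fun j => lam' j ^ 2) +
        devQuad N ψ p (fun j => lam j ^ 2) + devLin (D.coef φ S) N (fun j => lam' j - lam j) +
        devLin (D.coef φ S) N (fun j => lam j * (1 - lam j)) ≤ D.martRem φ S Λ lam N ψ p := by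
    -- The selected weight is random, but its deviations are nonnegative and hence dominated by the
    -- sum over the fixed set `Λ`.
    have := Finset.single_le_sum hterm hl'
    unfold martRem
    linarith
  have hmart0 : 0 ≤ D.martRem φ S Λ lam N ψ p := add_nonneg
    (add_nonneg (add_nonneg (devQuad_nonneg _ _ hp0 _) (devQuad_nonneg _ _ hp0 _))
      (devLin_nonneg _ _ _)) (Finset.sum_nonneg hterm)
  have hR0 : 0 ≤ (D.b - D.a) * (2 * (L * D.h) ^ 2 + 8 * Y4 * (8 / Real.sqrt D.n) ^ 2) +
      D.martRem φ S Λ lam N ψ p := by positivity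
  have hE0 : 0 ≤ (D.b - D.a) * (L * D.step) ^ 2 := by positivity
  obtain ⟨hρ, -⟩ := oracle_const_bounds hδ hδ1
  by_cases hΓ : y ∈ D.Gamma
  · refine integrated_oracle_arith hδ hδ1 hE0 hR0
      (sqNorm_wls_bounds hab hn φ lam' y hδ hL hS).1 (sqNorm_wls_bounds hab hn φ lam y hδ hL hS).2 ?_
    refine (gridLoss_oracle hab hn hD hφ hε hL hS hy hΓ (M := Real.sqrt Y4) (fun i hi => ?_) hδ hδ1
      (hΛ _ hl) (hΛ _ hl') hJ hN hψ hp).trans (add_le_add_right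
        (mul_le_mul_of_nonneg_left ?_ (by positivity)) _)
    · refine Real.le_sqrt_of_sq_le ((hY4 i hi).trans' (le_of_eq ?_))
      ring
    · rw [Real.sq_sqrt hY40]
      linarith
  · rw [wls_of_notMem_Gamma φ lam' lam hΓ]
    have h0 := sqNorm_nonneg hab fun t => D.wls φ lam y t - S t
    have h1 : 1 ≤ (1 + 4 * δ) * (1 + δ) ^ 2 / (1 - 6 * δ) := by
      rw [mul_div_right_comm]
      exact one_le_mul_of_one_le_of_one_le hρ (one_le_pow₀ (by linarith))
    refine le_add_of_le_of_nonneg (le_mul_of_one_le_left h0 h1) ?_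
    positivity

lemma risk_le_of_isRegular {ς : ℕ → ℝ} {ν : ℕ → ℕ} {p : ℝ → ℝ} (hε : 0 < ε) (hε1 : ε < 1)
    (hL : 0 ≤ L) (hς1 : ∀ n, 1 ≤ ς n) (hp : IsNoiseDensity (ς D.n) p) (hξ : IsNoise P p ξ)
    (hS : S ∈ stabilitySet D.a D.b ε L) (hD : D.IsRegular) (hφ : D.IsEmpOrthonormal φ)
    (hy : ∀ ω, y ω = D.process S y0 (fun k => ξ k ω))
    {δ : ℝ} (hδ : 0 < δ) (hδ1 : δ ≤ 1 / 12) {Λ : Finset (Fin D.d → ℝ)} (hcard : Λ.card = ν D.n)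
    (hΛ : ∀ lam ∈ Λ, ∀ j, lam j ∈ Set.Icc (0 : ℝ) 1) {lam : Fin D.d → ℝ} (hl : lam ∈ Λ)
    {lamHat : Ω → Fin D.d → ℝ} (hsel : D.IsSelector φ δ Λ y lamHat) :
    D.risk P (fun ω => D.wls φ (lamHat ω) (y ω)) S ≤
      ENNReal.ofReal ((1 + 4 * δ) * (1 + δ) ^ 2 / (1 - 6 * δ)) *
        D.risk P (fun ω => D.wls φ lam (y ω)) S +
      ENNReal.ofReal (mainBound D.a D.b ε L y0 ς ν D.n / (δ * D.n)) := by
  have hne : (Finset.range D.n).Nonempty := Finset.nonempty_range_iff.2 (by omega)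
  have hn0 : (0 : ℝ) < D.n := by exact_mod_cast hn
  have hba : 0 < D.b - D.a := by linarith
  have hς0 : 0 ≤ 3 * ς D.n ^ 2 := by positivity
  have hstd := isStdNoise hp hξ (hς1 D.n)
  obtain ⟨hMi, hMle⟩ := integral_martRem_le hab hn hD hφ hς0 hstd hy Λ lam rfl
  set Mart : Ω → ℝ := fun ω => D.martRem φ S Λ lam
    (noiseCoef (D.basisMat φ) D.step D.n (fun l k => D.wt (l + 1) k (y ω)) fun k => ξ (k + 1) ω)
    (energyCoef (D.basisMat φ) D.step D.n (fun l k => D.wt (l + 1) k (y ω)))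
    (D.step / (2 * Real.sqrt D.n * (2 + Real.log D.n))) with hMart
  set Y4 : Ω → ℝ := fun ω => (Finset.range D.n).sup' hne fun i => y ω i ^ 4 with hY4
  set κ := (1 + 4 * δ) * (1 + δ) ^ 2 / (1 - 6 * δ)
  have hκ : 0 ≤ κ := div_nonneg (by positivity) (by linarith)
  set c0 := (5 * ((D.b - D.a) * (L * D.step) ^ 2) +
    325 * ((D.b - D.a) * (2 * (L * D.h) ^ 2))) / δ with hc0
  set c1 := 325 * ((D.b - D.a) * (8 * (8 / Real.sqrt D.n) ^ 2)) / δ with hc1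
  have hc1nn : 0 ≤ c1 := by positivity
  have hY4m : Measurable Y4 := by
    have hym : ∀ i, Measurable fun ω => y ω i := fun i => by
      simp only [hy]
      exact D.measurable_process S y0 fun j _ => hstd.measurable j
    have := Finset.measurable_sup' hne (f := fun i ω => y ω i ^ 4) fun i _ => (hym i).pow_const 4
    convert this using 1
    ext ω
    simp [hY4, Finset.sup'_apply]
  have hpath : ∀ ω, D.sqNorm (fun t => D.wls φ (lamHat ω) (y ω) t - S t) ≤
      κ * D.sqNorm (fun t => D.wls φ lam (y ω) t - S t) +
        (c1 * Y4 ω + (c0 + 325 / δ * Mart ω)) := fun ω => by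
    refine (sqNorm_oracle hab hn hD hφ hε.le hL hS (hy ω) hδ hδ1 hΛ hl (hsel.mem ω)
      (hsel.le ω lam hl) hne rfl rfl rfl).trans (le_of_eq ?_)
    rw [hc0, hc1]
    ring
  have hAi : Integrable (fun ω => c0 + 325 / δ * Mart ω) P :=
    (integrable_const c0).add (hMi.const_mul _)
  have hrem : ∫⁻ ω, ENNReal.ofReal (c1 * Y4 ω + (c0 + 325 / δ * Mart ω)) ∂P ≤
      ENNReal.ofReal (mainBound D.a D.b ε L y0 ς ν D.n / (δ * D.n)) := by
    have hMart0 : ∀ ω, 0 ≤ c0 + 325 / δ * Mart ω := fun ω => by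
      have hlog := Real.log_natCast_nonneg D.n
      have hsq := D.sqrt_pos hn
      have hstep := step_pos hab hn
      have hp0 : 0 < D.step / (2 * Real.sqrt D.n * (2 + Real.log D.n)) := by positivity
      have : 0 ≤ Mart ω := add_nonneg (add_nonneg (add_nonneg (devQuad_nonneg _ _ hp0 _)
        (devQuad_nonneg _ _ hp0 _)) (devLin_nonneg _ _ _)) (Finset.sum_nonneg fun mu _ =>
          add_nonneg (add_nonneg (devQuad_nonneg _ _ hp0 _) (devQuad_nonneg _ _ hp0 _))
            (devLin_nonneg _ _ _))
      positivity
    have hpb : 0 ≤ pathBound y0 ε ς D.n := Real.iInf_nonneg fun m =>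
      mul_nonneg (Real.rpow_nonneg hn0.le _) (pathFactor_nonneg hε hς1 m _)
    calc _ ≤ ∫⁻ ω, (ENNReal.ofReal c1 * ENNReal.ofReal (Y4 ω) +
          ENNReal.ofReal (c0 + 325 / δ * Mart ω)) ∂P := lintegral_mono fun ω => by
            rw [← ENNReal.ofReal_mul hc1nn]
            exact ENNReal.ofReal_add_le
      _ = ENNReal.ofReal c1 * ∫⁻ ω, ENNReal.ofReal (Y4 ω) ∂P +
          ENNReal.ofReal (∫ ω, (c0 + 325 / δ * Mart ω) ∂P) := by
            rw [lintegral_add_left (hY4m.ennreal_ofReal.const_mul _),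
              lintegral_const_mul' _ _ ENNReal.ofReal_ne_top,
              ofReal_integral_eq_lintegral_ofReal hAi (Eventually.of_forall hMart0)]
      _ ≤ ENNReal.ofReal c1 * ENNReal.ofReal (pathBound y0 ε ς D.n) +
          ENNReal.ofReal (∫ ω, (c0 + 325 / δ * Mart ω) ∂P) := by
            gcongr
            exact lintegral_sup'_process_le hab hn hε hε1 hς1 hp hξ hS hy hne
      _ = ENNReal.ofReal (c1 * pathBound y0 ε ς D.n + ∫ ω, (c0 + 325 / δ * Mart ω) ∂P) := by
            rw [← ENNReal.ofReal_mul hc1nn, ENNReal.ofReal_add (mul_nonneg hc1nn hpb)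
              (integral_nonneg hMart0)]
      _ ≤ _ := by
            refine ENNReal.ofReal_le_ofReal ?_
            rw [integral_add (integrable_const c0) (hMi.const_mul _), integral_const_mul]
            simp only [integral_const, probReal_univ, one_smul]
            have hM' := mul_le_mul_of_nonneg_left hMle (by positivity : 0 ≤ 325 / δ)
            have hst := mul_le_mul_of_nonneg_left (step_sq_le hab hn)
              (by positivity : 0 ≤ (D.b - D.a) * L ^ 2)
            have hh : D.h = D.step / 2 := by
              unfold h step
              ring
            have hc0' : c0 ≤ (20 * (D.b - D.a) ^ 3 * L ^ 2 +
                325 * (2 * (D.b - D.a) ^ 3 * L ^ 2)) / (δ * D.n) := by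
              rw [hc0, hh, ← div_div, div_right_comm]
              refine div_le_div_of_nonneg_right ?_ hδ.le
              have e : (20 * (D.b - D.a) ^ 3 * L ^ 2 + 325 * (2 * (D.b - D.a) ^ 3 * L ^ 2)) /
                  (D.n : ℝ) = (5 + 325 / 2) * ((D.b - D.a) * L ^ 2 *
                    (4 * (D.b - D.a) ^ 2 / D.n)) := by ring
              rw [e]
              linarith
            have hc1' : c1 * pathBound y0 ε ς D.n =
                325 * (512 * (D.b - D.a) * pathBound y0 ε ς D.n) / (δ * D.n) := by
              rw [hc1, div_pow, Real.sq_sqrt hn0.le]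
              field_simp
              ring
            rw [hcard] at hM'
            have e2 : mainBound D.a D.b ε L y0 ς ν D.n / (δ * D.n) =
                325 * (512 * (D.b - D.a) * pathBound y0 ε ς D.n) / (δ * D.n) +
                ((20 * (D.b - D.a) ^ 3 * L ^ 2 +
                325 * (2 * (D.b - D.a) ^ 3 * L ^ 2)) / (δ * D.n) +
                325 / δ * (((ν D.n : ℝ) + 1) * (512 * (D.b - D.a) * (2 * (3 * ς D.n ^ 2) + 16) *
                  (2 + Real.log D.n) + 32 * (D.b - D.a)) / D.n)) := by
              unfold mainBound
              field_simp
              ring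
            rw [hc1', e2]
            exact add_le_add_right (add_le_add hc0' hM') _
  -- Only the remainder must be measurable for the integral of the sum to split; measurability of
  -- the losses is not needed.
  have hmeas : AEMeasurable (fun ω => ENNReal.ofReal (c1 * Y4 ω + (c0 + 325 / δ * Mart ω))) P :=
    ((hY4m.const_mul c1).aemeasurable.add hAi.aemeasurable).ennreal_ofReal
  unfold risk
  calc _ ≤ ∫⁻ ω, (ENNReal.ofReal κ *
          ENNReal.ofReal (D.sqNorm fun t => D.wls φ lam (y ω) t - S t) +
        ENNReal.ofReal (c1 * Y4 ω + (c0 + 325 / δ * Mart ω))) ∂P := lintegral_mono fun ω => by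
          rw [← ENNReal.ofReal_mul hκ]
          exact (ENNReal.ofReal_le_ofReal (hpath ω)).trans ENNReal.ofReal_add_le
    _ = ENNReal.ofReal κ * ∫⁻ ω, ENNReal.ofReal (D.sqNorm fun t => D.wls φ lam (y ω) t - S t) ∂P +
        ∫⁻ ω, ENNReal.ofReal (c1 * Y4 ω + (c0 + 325 / δ * Mart ω)) ∂P := by
          rw [lintegral_add_right' _ hmeas, lintegral_const_mul' _ _ ENNReal.ofReal_ne_top]
    _ ≤ _ := add_le_add_right hrem _

/-- For irregular designs the whole risk is put into the remainder. The leading factor `n` in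
`crudeBound` cancels the `n` in the denominator. -/
lemma risk_le_crude {ς : ℝ} {p : ℝ → ℝ} (hε : 0 < ε) (hε1 : ε < 1)
    (hL : 0 ≤ L) (hς1 : 1 ≤ ς) (hp : IsNoiseDensity ς p) (hξ : IsNoise P p ξ)
    (hS : S ∈ stabilitySet D.a D.b ε L) (hφ : D.IsEmpOrthonormal φ)
    (hy : ∀ ω, y ω = D.process S y0 (fun k => ξ k ω))
    {δ : ℝ} (hδ : 0 < δ) (hδ1 : δ ≤ 1 / 12) {lamHat : Ω → Fin D.d → ℝ}
    (hl : ∀ ω j, lamHat ω j ∈ Set.Icc (0 : ℝ) 1) :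
    D.risk P (fun ω => D.wls φ (lamHat ω) (y ω)) S ≤
      ENNReal.ofReal (crudeBound D.a D.b ε L y0 D.n / (δ * D.n)) := by
  have hn0 : (0 : ℝ) < D.n := by exact_mod_cast hn
  have hba : 0 < D.b - D.a := by linarith
  have hstd := isStdNoise hp hξ hς1
  have hS1 : ∀ t ∈ Set.Icc D.a D.b, |S t| ≤ 1 := fun t ht => (hS.2.1 t ht).trans (by linarith)
  have hmom : ∀ i, HasAllMoments (fun ω => y ω i) P := fun i => by
    simp only [hy]
    exact D.process_moments hstd i
  have hsum : HasAllMoments (fun ω => ∑ i ∈ Finset.range D.n, y ω (i + 1) ^ 2) P :=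
    HasAllMoments.sum _ fun i _ => (hmom (i + 1)).sq
  have hsum_le : ∫ ω, ∑ i ∈ Finset.range D.n, y ω (i + 1) ^ 2 ∂P ≤
      D.n * (y0 ^ 2 + 1 / ε ^ 2) := by
    rw [integral_finsetSum _ fun i _ => (hmom (i + 1)).sq.integrable]
    refine (Finset.sum_le_card_nsmul _ _ (y0 ^ 2 + 1 / ε ^ 2) fun i hi => ?_).trans
      (le_of_eq (by rw [Finset.card_range, nsmul_eq_mul]))
    have := D.integral_process_pow_le hstd (S := S) (y0 := y0) hε hε1 (N := D.n)
      (m := 1) (C := 1) (fun i hi => hS.2.1 _ (x_mem hab hn hi))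
      (fun k => (hstd.var k).le) zero_le_one (Finset.mem_range.1 hi)
    simpa only [hy, mul_one] using this
  have hstep : D.step ≤ D.b - D.a := by
    have : (1 : ℝ) ≤ D.d := by exact_mod_cast D.d_pos hn
    exact div_le_self hba.le this
  have hE : (D.b - D.a) * (L * D.step) ^ 2 ≤ (D.b - D.a) * (L * (D.b - D.a)) ^ 2 := by
    have := step_nonneg hab
    gcongr
  have hδinv : 1 ≤ 1 / δ := by
    rw [le_div_iff₀ hδ]
    linarith
  have hpath : ∀ ω, D.sqNorm (fun t => D.wls φ (lamHat ω) (y ω) t - S t) ≤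
      2 / δ * ((D.b - D.a) * (L * (D.b - D.a)) ^ 2) + 2 / δ * (2 * (D.b - D.a)) +
        2 / δ * (4 * (D.b - D.a)) * ∑ i ∈ Finset.range D.n, y ω (i + 1) ^ 2 := fun ω => by
    have h0 : 0 ≤ ∑ i ∈ Finset.range D.n, y ω (i + 1) ^ 2 :=
      Finset.sum_nonneg fun _ _ => sq_nonneg _
    have h1 := (sqNorm_wls_bounds hab hn φ (lamHat ω) (y ω) hδ hL hS).1
    have h2 := gridLoss_crude hab hn hφ hS1 (y ω) (hl ω)
    have h3 : (1 + δ) * D.gridLoss (D.wlsGrid φ (lamHat ω) (y ω)) S ≤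
        2 / δ * ((D.b - D.a) * (4 * ∑ i ∈ Finset.range D.n, y ω (i + 1) ^ 2 + 2)) := by
      refine (mul_le_mul_of_nonneg_left h2 (by linarith)).trans
        (mul_le_mul_of_nonneg_right ?_ (by positivity))
      have e : 2 / δ = 2 * (1 / δ) := by ring
      rw [e]
      linarith
    have h4 : (1 + 1 / δ) * ((D.b - D.a) * (L * D.step) ^ 2) ≤
        2 / δ * ((D.b - D.a) * (L * (D.b - D.a)) ^ 2) := by
      refine mul_le_mul ?_ hE (by positivity) (by positivity)
      have e : 2 / δ = 2 * (1 / δ) := by ring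
      rw [e]
      linarith
    linarith
  unfold risk
  have hAi := (HasAllMoments.const (P := P) (2 / δ * ((D.b - D.a) * (L * (D.b - D.a)) ^ 2) +
    2 / δ * (2 * (D.b - D.a)))).add (hsum.const_mul (2 / δ * (4 * (D.b - D.a))))
  refine (lintegral_mono fun ω => ENNReal.ofReal_le_ofReal (hpath ω)).trans ?_
  rw [← ofReal_integral_eq_lintegral_ofReal hAi.integrable (Eventually.of_forall fun ω =>
    (sqNorm_nonneg hab _).trans (hpath ω))]
  refine ENNReal.ofReal_le_ofReal ?_
  rw [(HasAllMoments.const (P := P) _).integral_add (hsum.const_mul _), integral_const_mul]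
  simp only [integral_const, probReal_univ, one_smul]
  have h5 := mul_le_mul_of_nonneg_left hsum_le (by positivity : 0 ≤ 2 / δ * (4 * (D.b - D.a)))
  refine (add_le_add_right h5 _).trans (le_of_eq ?_)
  unfold crudeBound
  field_simp
  ring

end Risk

end Design

end SeqAR

theorem mainTheorem3
    (a b : ℝ) (hab : a < b) (ε L mu0 y0 : ℝ) (hε0 : 0 < ε) (hε1 : ε < 1) (hL : 0 < L)
    (hmu0 : 0 < mu0) (hmu1 : mu0 < 1)
    (ς : ℕ → ℝ) (hς1 : ∀ n, 1 ≤ ς n)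
    (hς : ∀ r : ℝ, 0 < r → Tendsto (fun n : ℕ => ς n / (n : ℝ) ^ r) atTop (𝓝 0))
    (ν : ℕ → ℕ)
    (hν : ∀ r : ℝ, 0 < r → Tendsto (fun n : ℕ => (ν n : ℝ) / (n : ℝ) ^ r) atTop (𝓝 0)) :
    ∃ B : ℕ → (ℝ → ℝ) → ℝ,
      (∀ p : ℝ → ℝ, ∀ r : ℝ, 0 < r →
        Tendsto (fun n : ℕ => B n p / (n : ℝ) ^ r) atTop (𝓝 0)) ∧
      ∀ n : ℕ, 3 ≤ n → ∀ p : ℝ → ℝ, SeqAR.IsNoiseDensity (ς n) p →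
      ∀ S ∈ SeqAR.stabilitySet a b ε L,
      ∀ δ : ℝ, 0 < δ → δ ≤ 1 / 12 →
      ∀ D : SeqAR.Design, D = ⟨a, b, mu0, n⟩ →
      ∀ φ : Fin D.d → ℝ → ℝ, D.IsEmpOrthonormal φ →
      ∀ Λ : Finset (Fin D.d → ℝ), Λ.Nonempty → Λ.card = ν n →
        (∀ lam ∈ Λ, ∀ j, lam j ∈ Set.Icc (0 : ℝ) 1) →
      ∀ (Ω : Type*) [MeasurableSpace Ω] (P : Measure Ω) [IsProbabilityMeasure P]
        (ξ : ℕ → Ω → ℝ), SeqAR.IsNoise P p ξ →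
      ∀ y : Ω → ℕ → ℝ, (∀ ω, y ω = D.process S y0 (fun k => ξ k ω)) →
      ∀ lamHat : Ω → Fin D.d → ℝ, D.IsSelector φ δ Λ y lamHat →
        D.risk P (fun ω => D.wls φ (lamHat ω) (y ω)) S ≤
          ENNReal.ofReal ((1 + 4 * δ) * (1 + δ) ^ 2 / (1 - 6 * δ)) *
              (⨅ lam ∈ Λ, D.risk P (fun ω => D.wls φ lam (y ω)) S)
            + ENNReal.ofReal (B n p / (δ * n)) := by
  -- The density enters the estimates only through `ς n`, so the remainder can be chosen independent
  -- of `p`.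
  refine ⟨fun n _ => SeqAR.remainderBound a b ε L mu0 y0 ς ν n, fun _ =>
    SeqAR.isSubPoly_remainderBound hab hmu1 hε0 hς1 hς hν, ?_⟩
  intro n hn p hp S hS δ hδ hδ1 D hD φ hφ Λ hΛne hcard hΛ Ω _ P _ ξ hξ y hy lamHat hsel
  subst hD
  have hn1 : 1 ≤ n := by omega
  by_cases hreg : (⟨a, b, mu0, n⟩ : SeqAR.Design).IsRegular
  · obtain ⟨lam, hl, hmin⟩ := Finset.exists_min_image Λ
      (fun lam => SeqAR.Design.risk ⟨a, b, mu0, n⟩ P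
        (fun ω => SeqAR.Design.wls ⟨a, b, mu0, n⟩ φ lam (y ω)) S) hΛne
    have h := SeqAR.Design.risk_le_of_isRegular (D := ⟨a, b, mu0, n⟩) hab hn1 hε0 hε1 hL.le hς1 hp
      hξ hS hreg hφ hy hδ hδ1 hcard hΛ hl hsel
    beta_reduce
    rw [SeqAR.remainderBound, if_pos hreg]
    exact h.trans (add_le_add_left (mul_le_mul_right (le_iInf₂ hmin) _) _)
  · beta_reduce
    rw [SeqAR.remainderBound, if_neg hreg]
    exact (SeqAR.Design.risk_le_crude (D := ⟨a, b, mu0, n⟩) hab hn1 hε0 hε1 hL.le (hς1 n) hp hξ hS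
      hφ hy hδ hδ1 fun ω j => hΛ _ (hsel.mem ω) j).trans le_add_self
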